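/- Let $\mathbb{CP}^2$ be the complex projective plane with the Fubini–Study metric $g$, normalized to have diameter $\frac{\pi}{2}$: in an affine chart with coordinates $w\in\mathbb{C}^2$, $$g_w(u,v)=\operatorname{Re}\frac{(1+|w|^2)\langle u,v\rangle-\langle u,w\rangle\langle w,v\rangle}{(1+|w|^2)^2}.$$ For $0<r<\frac{\pi}{2}$ let $$\phi_{1,4}(r):=\frac{3^{3/4}\,e^{\frac{\pi}{2\sqrt3}}\,\sin(r)\,\exp\Big(-\tfrac12\sqrt3\,\arctan\Big(\frac{2\cos^{2/3}(r)+1}{\sqrt3}\Big)\Big)}{\sqrt{1-\cos^{2/3}(r)}\;\cos^{1/3}(r)\;\big(\cos^{2/3}(r)+\cos^{4/3}(r)+1\big)^{5/4}},$$ and extend it to $r=0$ by continuity. For a point $P\in\mathbb{CP}^2$ let $r_P(Q)$ be the geodesic distance from $P$ to $Q$, let $\iota_P$ be the injectivity radius of $(\mathbb{CP}^2,g)$ at $P$, let $B_P=\{Q: r_P(Q)<\iota_P\}$, and let $\tilde g:=\phi_{1,4}(r_P)^2 g$ on $B_P$. Then $\lim_{r\downarrow0}\phi_{1,4}(r)=1$,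 that is, $\phi_{1,4}(0)=1$. For every $P\in\mathbb{CP}^2$ one has $\iota_P=\frac{\pi}{2}$, the set $B_P$ is open, $\phi_{1,4}(r_P)$ is a smooth positive function on $B_P$, and $\tilde g$ is a smooth Riemannian metric on $B_P$. Let $\tilde\iota$ be the injectivity radius at $P$ of $(B_P,\tilde g)$, i.e. the supremum of the radii $\rho$ for which the exponential map of $(B_P,\tilde g)$ at $P$ is defined on the ball of radius $\rho$ in $T_P\mathbb{CP}^2$ and is a diffeomorphism from it onto an open set. For every $\tilde g$-orthonormal basis $e_1,\dots,e_4$ of $T_P\mathbb{CP}^2$, the geodesic coordinates $x\mapsto\exp_P(x^1e_1+\dots+x^4e_4)$ of $(B_P,\tilde g)$ map the ball $\{x\in\mathbb{R}^4:|x|<\tilde\iota\}$ diffeomorphically onto all of $B_P$, and in these coordinates the volume density function of $\tilde g$ satisfies $$\tilde\Theta:=\det\big(\tilde g(\partial_{x^i},\partial_{x^j})\big)^{1/2}=1\quad\text{at every point of } B_P .$$ -/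

import Mathlib

open Set Filter Topology Manifold ContDiff ENNReal

noncomputable section

namespace RadialDeformation

/-! ## Riemannian geometry on an open subset of a manifold

`M` is a smooth manifold modelled on the real normed space `E`, `U` is an open subset of `M` and
`g` is a field of bilinear forms on the tangent spaces of `M`, of which only the values on `U`
matter: the Riemannian manifold under consideration is `(U, g)`. -/

section Riemannian

variable {E : Type*} [NormedAddCommGroup E] [NormedSpace ℝ E]
  {M : Type*} [TopologicalSpace M] [ChartedSpace E M]

/-- A field of (continuous) bilinear forms on the tangent spaces of `M`. -/
abbrev MetricField (E : Type*) [NormedAddCommGroup E] [NormedSpace ℝ E]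
    (M : Type*) [TopologicalSpace M] [ChartedSpace E M] : Type _ :=
  ∀ x : M, TangentSpace 𝓘(ℝ, E) x →L[ℝ] TangentSpace 𝓘(ℝ, E) x →L[ℝ] ℝ

/-- The expression of `g` in the chart `e`, at the point `x` of the target of `e`:
the pullback of `g` under the parametrization `e.symm`. -/
def chartMetric (g : MetricField E M) (e : OpenPartialHomeomorph M E) (x u v : E) : ℝ :=
  g (e.symm x) (mfderiv 𝓘(ℝ, E) 𝓘(ℝ, E) e.symm x u) (mfderiv 𝓘(ℝ, E) 𝓘(ℝ, E) e.symm x v)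

/-- `g` is a smooth Riemannian metric on the open set `U`. -/
structure IsRiemannianMetricOn (g : MetricField E M) (U : Set M) : Prop where
  isOpen : IsOpen U
  symm : ∀ x ∈ U, ∀ u v : TangentSpace 𝓘(ℝ, E) x, g x u v = g x v u
  pos : ∀ x ∈ U, ∀ u : TangentSpace 𝓘(ℝ, E) x, u ≠ 0 → 0 < g x u u
  smooth : ∀ e ∈ IsManifold.maximalAtlas 𝓘(ℝ, E) ∞ M, ∀ u v : E,
    ContDiffOn ℝ ∞ (fun x => chartMetric g e x u v) (e.target ∩ e.symm ⁻¹' U)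

/-- The length `g(u, u)^{1/2}` of a tangent vector. -/
def vectorNorm (g : MetricField E M) (x : M) (u : TangentSpace 𝓘(ℝ, E) x) : ℝ :=
  Real.sqrt (g x u u)

/-- The geodesic distance on `(M, g)`: the infimum of the lengths of the `C¹` paths
from `P` to `Q`. -/
def geodesicEDist (g : MetricField E M) (P Q : M) : ℝ≥0∞ :=
  letI : ∀ x : M, ENorm (TangentSpace 𝓘(ℝ, E) x) :=
    fun x => ⟨fun u => ENNReal.ofReal (vectorNorm g x u)⟩
  riemannianEDist 𝓘(ℝ, E) P Q

/-- `γ` is, on the open set `J` of times, a geodesic of `(U, g)`: a smooth curve in `U` which in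
every chart solves the geodesic equation
`d/dt (g_{lk} γ'^l) = 1/2 ∂_k g_{ij} γ'^i γ'^j`, that is,
`g_{kl} (γ''^l + Γ^l_{ij} γ'^i γ'^j) = 0` with the Christoffel symbols of `g`.
Here `∂_k` is replaced by the derivative in the direction of an arbitrary constant vector `X`. -/
structure IsGeodesicOn (g : MetricField E M) (U : Set M) (γ : ℝ → M) (J : Set ℝ) : Prop where
  mapsTo : MapsTo γ J U
  smooth : ContMDiffOn 𝓘(ℝ, ℝ) 𝓘(ℝ, E) ∞ γ J
  equation : ∀ e ∈ IsManifold.maximalAtlas 𝓘(ℝ, E) ∞ M, ∀ t ∈ J, γ t ∈ e.source → ∀ X : E,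
    HasDerivAt (fun s => chartMetric g e (e (γ s)) (deriv (fun τ => e (γ τ)) s) X)
      (1 / 2 * fderiv ℝ (fun x => chartMetric g e x (deriv (fun τ => e (γ τ)) t)
        (deriv (fun τ => e (γ τ)) t)) (e (γ t)) X) t

/-- `γ` is a geodesic of `(U, g)`, defined on an open interval containing `[0, 1]`, which starts at
`P` with velocity `v`. -/
def IsGeodesicFrom (g : MetricField E M) (U : Set M) (P : M) (v : TangentSpace 𝓘(ℝ, E) P)
    (γ : ℝ → M) : Prop :=
  (∃ ε > 0, IsGeodesicOn g U γ (Ioo (-ε) (1 + ε))) ∧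
    (⟨γ 0, mfderiv 𝓘(ℝ, ℝ) 𝓘(ℝ, E) γ 0 (1 : ℝ)⟩ : TangentBundle 𝓘(ℝ, E) M) = ⟨P, v⟩

/-- The domain of the exponential map of `(U, g)` at `P`. -/
def expDomain (g : MetricField E M) (U : Set M) (P : M) : Set (TangentSpace 𝓘(ℝ, E) P) :=
  {v | ∃ γ, IsGeodesicFrom g U P v γ}

open Classical in
/-- The exponential map `v ↦ γ_v(1)` of `(U, g)` at `P`; it takes the value `P` outside its
domain. -/
def expMap (g : MetricField E M) (U : Set M) (P : M) (v : TangentSpace 𝓘(ℝ, E) P) : M :=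
  if h : ∃ γ, IsGeodesicFrom g U P v γ then h.choose 1 else P

/-- The open ball of radius `ρ` about `0` in `T_P M`. -/
def tangentBall (g : MetricField E M) (P : M) (ρ : ℝ≥0∞) : Set (TangentSpace 𝓘(ℝ, E) P) :=
  {v | ENNReal.ofReal (vectorNorm g P v) < ρ}

/-- The injectivity radius of `(U, g)` at `P`: the supremum of the radii `ρ` such that `exp_P` is
defined on the ball of radius `ρ` in `T_P M` and is a diffeomorphism from it onto an open set. -/
def injRadius (g : MetricField E M) (U : Set M) (P : M) : ℝ≥0∞ :=
  sSup {ρ : ℝ≥0∞ | tangentBall g P ρ ⊆ expDomain g U P ∧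
    InjOn (expMap g U P) (tangentBall g P ρ) ∧
    IsLocalDiffeomorphOn 𝓘(ℝ, E) 𝓘(ℝ, E) ∞ (fun v : E => expMap g U P v) (tangentBall g P ρ)}

/-- `B_{M,P}`: the points of `(M, g)` whose distance from `P` is less than the injectivity radius
at `P`. -/
def injBall (g : MetricField E M) (P : M) : Set M :=
  {Q | geodesicEDist g P Q < injRadius g univ P}

/-- `e` is a `g`-orthonormal family in `T_P M`. -/
def IsOrthonormalFrame {m : ℕ} (g : MetricField E M) (P : M)
    (e : Fin m → TangentSpace 𝓘(ℝ, E) P) : Prop :=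
  ∀ i j, g P (e i) (e j) = if i = j then 1 else 0

/-- Geodesic coordinates of `(U, g)` centered at `P`:
`(x¹, …, xᵐ) ↦ exp_P (x¹ e₁ + ⋯ + xᵐ eₘ)`. -/
def geodesicCoord {m : ℕ} (g : MetricField E M) (U : Set M) (P : M)
    (e : Fin m → TangentSpace 𝓘(ℝ, E) P) (x : EuclideanSpace ℝ (Fin m)) : M :=
  expMap g U P (∑ i, x i • e i)

/-- The coordinate vector field `∂/∂xⁱ` of the geodesic coordinates, at the point with
coordinates `x`. -/
def coordVector {m : ℕ} (g : MetricField E M) (U : Set M) (P : M)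
    (e : Fin m → TangentSpace 𝓘(ℝ, E) P) (x : EuclideanSpace ℝ (Fin m)) (i : Fin m) :
    TangentSpace 𝓘(ℝ, E) (geodesicCoord g U P e x) :=
  mfderiv (𝓡 m) 𝓘(ℝ, E) (geodesicCoord g U P e) x (EuclideanSpace.single i (1 : ℝ))

/-- The volume density function `det(g_{ij})^{1/2}`, `g_{ij} = g(∂/∂xⁱ, ∂/∂xʲ)`, of `(U, g)` in
the geodesic coordinates centered at `P`, at the point with coordinates `x`. -/
def volumeDensity {m : ℕ} (g : MetricField E M) (U : Set M) (P : M)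
    (e : Fin m → TangentSpace 𝓘(ℝ, E) P) (x : EuclideanSpace ℝ (Fin m)) : ℝ :=
  Real.sqrt (Matrix.det (Matrix.of fun i j : Fin m =>
    g (geodesicCoord g U P e x) (coordVector g U P e x i) (coordVector g U P e x j)))

end Riemannian

/-! ## The complex projective plane -/

/-- The model space of the complex projective plane: `ℂ²`, of real dimension `4`. -/
abbrev Model : Type := EuclideanSpace ℂ (Fin 2)

/-- The complex projective plane: the space of complex lines in `ℂ³`. -/
abbrev CP2 : Type := Projectivization ℂ (EuclideanSpace ℂ (Fin 3))

/-- The quotient topology. -/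
instance : TopologicalSpace CP2 :=
  inferInstanceAs (TopologicalSpace
    (Quotient (projectivizationSetoid ℂ (EuclideanSpace ℂ (Fin 3)))))

/-- The homogeneous coordinate vector with `i`-th coordinate `1` and the other coordinates `w`. -/
def homVec (i : Fin 3) (w : Model) : EuclideanSpace ℂ (Fin 3) :=
  WithLp.toLp 2 (i.insertNth (α := fun _ => ℂ) 1 w.ofLp)

lemma homVec_same (i : Fin 3) (w : Model) : homVec i w i = 1 := by
  simp [homVec]

lemma homVec_succAbove (i : Fin 3) (w : Model) (j : Fin 2) :
    homVec i w (i.succAbove j) = w j := by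
  simp [homVec]

lemma homVec_ne_zero (i : Fin 3) (w : Model) : homVec i w ≠ 0 := fun h => by
  have := homVec_same i w
  simp [h] at this

/-- The affine coordinates `(z_j / z_i)_{j ≠ i}` of the line spanned by `z`. -/
def affineCoord (i : Fin 3) (z : EuclideanSpace ℂ (Fin 3)) : Model :=
  WithLp.toLp 2 fun j => z (i.succAbove j) / z i

lemma affineCoord_smul (i : Fin 3) (c : ℂ) (hc : c ≠ 0) (z : EuclideanSpace ℂ (Fin 3)) :
    affineCoord i (c • z) = affineCoord i z := by
  ext j
  simp [affineCoord, mul_div_mul_left _ _ hc]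

lemma affineCoord_homVec (i : Fin 3) (w : Model) : affineCoord i (homVec i w) = w := by
  ext j
  simp [affineCoord, homVec_same, homVec_succAbove]

lemma smul_homVec_affineCoord (i : Fin 3) (z : EuclideanSpace ℂ (Fin 3)) (hz : z i ≠ 0) :
    z i • homVec i (affineCoord i z) = z := by
  ext k
  rcases Fin.eq_self_or_eq_succAbove i k with rfl | ⟨j, rfl⟩
  · simp [homVec_same]
  · simp [homVec_succAbove, affineCoord, mul_div_cancel₀ _ hz]

lemma rep_mk (z : EuclideanSpace ℂ (Fin 3)) (hz : z ≠ 0) :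
    ∃ c : ℂ, c ≠ 0 ∧ (Projectivization.mk ℂ z hz).rep = c • z := by
  obtain ⟨a, ha⟩ := Projectivization.exists_smul_eq_mk_rep ℂ z hz
  exact ⟨a, a.ne_zero, ha.symm⟩

lemma isQuotientMap_mk : IsQuotientMap
    (fun z : {z : EuclideanSpace ℂ (Fin 3) // z ≠ 0} => (Projectivization.mk ℂ z.1 z.2 : CP2)) :=
  isQuotientMap_quotient_mk'

lemma isOpen_affineSource (i : Fin 3) : IsOpen {p : CP2 | p.rep i ≠ 0} := by
  rw [← isQuotientMap_mk.isOpen_preimage]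
  have : (fun z : {z : EuclideanSpace ℂ (Fin 3) // z ≠ 0} =>
      (Projectivization.mk ℂ z.1 z.2 : CP2)) ⁻¹' {p : CP2 | p.rep i ≠ 0} = {z | z.1 i ≠ 0} := by
    ext z
    obtain ⟨c, hc, h⟩ := rep_mk z.1 z.2
    simp [h, hc]
  rw [this]
  exact isOpen_ne_fun (by fun_prop) continuous_const

/-- The affine chart `[z] ↦ (z_j / z_i)_{j ≠ i}`, defined where `z_i ≠ 0`. -/
def affineChart (i : Fin 3) : OpenPartialHomeomorph CP2 Model where
  toFun p := affineCoord i p.rep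
  invFun w := Projectivization.mk ℂ (homVec i w) (homVec_ne_zero i w)
  source := {p | p.rep i ≠ 0}
  target := univ
  map_source' _ _ := mem_univ _
  map_target' w _ := by
    obtain ⟨c, hc, h⟩ := rep_mk (homVec i w) (homVec_ne_zero i w)
    simp [h, hc, homVec_same]
  left_inv' p hp := by
    conv_rhs => rw [← p.mk_rep]
    rw [Projectivization.mk_eq_mk_iff']
    refine ⟨(p.rep i)⁻¹, ?_⟩
    have h := congrArg (fun z => (p.rep i)⁻¹ • z) (smul_homVec_affineCoord i p.rep hp)
    simp only [smul_smul, inv_mul_cancel₀ hp, one_smul] at h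
    exact h.symm
  right_inv' w _ := by
    obtain ⟨c, hc, h⟩ := rep_mk (homVec i w) (homVec_ne_zero i w)
    simp only [h, affineCoord_smul i c hc, affineCoord_homVec]
  open_source := isOpen_affineSource i
  open_target := isOpen_univ
  continuousOn_toFun := by
    rw [isQuotientMap_mk.continuousOn_isOpen_iff (isOpen_affineSource i)]
    have h1 : ∀ z : {z : EuclideanSpace ℂ (Fin 3) // z ≠ 0},
        affineCoord i (Projectivization.mk ℂ z.1 z.2).rep = affineCoord i z.1 := by
      intro z
      obtain ⟨c, hc, h⟩ := rep_mk z.1 z.2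
      rw [h, affineCoord_smul i c hc]
    refine ContinuousOn.congr (f := fun z : {z : EuclideanSpace ℂ (Fin 3) // z ≠ 0} => affineCoord i z.1) ?_ (fun z _ => h1 z)
    refine (PiLp.continuous_toLp 2 _).comp_continuousOn (continuousOn_pi.2 fun j => ?_)
    refine ContinuousOn.div (by fun_prop) (by fun_prop) fun z hz => ?_
    obtain ⟨c, hc, h⟩ := rep_mk z.1 z.2
    have hz' : (Projectivization.mk ℂ z.1 z.2).rep i ≠ 0 := hz
    simpa [h, hc] using hz'
  continuousOn_invFun := by
    refine Continuous.continuousOn ?_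
    have h1 : Continuous (homVec i) := by
      refine (PiLp.continuous_toLp 2 _).comp (continuous_pi fun k => ?_)
      rcases Fin.eq_self_or_eq_succAbove i k with rfl | ⟨j, rfl⟩
      · simpa using continuous_const
      · simpa using (by fun_prop : Continuous fun w : Model => w j)
    exact isQuotientMap_mk.continuous.comp (h1.subtype_mk (homVec_ne_zero i))

lemma exists_rep_ne_zero (p : CP2) : ∃ i, p.rep i ≠ 0 := by
  by_contra! h
  exact p.rep_nonzero (by ext i; simpa using h i)

/-- The complex projective plane with the atlas of its three affine charts. -/
instance : ChartedSpace Model CP2 where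
  atlas := range affineChart
  chartAt p := affineChart (exists_rep_ne_zero p).choose
  mem_chart_source p := (exists_rep_ne_zero p).choose_spec
  chart_mem_atlas _ := mem_range_self _

instance : IsManifold 𝓘(ℝ, Model) ∞ CP2 := by
  refine isManifold_of_contDiffOn _ _ _ ?_
  rintro _ _ ⟨i, rfl⟩ ⟨j, rfl⟩
  have h1 : ∀ k, ContDiff ℝ ∞ (fun w : Model => homVec i w k) := by
    intro k
    rcases Fin.eq_self_or_eq_succAbove i k with rfl | ⟨l, rfl⟩
    · simpa only [homVec_same] using contDiff_const
    · simp only [homVec_succAbove]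
      exact ((EuclideanSpace.proj (𝕜 := ℂ) l : Model →L[ℂ] ℂ).restrictScalars ℝ).contDiff
  have h2 : ∀ w : Model, affineCoord j (Projectivization.mk ℂ (homVec i w)
      (homVec_ne_zero i w)).rep = affineCoord j (homVec i w) := by
    intro w
    obtain ⟨c, hc, h⟩ := rep_mk (homVec i w) (homVec_ne_zero i w)
    rw [h, affineCoord_smul j c hc]
  have h3 : ∀ k, ContDiffOn ℝ ∞ (fun w : Model => homVec i w (j.succAbove k) / homVec i w j)
      {w | homVec i w j ≠ 0} := fun k => by
    simp only [div_eq_mul_inv]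
    exact (h1 _).contDiffOn.mul ((h1 j).contDiffOn.inv fun w hw => hw)
  have h4 : ContDiffOn ℝ ∞ (fun w : Model => affineCoord j (homVec i w))
      {w | homVec i w j ≠ 0} :=
    (PiLp.contDiff_toLp (𝕜 := ℝ) (p := 2)).comp_contDiffOn (contDiffOn_pi.2 h3)
  refine (h4.congr (f₁ := fun w : Model => affineCoord j (Projectivization.mk ℂ (homVec i w)
      (homVec_ne_zero i w)).rep) fun w _ => h2 w).mono ?_
  rintro w ⟨⟨-, hw⟩, -⟩
  obtain ⟨c, hc, h⟩ := rep_mk (homVec i w) (homVec_ne_zero i w)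
  have hw' : (Projectivization.mk ℂ (homVec i w) (homVec_ne_zero i w)).rep j ≠ 0 := hw
  simpa [h, hc] using hw'

/-- The Fubini–Study metric in an affine chart, at the point with affine coordinates `w`:
`(u, v) ↦ Re ((1 + |w|²) ⟨u, v⟩ - ⟨u, w⟩ ⟨w, v⟩) / (1 + |w|²)²`. -/
def fubiniStudyForm (w : Model) : Model →L[ℝ] Model →L[ℝ] ℝ :=
  (1 + ‖w‖ ^ 2)⁻¹ • innerSL ℝ -
    ((1 + ‖w‖ ^ 2) ^ 2)⁻¹ • (innerSL ℝ (E := ℂ)).bilinearComp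
      ((innerSL ℂ w).restrictScalars ℝ) ((innerSL ℂ w).restrictScalars ℝ)

/-- The Fubini–Study metric on the complex projective plane, normalized to have diameter `π / 2`.
The tangent space at `p` is identified with `ℂ²` through the affine chart `chartAt Model p`. -/
def fubiniStudy : MetricField Model CP2 :=
  fun p => fubiniStudyForm (chartAt Model p p)

/-- The geodesic distance of the Fubini–Study metric. -/
def fsDist (P Q : CP2) : ℝ := (geodesicEDist fubiniStudy P Q).toReal

/-! ## The conformal factor -/

/-- The closed form of `φ_{1,4}(r)`, meaningful for `0 < r < π / 2`. -/
def phiFormula (r : ℝ) : ℝ :=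
  3 ^ (3 / 4 : ℝ) * Real.exp (Real.pi / (2 * √3)) * Real.sin r *
      Real.exp (-(1 / 2) * √3 * Real.arctan ((2 * Real.cos r ^ (2 / 3 : ℝ) + 1) / √3)) *
    (√(1 - Real.cos r ^ (2 / 3 : ℝ)) * Real.cos r ^ (1 / 3 : ℝ) *
      (Real.cos r ^ (2 / 3 : ℝ) + Real.cos r ^ (4 / 3 : ℝ) + 1) ^ (5 / 4 : ℝ))⁻¹

/-- The function `φ_{1,4}` on `[0, π / 2)`: the closed form, an expression `0 / 0` at `r = 0`, is
extended there by continuity. -/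
def phi : ℝ → ℝ := extendFrom (Ioo 0 (Real.pi / 2)) phiFormula

/-- The radial conformal deformation `φ_{1,4}(r_P)² g` of the Fubini–Study metric `g`, where `r_P`
is the distance from `P`; it is considered on `B_{CP²,P}` only. -/
def deformedMetric (P : CP2) : MetricField Model CP2 :=
  fun Q => phi (fsDist P Q) ^ 2 • fubiniStudy Q

end RadialDeformation

end

open RadialDeformation

/-! Unitary maps act transitively on `CP2` and preserve the Fubini–Study form, so around any `P`
there is an affine chart `w`, centred at `P`, in which the metric has its standard expression
(`chartMetric_unitaryChart`). In it the distance from `P` is `arctan |w|`. The radial path gives the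
upper bound, and the lower bound comes from a function of `|⟨p, z⟩|² / |z|²` whose gradient has norm
at most one. The points outside the chart have distance at least `π / 2`. The deformed metric is
therefore `ψ(s)²` times the Fubini–Study form, with `s = |w|² = tan² r`.

For any such metric a Euclidean unit radial vector at `|w| = σ` has length `ψ(σ²) / (1 + σ²)`. If `A
+ 2 s A' = ψ / (1 + s)`, then `σ A(σ²)` is arclength along rays. The rays are geodesics
(`IsRadialProfile.geodesicEqAt`), and by ODE uniqueness the exponential map at `P` is, up to a
linear isometry, the inverse of `H(w) = A(|w|²) w`, defined on the ball whose radius `L` is the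
total length of a ray.

The metric has Euclidean eigenvalue `ψ² / (1 + s)²` on `w` and `iw`, and `ψ² / (1 + s)` on their
orthogonal complement; `DH` stretches by `ψ / (1 + s)` along `w` and by `A` across it. The volume
density is thus `ψ³ / (A³ (1 + s)²)`, and it equals `1` exactly when `A = ψ y²` with `y = (1 +
s)^(-1/3) = cos^(2/3) r`. Inserted into the equation for `A`, this gives `ψ' / ψ = -(2 y + 1)² / (2
y (y² + y + 1))` as a differential equation in `y`, and `φ_{1,4}` is its solution with value `1` at
`y = 1` (`hasDerivAt_phiAux`, `phiAux_one`, `deformQuot_cube`, `IsRadialProfile.det_radialForm`).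

The Fubini–Study injectivity radius is `π / 2`, since opposite geodesics of that length meet on the
line at infinity; hence `B_P` is the domain of the chart. For the deformed metric on `B_P` the
injectivity radius is again the length of the rays, since no geodesic of that length from `P` stays
in `B_P` (`IsRadialChart.injRadius_source`). So the coordinates cover all of `B_P`. -/

noncomputable section

namespace RadialDeformation

set_option maxSynthPendingDepth 3

/-! ### The geodesic equation in a normed space: change of variables and local uniqueness. -/

section NormedSpace

variable {E : Type*} [NormedAddCommGroup E] [NormedSpace ℝ E]

/-- The geodesic equation at time `t` for a curve in a normed space with metric `G`. -/
def GeodesicEqAt (G : E → E →L[ℝ] E →L[ℝ] ℝ) (c : ℝ → E) (t : ℝ) : Prop :=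
  ∀ X : E, HasDerivAt (fun s => G (c s) (deriv c s) X)
    (1 / 2 * fderiv ℝ (fun x => G x (deriv c t) (deriv c t)) (c t) X) t

lemma contDiffAt_deriv_of_smooth {c : ℝ → E} {t : ℝ} (h : ContDiffAt ℝ ∞ c t) :
    ContDiffAt ℝ ∞ (deriv c) t :=
  (h.fderiv_right (m := ∞) (by simp)).clm_apply contDiffAt_const

/-- Smoothness at a point gives, for each finite order separately, a neighbourhood of
differentiability of that order, so only finite `n` can be claimed nearby. -/
lemma eventually_smooth {F : Type*} [NormedAddCommGroup F] [NormedSpace ℝ F] {c : E → F} {t : E}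
    (h : ContDiffAt ℝ ∞ c t) (n : ℕ) : ∀ᶠ s in 𝓝 t, ContDiffAt ℝ n c s :=
  (h.of_le (by exact_mod_cast le_top)).eventually (by simp)

/-- The geodesic equation is preserved by pulling the metric back. -/
lemma GeodesicEqAt.pullback {G : E → E →L[ℝ] E →L[ℝ] ℝ} {F : E → E} {y : ℝ → E} {t : ℝ}
    (hF : ContDiffAt ℝ ∞ F (y t)) (hy : ContDiffAt ℝ ∞ y t) (hG : ContDiffAt ℝ ∞ G (F (y t)))
    (hsymm : ∀ x u v, G x u v = G x v u) (h : GeodesicEqAt G (F ∘ y) t) (X : E) :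
    HasDerivAt (fun s => G (F (y s)) (fderiv ℝ F (y s) (deriv y s)) (fderiv ℝ F (y s) X))
      (1 / 2 * fderiv ℝ (fun x => G (F x) (fderiv ℝ F x (deriv y t)) (fderiv ℝ F x (deriv y t)))
        (y t) X) t := by
  have hF' : DifferentiableAt ℝ (fderiv ℝ F) (y t) :=
    (hF.fderiv_right (m := ∞) (by simp)).differentiableAt (by simp)
  have hyd : HasDerivAt y (deriv y t) t := (hy.differentiableAt (by simp)).hasDerivAt
  have hder : ∀ᶠ s in 𝓝 t, deriv (F ∘ y) s = fderiv ℝ F (y s) (deriv y s) := by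
    filter_upwards [hy.continuousAt.eventually (eventually_smooth hF 1), eventually_smooth hy 1]
      with s h1 h2
    exact fderiv_comp_deriv s (h1.differentiableAt (by simp)) (h2.differentiableAt (by simp))
  set D := deriv (F ∘ y) t with hD
  have hDt : D = fderiv ℝ F (y t) (deriv y t) := hder.self_of_nhds
  -- the momentum along the curve
  have hp : DifferentiableAt ℝ (fun s => G (F (y s)) (deriv (F ∘ y) s)) t := by
    refine DifferentiableAt.clm_apply ?_ ?_
    · exact ((hG.differentiableAt (by simp)).comp t
        ((hF.differentiableAt (by simp)).comp t (hy.differentiableAt (by simp))))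
    · exact (contDiffAt_deriv_of_smooth (hF.comp t hy)).differentiableAt (by simp)
  -- The hypothesis only tests against constant vectors. It determines the derivative of the
  -- momentum covector, which can then be paired with the moving vector `DF(y) X`.
  have hp' : ∀ Y, deriv (fun s => G (F (y s)) (deriv (F ∘ y) s)) t Y =
      1 / 2 * fderiv ℝ (fun x => G x D D) (F (y t)) Y := fun Y =>
    ((hp.hasDerivAt.clm_apply (hasDerivAt_const t Y)).congr_deriv (by simp)).unique (h Y)
  have hY : HasDerivAt (fun s => fderiv ℝ F (y s) X)
      (fderiv ℝ (fderiv ℝ F) (y t) (deriv y t) X) t := by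
    have := (hF'.hasFDerivAt.comp_hasDerivAt t hyd).clm_apply (hasDerivAt_const t X)
    simpa using this
  have key := (hp.hasDerivAt.clm_apply hY).congr_of_eventuallyEq (f₁ := fun s =>
    G (F (y s)) (fderiv ℝ F (y s) (deriv y s)) (fderiv ℝ F (y s) X))
    (by filter_upwards [hder] with s hs; rw [hs])
  refine key.congr_deriv ?_
  rw [hp']
  have hGd : HasFDerivAt G (fderiv ℝ G (F (y t))) (F (y t)) :=
    (hG.differentiableAt (by simp)).hasFDerivAt
  have hFd : HasFDerivAt F (fderiv ℝ F (y t)) (y t) := (hF.differentiableAt (by simp)).hasFDerivAt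
  have h1 : fderiv ℝ (fun x => G x D D) (F (y t)) (fderiv ℝ F (y t) X) =
      fderiv ℝ G (F (y t)) (fderiv ℝ F (y t) X) D D := by
    have := (hGd.clm_apply (hasFDerivAt_const D _)).clm_apply (hasFDerivAt_const D _)
    rw [this.fderiv]; simp
  have hV : HasFDerivAt (fun x => fderiv ℝ F x (deriv y t))
      ((fderiv ℝ (fderiv ℝ F) (y t)).flip (deriv y t)) (y t) := by
    have := hF'.hasFDerivAt.clm_apply (hasFDerivAt_const (deriv y t) (y t))
    simpa using this
  have hGF : HasFDerivAt (fun x => G (F x)) (fderiv ℝ G (F (y t)) ∘L fderiv ℝ F (y t)) (y t) :=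
    hGd.comp (y t) hFd
  have h2 := (hGF.clm_apply hV).clm_apply hV
  -- The left side produces `D²F(y', X)` by differentiating the test vector; the right side produces
  -- `D²F(X, y')` twice, with a factor `1 / 2`. Symmetry of `D²F` makes them cancel.
  have hs : fderiv ℝ (fderiv ℝ F) (y t) (deriv y t) X =
      fderiv ℝ (fderiv ℝ F) (y t) X (deriv y t) :=
    (hF.isSymmSndFDerivAt (by simp; exact WithTop.coe_le_coe.2 le_top)).eq _ _
  have h3 : fderiv ℝ (fun x => G (F x) (fderiv ℝ F x (deriv y t)) (fderiv ℝ F x (deriv y t)))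
      (y t) X = fderiv ℝ G (F (y t)) (fderiv ℝ F (y t) X) D D
        + 2 * G (F (y t)) D (fderiv ℝ (fderiv ℝ F) (y t) X (deriv y t)) := by
    rw [h2.fderiv]
    simp only [add_apply, ContinuousLinearMap.comp_apply,
      ContinuousLinearMap.flip_apply, ← hDt]
    rw [hsymm _ (fderiv ℝ (fderiv ℝ F) (y t) X (deriv y t)) D]
    ring
  rw [h1, h3, hs, ← hD]
  ring

/-- The geodesic spray: the acceleration of a geodesic as a function of position and velocity. -/
def spray (G : E → E →L[ℝ] E →L[ℝ] ℝ) (z : E × E) : E :=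
  (G z.1).inverse ((1 / 2 : ℝ) • ((fderiv ℝ G z.1).flip z.2).flip z.2 - fderiv ℝ G z.1 z.2 z.2)

lemma isInvertible_of_nondegenerate [FiniteDimensional ℝ E] {B : E →L[ℝ] E →L[ℝ] ℝ}
    (hB : ∀ u, (∀ v, B u v = 0) → u = 0) : B.IsInvertible := by
  have hinj : Function.Injective B :=
    (injective_iff_map_eq_zero B).2 fun u hu => hB u fun v => by simp [hu]
  have hfin : Module.finrank ℝ E = Module.finrank ℝ (E →L[ℝ] ℝ) := by
    rw [← (LinearMap.toContinuousLinearMap (𝕜 := ℝ) (E := E) (F' := ℝ)).finrank_eq]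
    exact (Subspace.dual_finrank_eq (K := ℝ) (V := E)).symm
  refine ⟨(LinearEquiv.ofInjectiveOfFinrankEq (B : E →ₗ[ℝ] E →L[ℝ] ℝ) hinj hfin).toContinuousLinearEquiv, ?_⟩
  ext u v; rfl

lemma contDiff_clm_flip {A B C D : Type*} [NormedAddCommGroup A] [NormedSpace ℝ A]
    [NormedAddCommGroup B] [NormedSpace ℝ B] [NormedAddCommGroup C] [NormedSpace ℝ C]
    [NormedAddCommGroup D] [NormedSpace ℝ D] {f : D → A →L[ℝ] B →L[ℝ] C} (hf : ContDiff ℝ ∞ f) :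
    ContDiff ℝ ∞ fun z => (f z).flip :=
  (ContinuousLinearMap.flipₗᵢ ℝ A B C).contDiff.comp hf

lemma contDiff_spray [FiniteDimensional ℝ E] {G : E → E →L[ℝ] E →L[ℝ] ℝ} (hG : ContDiff ℝ ∞ G)
    (hnd : ∀ x u, (∀ v, G x u v = 0) → u = 0) : ContDiff ℝ ∞ (spray G) := by
  have : CompleteSpace E := FiniteDimensional.complete ℝ E
  have hdG : ContDiff ℝ ∞ (fun z : E × E => fderiv ℝ G z.1) :=
    (hG.fderiv_right (m := ∞) (by simp)).comp contDiff_fst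
  rw [contDiff_iff_contDiffAt]
  intro z
  refine ContDiffAt.clm_apply ?_ ?_
  · obtain ⟨e, he⟩ := isInvertible_of_nondegenerate (hnd z.1)
    have h := contDiffAt_map_inverse (𝕜 := ℝ) (n := ∞) e
    rw [he] at h
    exact ContDiffAt.comp (f := fun z : E × E => G z.1) z h ((hG.comp contDiff_fst).contDiffAt)
  · refine (ContDiff.sub (ContDiff.const_smul (1 / 2 : ℝ) ?_) ?_).contDiffAt
    · exact (contDiff_clm_flip ((contDiff_clm_flip hdG).clm_apply contDiff_snd)).clm_apply contDiff_snd
    · exact (hdG.clm_apply contDiff_snd).clm_apply contDiff_snd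

/-- Expanding the derivative of `G(c) c'` leaves `G(c) c''` as the only second-order term.
Nondegeneracy allows solving for `c''`, so the equation becomes a first-order system with a smooth
vector field. -/
lemma GeodesicEqAt.hasDerivAt [FiniteDimensional ℝ E] {G : E → E →L[ℝ] E →L[ℝ] ℝ}
    {c : ℝ → E} {t : ℝ} (hG : ContDiff ℝ ∞ G)
    (hnd : ∀ x u, (∀ v, G x u v = 0) → u = 0) (hc : ContDiffAt ℝ ∞ c t)
    (h : GeodesicEqAt G c t) :
    HasDerivAt (fun s => (c s, deriv c s)) (deriv c t, spray G (c t, deriv c t)) t := by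
  have h1 : HasDerivAt c (deriv c t) t := (hc.differentiableAt (by simp)).hasDerivAt
  have h2 : HasDerivAt (deriv c) (deriv (deriv c) t) t :=
    ((contDiffAt_deriv_of_smooth hc).differentiableAt (by simp)).hasDerivAt
  have hGd : HasFDerivAt G (fderiv ℝ G (c t)) (c t) :=
    (hG.differentiable (by simp) _).hasFDerivAt
  obtain ⟨e, he⟩ := isInvertible_of_nondegenerate (hnd (c t))
  have key : G (c t) (deriv (deriv c) t) = (1 / 2 : ℝ) •
      ((fderiv ℝ G (c t)).flip (deriv c t)).flip (deriv c t)
        - fderiv ℝ G (c t) (deriv c t) (deriv c t) := by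
    ext X
    have h3 := ((hGd.comp_hasDerivAt t h1).clm_apply h2).clm_apply (hasDerivAt_const t X)
    have h4 := h3.unique (h X)
    have h5 := ((hGd.clm_apply (hasFDerivAt_const (deriv c t) _)).clm_apply
      (hasFDerivAt_const (deriv c t) _))
    rw [h5.fderiv] at h4
    simp at h4 ⊢
    linarith
  have h6 : deriv (deriv c) t = spray G (c t, deriv c t) := by
    simp only [spray]
    rw [← key, ← he, ContinuousLinearMap.inverse_equiv]
    simp
  rw [← h6]
  exact h1.prodMk h2

/-- Two geodesics with the same position and velocity at `t₀` agree near `t₀`. -/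
lemma geodesic_eventuallyEq [FiniteDimensional ℝ E] {G : E → E →L[ℝ] E →L[ℝ] ℝ}
    {c₁ c₂ : ℝ → E} {t₀ : ℝ} (hG : ContDiff ℝ ∞ G)
    (hnd : ∀ x u, (∀ v, G x u v = 0) → u = 0)
    (h₁ : ∀ᶠ t in 𝓝 t₀, ContDiffAt ℝ ∞ c₁ t ∧ GeodesicEqAt G c₁ t)
    (h₂ : ∀ᶠ t in 𝓝 t₀, ContDiffAt ℝ ∞ c₂ t ∧ GeodesicEqAt G c₂ t)
    (h0 : c₁ t₀ = c₂ t₀) (h0' : deriv c₁ t₀ = deriv c₂ t₀) : c₁ =ᶠ[𝓝 t₀] c₂ := by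
  have hV : ContDiff ℝ ∞ (fun z : E × E => (z.2, spray G z)) :=
    contDiff_snd.prodMk (contDiff_spray hG hnd)
  obtain ⟨K, s, hs, hK⟩ := (hV.contDiffAt (x := (c₁ t₀, deriv c₁ t₀)) |>.of_le
    (m := 1) (by exact_mod_cast le_top)).exists_lipschitzOnWith
  have cont : ∀ {c : ℝ → E}, ContDiffAt ℝ ∞ c t₀ →
      ContinuousAt (fun t => (c t, deriv c t)) t₀ := fun h =>
    h.continuousAt.prodMk (contDiffAt_deriv_of_smooth h).continuousAt
  have hs₂ : s ∈ 𝓝 (c₂ t₀, deriv c₂ t₀) := by rwa [← h0, ← h0']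
  have e₁ := (cont h₁.self_of_nhds.1).eventually_mem hs
  have e₂ := (cont h₂.self_of_nhds.1).eventually_mem hs₂
  have := ODE_solution_unique_of_eventually (v := fun _ z => (z.2, spray G z)) (s := fun _ => s)
    (K := K) (f := fun t => (c₁ t, deriv c₁ t)) (g := fun t => (c₂ t, deriv c₂ t)) (t₀ := t₀)
    (Eventually.of_forall fun _ => hK)
    (by filter_upwards [h₁, e₁] with t h hm using ⟨h.2.hasDerivAt hG hnd h.1, hm⟩)
    (by filter_upwards [h₂, e₂] with t h hm using ⟨h.2.hasDerivAt hG hnd h.1, hm⟩)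
    (by simp [h0, h0'])
  filter_upwards [this] with t ht using congrArg Prod.fst ht

end NormedSpace

/-! ### Geodesics of a manifold read in a single chart. -/

section Chart

variable {E : Type*} [NormedAddCommGroup E] [NormedSpace ℝ E]
  {M : Type*} [TopologicalSpace M] [ChartedSpace E M]

/-- All tangent spaces are copies of `E`; typing the vectors in `E` permits a change of base point
without casts. -/
lemma metricField_congr (g : MetricField E M) {Q Q' : M} (h : Q = Q') {a a' b b' : E}
    (ha : a = a') (hb : b = b') :
    g Q (show TangentSpace 𝓘(ℝ, E) Q from a) (show TangentSpace 𝓘(ℝ, E) Q from b) =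
      g Q' (show TangentSpace 𝓘(ℝ, E) Q' from a') (show TangentSpace 𝓘(ℝ, E) Q' from b') := by
  subst h ha hb; rfl

lemma mem_maximalAtlas_one {e : OpenPartialHomeomorph M E}
    (he : e ∈ IsManifold.maximalAtlas 𝓘(ℝ, E) ∞ M) : e ∈ IsManifold.maximalAtlas 𝓘(ℝ, E) 1 M :=
  IsManifold.maximalAtlas_subset_of_le (by exact_mod_cast le_top) he

lemma mdifferentiable_chart_of_mem {e : OpenPartialHomeomorph M E}
    (he : e ∈ IsManifold.maximalAtlas 𝓘(ℝ, E) ∞ M) : e.MDifferentiable 𝓘(ℝ, E) 𝓘(ℝ, E) :=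
  ⟨fun _ hx => (mdifferentiableAt_of_mem_maximalAtlas
    (mem_maximalAtlas_one he) hx).mdifferentiableWithinAt,
   fun _ hx => (mdifferentiableAt_symm_of_mem_maximalAtlas
    (mem_maximalAtlas_one he) hx).mdifferentiableWithinAt⟩

lemma metric_eq_chartMetric (g : MetricField E M) {e : OpenPartialHomeomorph M E}
    (he : e ∈ IsManifold.maximalAtlas 𝓘(ℝ, E) ∞ M) {Q : M} (hQ : Q ∈ e.source)
    (a b : TangentSpace 𝓘(ℝ, E) Q) :
    g Q a b = chartMetric g e (e Q) (mfderiv 𝓘(ℝ, E) 𝓘(ℝ, E) e Q a)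
      (mfderiv 𝓘(ℝ, E) 𝓘(ℝ, E) e Q b) := by
  have key : ∀ a : TangentSpace 𝓘(ℝ, E) Q, (mfderiv 𝓘(ℝ, E) 𝓘(ℝ, E) e.symm (e Q)
      (mfderiv 𝓘(ℝ, E) 𝓘(ℝ, E) e Q a) : E) = a := fun a =>
    congrArg (fun T => T a) ((mdifferentiable_chart_of_mem he).symm_comp_deriv hQ)
  exact metricField_congr g (e.left_inv hQ).symm (key a).symm (key b).symm

lemma contDiffAt_transition {e e' : OpenPartialHomeomorph M E}
    (he : e ∈ IsManifold.maximalAtlas 𝓘(ℝ, E) ∞ M)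
    (he' : e' ∈ IsManifold.maximalAtlas 𝓘(ℝ, E) ∞ M) {x : E} (hx : x ∈ e'.target)
    (hx' : e'.symm x ∈ e.source) : ContDiffAt ℝ ∞ (e ∘ e'.symm) x :=
  ((contMDiffAt_of_mem_maximalAtlas he hx').comp x
    (contMDiffAt_symm_of_mem_maximalAtlas he' hx)).contDiffAt

/-- The transformation law of the metric coefficients under a change of charts. -/
lemma chartMetric_transition (g : MetricField E M) {e e' : OpenPartialHomeomorph M E}
    (he : e ∈ IsManifold.maximalAtlas 𝓘(ℝ, E) ∞ M)
    (he' : e' ∈ IsManifold.maximalAtlas 𝓘(ℝ, E) ∞ M) {x : E} (hx : x ∈ e'.target)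
    (hx' : e'.symm x ∈ e.source) (u v : E) :
    chartMetric g e' x u v = chartMetric g e ((e ∘ e'.symm) x)
      (fderiv ℝ (e ∘ e'.symm) x u) (fderiv ℝ (e ∘ e'.symm) x v) := by
  have h : fderiv ℝ (e ∘ e'.symm) x = (mfderiv 𝓘(ℝ, E) 𝓘(ℝ, E) e (e'.symm x)).comp
      (mfderiv 𝓘(ℝ, E) 𝓘(ℝ, E) e'.symm x) := by
    rw [← mfderiv_eq_fderiv]
    exact mfderiv_comp x ((mdifferentiable_chart_of_mem he).mdifferentiableAt hx')
      ((mdifferentiable_chart_of_mem he').mdifferentiableAt_symm hx)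
  rw [h]
  exact metric_eq_chartMetric g he hx' _ _

lemma GeodesicEqAt.congr {G : E → E →L[ℝ] E →L[ℝ] ℝ} {c c' : ℝ → E} {t : ℝ}
    (h : GeodesicEqAt G c t) (hcc : c' =ᶠ[𝓝 t] c) : GeodesicEqAt G c' t := by
  intro X
  rw [hcc.deriv_eq, hcc.self_of_nhds]
  refine (h X).congr_of_eventuallyEq ?_
  filter_upwards [hcc.eventuallyEq_nhds] with s hs
  rw [hs.deriv_eq, hs.self_of_nhds]

/-- A geodesic has to satisfy its equation in every chart of the maximal atlas. One chart onto `E`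
suffices, because any other chart sees the metric pulled back by a transition map, and
`GeodesicEqAt.pullback` applies. -/
lemma isGeodesicOn_symm_comp {g : MetricField E M} {e : OpenPartialHomeomorph M E}
    (he : e ∈ IsManifold.maximalAtlas 𝓘(ℝ, E) ∞ M) (htgt : e.target = univ)
    {G : E → E →L[ℝ] E →L[ℝ] ℝ} (hG : ∀ x u v, chartMetric g e x u v = G x u v)
    (hGd : ContDiff ℝ ∞ G) (hsymm : ∀ x u v, G x u v = G x v u)
    {U : Set M} {c : ℝ → E} {J : Set ℝ} (hJ : IsOpen J) (hc : ContDiffOn ℝ ∞ c J)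
    (hU : ∀ t ∈ J, e.symm (c t) ∈ U) (heq : ∀ t ∈ J, GeodesicEqAt G c t) :
    IsGeodesicOn g U (e.symm ∘ c) J := by
  have hct : ∀ t, c t ∈ e.target := fun t => htgt ▸ mem_univ _
  have hcsm : ∀ t ∈ J, ContMDiffAt 𝓘(ℝ, ℝ) 𝓘(ℝ, E) ∞ (e.symm ∘ c) t := fun t ht =>
    (contMDiffAt_symm_of_mem_maximalAtlas he (hct t)).comp t
      (hc.contDiffAt (hJ.mem_nhds ht)).contMDiffAt
  refine ⟨hU, fun t ht => (hcsm t ht).contMDiffWithinAt, ?_⟩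
  intro e' he' t ht hsrc X
  set γ := e.symm ∘ c with hγ
  set F := e ∘ e'.symm with hF
  set y : ℝ → E := fun s => e' (γ s) with hy
  have hsrc' : ∀ᶠ s in 𝓝 t, γ s ∈ e'.source :=
    (hcsm t ht).continuousAt.eventually_mem (e'.open_source.mem_nhds hsrc)
  have hγe : ∀ s, γ s ∈ e.source := fun s => e.map_target (hct s)
  have hFy : F ∘ y =ᶠ[𝓝 t] c := by
    filter_upwards [hsrc'] with s hs
    simp only [hF, hy, Function.comp_apply]
    rw [e'.left_inv hs]
    exact e.right_inv (hct s)
  have hysm : ContDiffAt ℝ ∞ y t :=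
    ((contMDiffAt_of_mem_maximalAtlas he' hsrc).comp t (hcsm t ht)).contDiffAt
  have hyt : y t ∈ e'.target := e'.map_source hsrc
  have hyt' : e'.symm (y t) ∈ e.source := by
    simp only [hy]; rw [e'.left_inv hsrc]; exact hγe t
  have hFsm : ContDiffAt ℝ ∞ F (y t) := contDiffAt_transition he he' hyt hyt'
  have key := GeodesicEqAt.pullback hFsm hysm hGd.contDiffAt hsymm
    ((heq t ht).congr hFy) X
  have hnear : ∀ᶠ x in 𝓝 (y t), x ∈ e'.target ∧ e'.symm x ∈ e.source :=
    (e'.open_target.mem_nhds hyt |> fun h => Filter.inter_mem h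
      ((e'.continuousAt_symm hyt).preimage_mem_nhds (e.open_source.mem_nhds hyt')))
  have hcm : ∀ᶠ x in 𝓝 (y t), ∀ u v, chartMetric g e' x u v =
      G (F x) (fderiv ℝ F x u) (fderiv ℝ F x v) := by
    filter_upwards [hnear] with x hx u v
    rw [chartMetric_transition g he he' hx.1 hx.2, hG]
  have hfd : fderiv ℝ (fun x => chartMetric g e' x (deriv y t) (deriv y t)) (y t) =
      fderiv ℝ (fun x => G (F x) (fderiv ℝ F x (deriv y t)) (fderiv ℝ F x (deriv y t))) (y t) :=
    Filter.EventuallyEq.fderiv_eq (by filter_upwards [hcm] with x hx using hx _ _)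
  change HasDerivAt (fun s => chartMetric g e' (y s) (deriv y s) X)
      (1 / 2 * fderiv ℝ (fun x => chartMetric g e' x (deriv y t) (deriv y t)) (y t) X) t
  rw [hfd]
  refine key.congr_of_eventuallyEq ?_
  filter_upwards [hysm.continuousAt.eventually hcm] with s hs using hs _ _

lemma IsGeodesicOn.mono {g : MetricField E M} {U : Set M} {γ : ℝ → M} {J J' : Set ℝ}
    (h : IsGeodesicOn g U γ J) (hJ : J' ⊆ J) : IsGeodesicOn g U γ J' :=
  ⟨h.mapsTo.mono_left hJ, h.smooth.mono hJ, fun e he t ht => h.equation e he t (hJ ht)⟩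

/-- A geodesic which at time `0` has the position and velocity of a geodesic given in a chart,
agrees with it. -/
lemma IsGeodesicOn.eqOn_symm_comp [T2Space M] [FiniteDimensional ℝ E]
    {g : MetricField E M} {e : OpenPartialHomeomorph M E}
    (he : e ∈ IsManifold.maximalAtlas 𝓘(ℝ, E) ∞ M) (htgt : e.target = univ)
    {G : E → E →L[ℝ] E →L[ℝ] ℝ} (hG : ∀ x u v, chartMetric g e x u v = G x u v)
    (hGd : ContDiff ℝ ∞ G) (hnd : ∀ x u, (∀ v, G x u v = 0) → u = 0)
    {U : Set M} {γ : ℝ → M} {c : ℝ → E} {a b : ℝ} (hγ : IsGeodesicOn g U γ (Ioo a b))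
    (hc : ContDiffOn ℝ ∞ c (Ioo a b)) (heq : ∀ t ∈ Ioo a b, GeodesicEqAt G c t)
    (h0 : (0 : ℝ) ∈ Ioo a b) (hγ0 : γ 0 = e.symm (c 0))
    (hγ0' : deriv (fun s => e (γ s)) 0 = deriv c 0) : EqOn γ (e.symm ∘ c) (Ioo a b) := by
  have hct : ∀ t, c t ∈ e.target := fun t => htgt ▸ mem_univ _
  have hγsm : ∀ t ∈ Ioo a b, ContMDiffAt 𝓘(ℝ, ℝ) 𝓘(ℝ, E) ∞ γ t := fun t ht =>
    (hγ.smooth t ht).contMDiffAt (isOpen_Ioo.mem_nhds ht)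
  have hcsm : ∀ t ∈ Ioo a b, ContDiffAt ℝ ∞ c t := fun t ht =>
    hc.contDiffAt (isOpen_Ioo.mem_nhds ht)
  have hesm : ∀ t, ContinuousAt e.symm (c t) := fun t => e.continuousAt_symm (hct t)
  have hcomp : ∀ t ∈ Ioo a b, γ t ∈ e.source → ContDiffAt ℝ ∞ (fun s => e (γ s)) t :=
    fun t ht hs => ((contMDiffAt_of_mem_maximalAtlas he hs).comp t (hγsm t ht)).contDiffAt
  have local_eq : ∀ t ∈ Ioo a b, γ t = e.symm (c t) →
      deriv (fun s => e (γ s)) t = deriv c t → γ =ᶠ[𝓝 t] e.symm ∘ c := by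
    intro t ht h1 h2
    have hsrc : γ t ∈ e.source := h1 ▸ e.map_target (hct t)
    have hev : ∀ᶠ s in 𝓝 t, s ∈ Ioo a b ∧ γ s ∈ e.source :=
      Filter.inter_mem (isOpen_Ioo.mem_nhds ht)
        ((hγsm t ht).continuousAt.preimage_mem_nhds (e.open_source.mem_nhds hsrc))
    have := geodesic_eventuallyEq (c₁ := fun s => e (γ s)) (c₂ := c) (t₀ := t) hGd hnd
      (by
        filter_upwards [hev] with s hs
        refine ⟨hcomp s hs.1 hs.2, fun X => ?_⟩
        have := hγ.equation e he s hs.1 hs.2 X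
        simpa only [hG] using this)
      (by
        filter_upwards [hev] with s hs
        exact ⟨hcsm s hs.1, heq s hs.1⟩)
      (by rw [h1, e.right_inv (hct t)]) h2
    filter_upwards [this, hev] with s hs hs'
    rw [Function.comp_apply, ← hs, e.left_inv hs'.2]
  -- Connectedness: the times near which the two curves agree form an open set containing `0`. It is
  -- relatively closed because positions and velocities agree at limit times, where local uniqueness
  -- starts again.
  have hsub : Ioo a b ⊆ {t | t ∈ Ioo a b ∧ γ =ᶠ[𝓝 t] e.symm ∘ c} := by
    refine isPreconnected_Ioo.subset_of_closure_inter_subset ?_ ⟨0, h0, h0, local_eq 0 h0 hγ0 hγ0'⟩ ?_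
    · rw [isOpen_iff_eventually]
      rintro t ⟨ht, h⟩
      filter_upwards [isOpen_Ioo.mem_nhds ht, h.eventuallyEq_nhds] with s h1 h2 using ⟨h1, h2⟩
    · rintro t ⟨htc, ht⟩
      refine ⟨ht, ?_⟩
      have hfr : ∃ᶠ s in 𝓝 t, s ∈ Ioo a b ∧ γ =ᶠ[𝓝 s] e.symm ∘ c :=
        mem_closure_iff_frequently.1 htc
      have h1 : γ t = e.symm (c t) := by
        refine (tendsto_nhds_unique_of_frequently_eq (l := 𝓝 t) (f := γ) (g := e.symm ∘ c)
          (hγsm t ht).continuousAt ((hesm t).comp (hcsm t ht).continuousAt) ?_)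
        exact hfr.mono fun s hs => hs.2.self_of_nhds
      have hsrc : γ t ∈ e.source := h1 ▸ e.map_target (hct t)
      refine local_eq t ht h1 ?_
      refine tendsto_nhds_unique_of_frequently_eq (l := 𝓝 t)
        (contDiffAt_deriv_of_smooth (hcomp t ht hsrc)).continuousAt
        (contDiffAt_deriv_of_smooth (hcsm t ht)).continuousAt (hfr.mono fun s hs => ?_)
      refine Filter.EventuallyEq.deriv_eq ?_
      filter_upwards [hs.2] with r hr
      rw [hr, Function.comp_apply, e.right_inv (hct r)]
  exact fun t ht => (hsub ht).2.self_of_nhds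

lemma IsGeodesicFrom.apply_zero {g : MetricField E M} {U : Set M} {P : M}
    {v : TangentSpace 𝓘(ℝ, E) P} {γ : ℝ → M} (h : IsGeodesicFrom g U P v γ) : γ 0 = P :=
  congrArg Bundle.TotalSpace.proj h.2

lemma IsGeodesicFrom.deriv_chart {g : MetricField E M} {e : OpenPartialHomeomorph M E}
    (he : e ∈ IsManifold.maximalAtlas 𝓘(ℝ, E) ∞ M) {U : Set M} {P : M} (hP : P ∈ e.source)
    {v : TangentSpace 𝓘(ℝ, E) P} {γ : ℝ → M} (h : IsGeodesicFrom g U P v γ) :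
    deriv (fun s => e (γ s)) 0 = mfderiv 𝓘(ℝ, E) 𝓘(ℝ, E) e P v := by
  obtain ⟨⟨ε, hε, hγ⟩, h0⟩ := h
  have hsm : MDifferentiableAt 𝓘(ℝ, ℝ) 𝓘(ℝ, E) γ 0 :=
    ((hγ.smooth 0 ⟨by linarith, by linarith⟩).contMDiffAt
      (isOpen_Ioo.mem_nhds ⟨by linarith, by linarith⟩)).mdifferentiableAt (by simp)
  have hP' : γ 0 = P := congrArg Bundle.TotalSpace.proj h0
  subst hP'
  have hv : mfderiv 𝓘(ℝ, ℝ) 𝓘(ℝ, E) γ 0 (1 : ℝ) = v := by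
    simpa using h0
  have := mfderiv_comp (I'' := 𝓘(ℝ, E)) (0 : ℝ)
    ((mdifferentiable_chart_of_mem he).mdifferentiableAt hP) hsm
  rw [mfderiv_eq_fderiv] at this
  rw [← fderiv_apply_one_eq_deriv, ← hv]
  exact congrArg (fun T => T (1 : ℝ)) this

lemma isGeodesicFrom_symm_comp {g : MetricField E M} {e : OpenPartialHomeomorph M E}
    (he : e ∈ IsManifold.maximalAtlas 𝓘(ℝ, E) ∞ M) (htgt : e.target = univ)
    {G : E → E →L[ℝ] E →L[ℝ] ℝ} (hG : ∀ x u v, chartMetric g e x u v = G x u v)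
    (hGd : ContDiff ℝ ∞ G) (hsymm : ∀ x u v, G x u v = G x v u)
    {U : Set M} {c : ℝ → E} {ε : ℝ} (hε : 0 < ε) (hc : ContDiffOn ℝ ∞ c (Ioo (-ε) (1 + ε)))
    (hU : ∀ t ∈ Ioo (-ε) (1 + ε), e.symm (c t) ∈ U)
    (heq : ∀ t ∈ Ioo (-ε) (1 + ε), GeodesicEqAt G c t)
    {P : M} (hP : P ∈ e.source) {v : TangentSpace 𝓘(ℝ, E) P} (hc0 : c 0 = e P)
    (hc0' : deriv c 0 = mfderiv 𝓘(ℝ, E) 𝓘(ℝ, E) e P v) :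
    IsGeodesicFrom g U P v (e.symm ∘ c) := by
  refine ⟨⟨ε, hε, isGeodesicOn_symm_comp he htgt hG hGd hsymm isOpen_Ioo hc hU heq⟩, ?_⟩
  have h0 : (0 : ℝ) ∈ Ioo (-ε) (1 + ε) := ⟨by linarith, by linarith⟩
  have hd : DifferentiableAt ℝ c 0 :=
    (hc.contDiffAt (isOpen_Ioo.mem_nhds h0)).differentiableAt (by simp)
  have h1 := mfderiv_comp (I'' := 𝓘(ℝ, E)) (0 : ℝ)
    ((mdifferentiable_chart_of_mem he).mdifferentiableAt_symm (x := c 0) (htgt ▸ mem_univ _))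
    hd.mdifferentiableAt
  have h2 : (mfderiv 𝓘(ℝ, ℝ) 𝓘(ℝ, E) (e.symm ∘ c) 0 (1 : ℝ) : E) =
      mfderiv 𝓘(ℝ, E) 𝓘(ℝ, E) e.symm (e P) (mfderiv 𝓘(ℝ, E) 𝓘(ℝ, E) e P v) := by
    rw [h1, ← hc0', ← hc0, ← fderiv_apply_one_eq_deriv, mfderiv_eq_fderiv]
    rfl
  have h3 : (mfderiv 𝓘(ℝ, E) 𝓘(ℝ, E) e.symm (e P) (mfderiv 𝓘(ℝ, E) 𝓘(ℝ, E) e P v) : E) = v :=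
    congrArg (fun T => T v) ((mdifferentiable_chart_of_mem he).symm_comp_deriv hP)
  have h4 : (e.symm ∘ c) 0 = P := by rw [Function.comp_apply, hc0, e.left_inv hP]
  have h5 := h2.trans h3
  -- The remaining equality is one of dependent pairs. Abstracting the vector and its base point
  -- lets both equations be substituted.
  generalize (mfderiv 𝓘(ℝ, ℝ) 𝓘(ℝ, E) (e.symm ∘ c) 0 (1 : ℝ) : E) = w at h5
  generalize (e.symm ∘ c) 0 = Q at h4
  subst h4 h5
  rfl

end Chart

/-! ### Radial conformal metrics and the radial map. -/

section Radial

lemma inner_model_eq_re (u v : Model) : inner ℝ u v = (inner ℂ u v : ℂ).re := by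
  simp [PiLp.inner_apply]

/-- Splits the Hermitian correction into its real parts along `w` and along `iw`. -/
lemma fubiniStudyForm_apply (w u v : Model) : fubiniStudyForm w u v =
    (1 + ‖w‖ ^ 2)⁻¹ * inner ℝ u v - ((1 + ‖w‖ ^ 2) ^ 2)⁻¹ *
      (inner ℝ w u * inner ℝ w v + (inner ℂ w u : ℂ).im * (inner ℂ w v : ℂ).im) := by
  have h : fubiniStudyForm w u v = (1 + ‖w‖ ^ 2)⁻¹ * inner ℝ u v -
      ((1 + ‖w‖ ^ 2) ^ 2)⁻¹ * inner ℝ (inner ℂ w u : ℂ) (inner ℂ w v : ℂ) := rfl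
  rw [h, inner_model_eq_re w u, inner_model_eq_re w v, Complex.inner, Complex.mul_re,
    Complex.conj_re, Complex.conj_im]
  ring

lemma fubiniStudyForm_symm (w u v : Model) : fubiniStudyForm w u v = fubiniStudyForm w v u := by
  rw [fubiniStudyForm_apply, fubiniStudyForm_apply, real_inner_comm]
  ring

/-- Cauchy–Schwarz for the Hermitian product bounds the correction term by `|w|² |u|²`. -/
lemma fubiniStudyForm_pos (w : Model) {u : Model} (hu : u ≠ 0) : 0 < fubiniStudyForm w u u := by
  have h1 : inner ℝ w u ^ 2 + (inner ℂ w u : ℂ).im ^ 2 ≤ ‖w‖ ^ 2 * ‖u‖ ^ 2 := by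
    have h := pow_le_pow_left₀ (norm_nonneg _) (norm_inner_le_norm (𝕜 := ℂ) w u) 2
    rw [← Complex.normSq_eq_norm_sq, Complex.normSq_apply, ← inner_model_eq_re] at h
    nlinarith
  have h2 : 0 < ‖u‖ ^ 2 := by positivity
  rw [fubiniStudyForm_apply, real_inner_self_eq_norm_sq]
  have h3 : (1 + ‖w‖ ^ 2)⁻¹ * ‖u‖ ^ 2 - ((1 + ‖w‖ ^ 2) ^ 2)⁻¹ *
      (inner ℝ w u * inner ℝ w u + (inner ℂ w u : ℂ).im * (inner ℂ w u : ℂ).im) =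
      ((1 + ‖w‖ ^ 2) ^ 2)⁻¹ * (‖u‖ ^ 2 + (‖w‖ ^ 2 * ‖u‖ ^ 2 -
        (inner ℝ w u ^ 2 + (inner ℂ w u : ℂ).im ^ 2))) := by
    field_simp
    ring
  rw [h3]
  have : 0 < ((1 + ‖w‖ ^ 2) ^ 2)⁻¹ := by positivity
  exact mul_pos this (by linarith)

lemma contDiff_fubiniStudyForm : ContDiff ℝ ∞ fubiniStudyForm := by
  have h0 : ContDiff ℝ ∞ (fun w : Model => 1 + ‖w‖ ^ 2) := contDiff_const.add (contDiff_norm_sq ℝ)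
  have h1 : ∀ w : Model, 1 + ‖w‖ ^ 2 ≠ 0 := fun w => by positivity
  have h2 : ∀ u : Model, ContDiff ℝ ∞ (fun w : Model => inner ℝ w u) := fun u =>
    contDiff_id.inner ℝ contDiff_const
  have h3 : ∀ u : Model, ContDiff ℝ ∞ (fun w : Model => (inner ℂ w u : ℂ).im) := fun u =>
    Complex.imCLM.contDiff.comp (contDiff_id.inner ℂ contDiff_const)
  refine contDiff_clm_apply_iff.2 fun u => contDiff_clm_apply_iff.2 fun v => ?_
  simp only [fubiniStudyForm_apply]
  exact ((h0.inv h1).mul contDiff_const).sub (((h0.pow 2).inv fun w => pow_ne_zero 2 (h1 w)).mul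
    (((h2 u).mul (h2 v)).add ((h3 u).mul (h3 v))))

/-- The Fubini–Study metric multiplied by the radial conformal factor `ψ(|w|²)²`. -/
def radialForm (ψ : ℝ → ℝ) (w : Model) : Model →L[ℝ] Model →L[ℝ] ℝ :=
  ψ (‖w‖ ^ 2) ^ 2 • fubiniStudyForm w

/-- The radial map `w ↦ A(|w|²) w`. -/
def radialMap (A : ℝ → ℝ) (w : Model) : Model := A (‖w‖ ^ 2) • w

/-- The inverse of the radial map. -/
def radialInv (A : ℝ → ℝ) : Model → Model := Function.invFun (radialMap A)

/-- `σ A(σ²)` is the distance from the origin to the sphere `|w| = σ` for the metric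
`radialForm ψ`, and it tends to `L` for `σ → ∞`. -/
structure IsRadialProfile (A ψ : ℝ → ℝ) (L : ℝ) : Prop where
  smooth : ∀ s, 0 ≤ s → ContDiffAt ℝ ∞ A s
  smooth_factor : ∀ s, 0 ≤ s → ContDiffAt ℝ ∞ ψ s
  pos : ∀ s, 0 ≤ s → 0 < A s
  pos_factor : ∀ s, 0 ≤ s → 0 < ψ s
  zero : A 0 = 1
  zero_factor : ψ 0 = 1
  ode : ∀ s, 0 ≤ s → A s + 2 * s * deriv A s = ψ s / (1 + s)
  lt : ∀ σ, 0 ≤ σ → σ * A (σ ^ 2) < L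
  exists_le : ∀ l < L, ∃ σ, 0 ≤ σ ∧ l ≤ σ * A (σ ^ 2)

variable {A ψ : ℝ → ℝ} {L : ℝ}

namespace IsRadialProfile

lemma L_pos (h : IsRadialProfile A ψ L) : 0 < L := by simpa using h.lt 0 le_rfl

lemma contDiff_radialForm (h : IsRadialProfile A ψ L) : ContDiff ℝ ∞ (radialForm ψ) := by
  have : ContDiff ℝ ∞ (fun w : Model => ψ (‖w‖ ^ 2)) := contDiff_iff_contDiffAt.2 fun w =>
    (h.smooth_factor _ (by positivity)).comp w (contDiff_norm_sq ℝ).contDiffAt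
  exact (this.pow 2).smul contDiff_fubiniStudyForm

lemma radialForm_symm (w u v : Model) : radialForm ψ w u v = radialForm ψ w v u := by
  simp [radialForm, fubiniStudyForm_symm w u v]

lemma radialForm_pos (h : IsRadialProfile A ψ L) (w : Model) {u : Model} (hu : u ≠ 0) :
    0 < radialForm ψ w u u :=
  mul_pos (pow_pos (h.pos_factor _ (by positivity)) 2) (fubiniStudyForm_pos w hu)

lemma radialForm_nondegenerate (h : IsRadialProfile A ψ L) (w u : Model)
    (hu : ∀ v, radialForm ψ w u v = 0) : u = 0 := by
  by_contra hne
  exact (h.radialForm_pos w hne).ne' (hu u)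

/-- This is the field `ode` at `s = σ²`, read as a statement about arclength along a ray. -/
lemma hasDerivAt_profile (h : IsRadialProfile A ψ L) (σ : ℝ) :
    HasDerivAt (fun σ => σ * A (σ ^ 2)) (ψ (σ ^ 2) / (1 + σ ^ 2)) σ := by
  have hA : HasDerivAt A (deriv A (σ ^ 2)) (σ ^ 2) :=
    ((h.smooth _ (sq_nonneg σ)).differentiableAt (by simp)).hasDerivAt
  have := (hasDerivAt_id' σ).mul (HasDerivAt.comp (h := fun σ => σ ^ 2) σ hA (hasDerivAt_pow 2 σ))
  refine HasDerivAt.congr_deriv this ?_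
  rw [← h.ode _ (sq_nonneg σ)]
  simp
  ring

lemma strictMono_profile (h : IsRadialProfile A ψ L) : StrictMono fun σ => σ * A (σ ^ 2) :=
  strictMono_of_deriv_pos fun σ => by
    rw [(h.hasDerivAt_profile σ).deriv]
    have := h.pos_factor _ (sq_nonneg σ)
    positivity

/-- The intermediate value theorem for `l ≥ 0`, and oddness of `σ A(σ²)` for `l ≤ 0`. Negative
values are needed because geodesics are followed to slightly negative times. -/
lemma exists_profile_eq (h : IsRadialProfile A ψ L) {l : ℝ} (hl : |l| < L) :
    ∃ σ, σ * A (σ ^ 2) = l := by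
  have key : ∀ l, 0 ≤ l → l < L → ∃ σ, σ * A (σ ^ 2) = l := by
    intro l h0 hl
    obtain ⟨σ, hσ, hle⟩ := h.exists_le l hl
    have hc : ContinuousOn (fun σ => σ * A (σ ^ 2)) (Icc 0 σ) := fun τ _ =>
      (h.hasDerivAt_profile τ).continuousAt.continuousWithinAt
    obtain ⟨τ, -, hτ⟩ := intermediate_value_Icc hσ hc ⟨by simpa using h0, hle⟩
    exact ⟨τ, hτ⟩
  rcases le_total 0 l with h0 | h0
  · exact key l h0 (by rwa [abs_of_nonneg h0] at hl)
  · obtain ⟨σ, hσ⟩ := key (-l) (by linarith) (by rwa [abs_of_nonpos h0] at hl)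
    exact ⟨-σ, by rw [neg_sq]; linarith⟩

lemma norm_radialMap (h : IsRadialProfile A ψ L) (w : Model) :
    ‖radialMap A w‖ = ‖w‖ * A (‖w‖ ^ 2) := by
  rw [radialMap, norm_smul, Real.norm_of_nonneg (h.pos _ (by positivity)).le, mul_comm]

lemma radialMap_injective (h : IsRadialProfile A ψ L) : Function.Injective (radialMap A) := by
  intro w w' hw
  have h1 : ‖w‖ = ‖w'‖ := h.strictMono_profile.injective (by
    simpa only [h.norm_radialMap] using congrArg norm hw)
  simp only [radialMap, h1] at hw
  exact smul_right_injective _ (h.pos _ (by positivity)).ne' hw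

lemma radialInv_radialMap (h : IsRadialProfile A ψ L) (w : Model) :
    radialInv A (radialMap A w) = w :=
  Function.leftInverse_invFun h.radialMap_injective w

lemma radialMap_mem_ball (h : IsRadialProfile A ψ L) (w : Model) : ‖radialMap A w‖ < L := by
  rw [h.norm_radialMap]; exact h.lt _ (norm_nonneg w)

lemma radialInv_smul (h : IsRadialProfile A ψ L) {ξ : Model} (hξ : ‖ξ‖ = 1) (σ : ℝ) :
    radialInv A ((σ * A (σ ^ 2)) • ξ) = σ • ξ := by
  have : radialMap A (σ • ξ) = (σ * A (σ ^ 2)) • ξ := by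
    rw [radialMap, norm_smul, hξ, mul_one, Real.norm_eq_abs, sq_abs, smul_smul, mul_comm]
  rw [← this, h.radialInv_radialMap]

lemma radialInv_zero (h : IsRadialProfile A ψ L) : radialInv A 0 = 0 := by
  simpa [radialMap] using h.radialInv_radialMap 0

lemma radialMap_radialInv (h : IsRadialProfile A ψ L) {v : Model} (hv : ‖v‖ < L) :
    radialMap A (radialInv A v) = v := by
  suffices v ∈ range (radialMap A) from Function.invFun_eq this
  by_cases h0 : v = 0
  · exact ⟨0, by simp [radialMap, h0]⟩
  obtain ⟨σ, hσ⟩ := h.exists_profile_eq (l := ‖v‖) (by simpa using hv)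
  refine ⟨σ • (‖v‖⁻¹ • v), ?_⟩
  have h1 : ‖‖v‖⁻¹ • v‖ = 1 := by
    rw [norm_smul, norm_inv, norm_norm, inv_mul_cancel₀ (norm_ne_zero_iff.2 h0)]
  rw [radialMap, norm_smul, h1, mul_one, Real.norm_eq_abs, sq_abs, smul_smul, mul_comm, hσ,
    smul_smul, mul_inv_cancel₀ (norm_ne_zero_iff.2 h0), one_smul]

lemma contDiff_radialMap (h : IsRadialProfile A ψ L) : ContDiff ℝ ∞ (radialMap A) :=
  (contDiff_iff_contDiffAt.2 fun w =>
    (h.smooth _ (by positivity)).comp w (contDiff_norm_sq ℝ).contDiffAt).smul contDiff_id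

lemma fderiv_radialMap (h : IsRadialProfile A ψ L) (w u : Model) :
    fderiv ℝ (radialMap A) w u =
      A (‖w‖ ^ 2) • u + (2 * deriv A (‖w‖ ^ 2) * inner ℝ w u) • w := by
  have hA : HasDerivAt A (deriv A (‖w‖ ^ 2)) (‖w‖ ^ 2) :=
    ((h.smooth _ (by positivity)).differentiableAt (by simp)).hasDerivAt
  have h1 := (hA.comp_hasFDerivAt w (hasStrictFDerivAt_norm_sq w).hasFDerivAt).smul
    (hasFDerivAt_id (𝕜 := ℝ) w)
  have h2 : HasFDerivAt (radialMap A) _ w := h1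
  rw [h2.fderiv]
  simp
  ring_nf

/-- The radial component is multiplied by `A + 2 s A'`, which the field `ode` evaluates. -/
lemma inner_fderiv_radialMap (h : IsRadialProfile A ψ L) (w u : Model) :
    inner ℝ w (fderiv ℝ (radialMap A) w u) = ψ (‖w‖ ^ 2) / (1 + ‖w‖ ^ 2) * inner ℝ w u := by
  rw [h.fderiv_radialMap, inner_add_right, real_inner_smul_right, real_inner_smul_right,
    real_inner_self_eq_norm_sq, ← h.ode _ (by positivity)]
  ring

/-- The rank-one part of the differential is a real multiple of `w` and `⟨w, w⟩` is real, so only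
the factor `A` acts on the component along `iw`. -/
lemma im_inner_fderiv_radialMap (h : IsRadialProfile A ψ L) (w u : Model) :
    (inner ℂ w (fderiv ℝ (radialMap A) w u) : ℂ).im = A (‖w‖ ^ 2) * (inner ℂ w u : ℂ).im := by
  rw [h.fderiv_radialMap, inner_add_right, inner_smul_right_eq_smul, inner_smul_right_eq_smul,
    inner_self_eq_norm_sq_to_K]
  simp [← Complex.ofReal_pow]

lemma fderiv_radialMap_injective (h : IsRadialProfile A ψ L) (w : Model) :
    Function.Injective (fderiv ℝ (radialMap A) w) := by
  refine (injective_iff_map_eq_zero _).2 fun u hu => ?_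
  have h1 := h.inner_fderiv_radialMap w u
  rw [hu, inner_zero_right] at h1
  have hψ := h.pos_factor (‖w‖ ^ 2) (by positivity)
  have h2 : inner ℝ w u = 0 := by
    rcases mul_eq_zero.1 h1.symm with h3 | h3
    · exact absurd h3 (by positivity)
    · exact h3
  rw [h.fderiv_radialMap, h2] at hu
  simpa [(h.pos (‖w‖ ^ 2) (by positivity)).ne'] using hu

/-- The inverse function theorem gives a smooth local inverse; global injectivity of the radial map
identifies it with `radialInv`. -/
lemma contDiffAt_radialInv (h : IsRadialProfile A ψ L) {v : Model} (hv : ‖v‖ < L) :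
    ContDiffAt ℝ ∞ (radialInv A) v := by
  set w := radialInv A v with hw
  have hwv : radialMap A w = v := h.radialMap_radialInv hv
  let T : Model ≃L[ℝ] Model := (LinearEquiv.ofInjectiveEndo
    (fderiv ℝ (radialMap A) w : Model →ₗ[ℝ] Model)
    (h.fderiv_radialMap_injective w)).toContinuousLinearEquiv
  have hT : HasFDerivAt (radialMap A) (T : Model →L[ℝ] Model) w :=
    (h.contDiff_radialMap.differentiable (by simp) w).hasFDerivAt
  have hsm := h.contDiff_radialMap.contDiffAt (x := w)
  let φ := hsm.toOpenPartialHomeomorph (radialMap A) hT (by simp)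
  have hmem : radialMap A w ∈ φ.target :=
    hsm.image_mem_toOpenPartialHomeomorph_target hT (by simp)
  have hinv : ContDiffAt ℝ ∞ φ.symm (radialMap A w) := hsm.to_localInverse hT (by simp)
  rw [hwv] at hmem hinv
  refine hinv.congr_of_eventuallyEq ?_
  filter_upwards [φ.open_target.mem_nhds hmem] with y hy
  have : radialMap A (φ.symm y) = y := φ.right_inv hy
  conv_lhs => rw [← this]
  exact h.radialInv_radialMap _

lemma fderiv_radialMap_fderiv_radialInv (h : IsRadialProfile A ψ L) {v : Model} (hv : ‖v‖ < L)
    (a : Model) :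
    fderiv ℝ (radialMap A) (radialInv A v) (fderiv ℝ (radialInv A) v a) = a := by
  have h1 : HasFDerivAt (radialMap A ∘ radialInv A) _ v :=
    (h.contDiff_radialMap.differentiable (by simp) _).hasFDerivAt.comp v
      ((h.contDiffAt_radialInv hv).differentiableAt (by simp)).hasFDerivAt
  have h2 : radialMap A ∘ radialInv A =ᶠ[𝓝 v] id := by
    have : {x : Model | ‖x‖ < L} ∈ 𝓝 v := (isOpen_lt continuous_norm continuous_const).mem_nhds hv
    filter_upwards [this] with x hx using h.radialMap_radialInv hx
  have h3 := h1.unique ((hasFDerivAt_id v).congr_of_eventuallyEq h2)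
  exact congrArg (fun T => T a) h3

lemma fderiv_radialInv_zero (h : IsRadialProfile A ψ L) (a : Model) :
    fderiv ℝ (radialInv A) 0 a = a := by
  have h1 := h.fderiv_radialMap_fderiv_radialInv (v := 0) (by simpa using h.L_pos) a
  rw [h.radialInv_zero, h.fderiv_radialMap] at h1
  simpa [h.zero] using h1

end IsRadialProfile

end Radial

/-! ### Rays as geodesics, and the Gram determinant. -/

section Radial

variable {A ψ : ℝ → ℝ} {L : ℝ}

/-- The Gauss lemma in the chart: on the ray, a radial vector pairs only with the radial component
of `X`, since both Fubini–Study terms are multiples of `⟨ξ, X⟩`. -/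
lemma radialForm_ray {ξ : Model} (hξ : ‖ξ‖ = 1) (σ τ : ℝ) (X : Model) :
    radialForm ψ (σ • ξ) (τ • ξ) X = τ * (ψ (σ ^ 2) / (1 + σ ^ 2)) ^ 2 * inner ℝ ξ X := by
  have h1 : ‖σ • ξ‖ ^ 2 = σ ^ 2 := by rw [norm_smul, hξ, mul_one, Real.norm_eq_abs, sq_abs]
  have h2 : (inner ℂ (σ • ξ) (τ • ξ) : ℂ).im = 0 := by
    rw [inner_smul_right_eq_smul, inner_smul_left_eq_smul, inner_self_eq_norm_sq_to_K, hξ]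
    simp
  have h3 : radialForm ψ (σ • ξ) (τ • ξ) X =
    ψ (‖σ • ξ‖ ^ 2) ^ 2 * fubiniStudyForm (σ • ξ) (τ • ξ) X := rfl
  rw [h3, fubiniStudyForm_apply, h2, h1]
  simp only [real_inner_smul_left, real_inner_smul_right, real_inner_self_eq_norm_sq, hξ]
  have : 1 + σ ^ 2 ≠ 0 := by positivity
  field_simp
  ring

/-- Differentiate along the line `σ ξ + r X`. The component of `X` along `iξ` enters only through
`(r b)²`, so it drops out at `r = 0` and the answer depends on `X` through `⟨ξ, X⟩` alone. -/
lemma IsRadialProfile.fderiv_radialForm_ray (h : IsRadialProfile A ψ L) {ξ : Model}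
    (hξ : ‖ξ‖ = 1) (σ τ : ℝ) (X : Model) :
    fderiv ℝ (fun x => radialForm ψ x (τ • ξ) (τ • ξ)) (σ • ξ) X =
      2 * τ ^ 2 * (ψ (σ ^ 2) / (1 + σ ^ 2)) *
      (2 * σ * (deriv ψ (σ ^ 2) / (1 + σ ^ 2) - ψ (σ ^ 2) / (1 + σ ^ 2) ^ 2)) * inner ℝ ξ X := by
  set F : Model → ℝ := fun x => radialForm ψ x (τ • ξ) (τ • ξ)
  have hF : HasFDerivAt F (fderiv ℝ F (σ • ξ)) (σ • ξ) :=
    (((h.contDiff_radialForm.clm_apply contDiff_const).clm_apply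
      contDiff_const).differentiable (by simp) _).hasFDerivAt
  have hline : HasDerivAt (fun r : ℝ => σ • ξ + r • X) X 0 := by
    simpa using ((hasDerivAt_id (0 : ℝ)).smul_const X).const_add (σ • ξ)
  have h1 : HasDerivAt (fun r : ℝ => F (σ • ξ + r • X)) (fderiv ℝ F (σ • ξ) X) 0 := by
    have hF' : HasFDerivAt F (fderiv ℝ F (σ • ξ)) (σ • ξ + (0 : ℝ) • X) := by simpa using hF
    exact hF'.comp_hasDerivAt (0 : ℝ) hline
  refine h1.unique ?_
  set a := inner ℝ ξ X with ha
  set b := (inner ℂ X ξ : ℂ).im with hb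
  set n : ℝ → ℝ := fun r => σ ^ 2 + 2 * σ * a * r + ‖X‖ ^ 2 * r ^ 2 with hn
  have hnorm : ∀ r : ℝ, ‖σ • ξ + r • X‖ ^ 2 = n r := fun r => by
    rw [norm_add_sq_real, real_inner_smul_left, real_inner_smul_right, norm_smul, norm_smul, hξ,
      Real.norm_eq_abs, Real.norm_eq_abs, mul_pow, mul_pow, sq_abs, sq_abs]
    simp only [hn]; ring
  have hre : ∀ r : ℝ, inner ℝ (σ • ξ + r • X) ξ = σ + r * a := fun r => by
    rw [inner_add_left, real_inner_smul_left, real_inner_smul_left, real_inner_self_eq_norm_sq, hξ,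
      real_inner_comm]
    ring
  have him : ∀ r : ℝ, (inner ℂ (σ • ξ + r • X) ξ : ℂ).im = r * b := fun r => by
    rw [inner_add_left, inner_smul_left_eq_smul, inner_smul_left_eq_smul,
      inner_self_eq_norm_sq_to_K, hξ]
    simp [hb]
  have hFn : (fun r : ℝ => F (σ • ξ + r • X)) = fun r => ψ (n r) ^ 2 * (τ ^ 2 *
      ((1 + n r)⁻¹ - ((1 + n r) ^ 2)⁻¹ * ((σ + r * a) ^ 2 + (r * b) ^ 2))) := by
    funext r
    have h3 : F (σ • ξ + r • X) = ψ (‖σ • ξ + r • X‖ ^ 2) ^ 2 *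
      fubiniStudyForm (σ • ξ + r • X) (τ • ξ) (τ • ξ) := rfl
    have h4 : (inner ℂ (σ • ξ + r • X) (τ • ξ) : ℂ).im = τ * (r * b) := by
      rw [inner_smul_right_eq_smul, Complex.smul_im, him, smul_eq_mul]
    have h5 : ‖τ • ξ‖ ^ 2 = τ ^ 2 := by rw [norm_smul, hξ, mul_one, Real.norm_eq_abs, sq_abs]
    rw [h3, fubiniStudyForm_apply, hnorm, h4, real_inner_self_eq_norm_sq, h5]
    simp only [real_inner_smul_right, hre]
    ring
  rw [hFn]
  have hn0 : n 0 = σ ^ 2 := by simp [hn]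
  have hnpos : 1 + n 0 ≠ 0 := by rw [hn0]; positivity
  have dn : HasDerivAt n (2 * σ * a) 0 := by
    have := (((hasDerivAt_id' (0 : ℝ)).const_mul (2 * σ * a)).const_add (σ ^ 2)).add
      ((hasDerivAt_pow 2 (0 : ℝ)).const_mul (‖X‖ ^ 2))
    refine HasDerivAt.congr_deriv this (by simp)
  have dψ : HasDerivAt (fun r => ψ (n r)) (deriv ψ (σ ^ 2) * (2 * σ * a)) 0 := by
    have : HasDerivAt ψ (deriv ψ (σ ^ 2)) (n 0) := by
      rw [hn0]
      exact ((h.smooth_factor _ (sq_nonneg σ)).differentiableAt (by simp)).hasDerivAt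
    exact this.comp (0 : ℝ) dn
  have d1 : HasDerivAt (fun r => (1 + n r)⁻¹) (-(2 * σ * a) / (1 + n 0) ^ 2) 0 :=
    (dn.const_add 1).inv hnpos
  have d2 : HasDerivAt (fun r => ((1 + n r) ^ 2)⁻¹) _ 0 :=
    ((dn.const_add 1).pow 2).inv (pow_ne_zero 2 hnpos)
  have d3 : HasDerivAt (fun r : ℝ => (σ + r * a) ^ 2 + (r * b) ^ 2) (2 * σ * a) 0 := by
    have := ((((hasDerivAt_id' (0 : ℝ)).mul_const a).const_add σ).pow 2).add
      (((hasDerivAt_id' (0 : ℝ)).mul_const b).pow 2)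
    exact HasDerivAt.congr_deriv this (by simp)
  have d := (dψ.pow 2).mul ((d1.sub (d2.mul d3)).const_mul (τ ^ 2))
  refine HasDerivAt.congr_deriv d ?_
  have hpos : 1 + σ ^ 2 ≠ 0 := by positivity
  simp only [Pi.mul_apply, Pi.pow_apply, Pi.sub_apply, hn0]
  field_simp
  ring

/-- The curves `t ↦ radialInv A (t v)` are geodesics for the metric `radialForm ψ`. -/
lemma IsRadialProfile.geodesicEqAt (h : IsRadialProfile A ψ L) {v : Model} {t : ℝ}
    (ht : ‖t • v‖ < L) : GeodesicEqAt (radialForm ψ) (fun s => radialInv A (s • v)) t := by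
  intro X
  by_cases h0 : v = 0
  · subst h0
    simp
    exact hasDerivAt_const t 0
  set κ := ‖v‖ with hκ
  have hκ0 : κ ≠ 0 := norm_ne_zero_iff.2 h0
  set ξ := κ⁻¹ • v with hξd
  have hξ : ‖ξ‖ = 1 := by rw [hξd, norm_smul, norm_inv, hκ, norm_norm, inv_mul_cancel₀ hκ0]
  have hv : v = κ • ξ := by rw [hξd, smul_smul, mul_inv_cancel₀ hκ0, one_smul]
  set c : ℝ → Model := fun s => radialInv A (s • v) with hc
  -- Defining the position on the ray by an inner product makes its smoothness immediate; the
  -- implicit equation `f A(f²) = s κ` is derived afterwards.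
  set f : ℝ → ℝ := fun s => inner ℝ ξ (c s) with hf
  have hopen : ∀ s, ‖s • v‖ < L → ∀ᶠ r in 𝓝 s, ‖r • v‖ < L := fun s hs =>
    (isOpen_lt (f := fun r : ℝ => ‖r • v‖) (by fun_prop) continuous_const).mem_nhds hs
  have hcf : ∀ s, ‖s • v‖ < L → c s = f s • ξ ∧ f s * A (f s ^ 2) = s * κ := by
    intro s hs
    obtain ⟨σ, hσ⟩ := h.exists_profile_eq (l := s * κ) (by
      rwa [abs_mul, hκ, abs_norm, ← Real.norm_eq_abs, ← norm_smul])
    have h1 : c s = σ • ξ := by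
      simp only [hc]
      rw [hv, smul_smul, ← hσ, h.radialInv_smul hξ]
    have h2 : f s = σ := by
      simp only [hf]
      rw [h1, real_inner_smul_right, real_inner_self_eq_norm_sq, hξ]; ring
    rw [h2]
    exact ⟨h1, hσ⟩
  have hcsm : ∀ s, ‖s • v‖ < L → ContDiffAt ℝ ∞ c s := fun s hs =>
    ContDiffAt.comp s (h.contDiffAt_radialInv hs) (contDiff_id.smul contDiff_const).contDiffAt
  have hfsm : ∀ s, ‖s • v‖ < L → HasDerivAt f (deriv f s) s := fun s hs =>
    (DifferentiableAt.inner ℝ (differentiableAt_const ξ)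
      ((hcsm s hs).differentiableAt (by simp))).hasDerivAt
  -- Differentiating `f A(f²) = s κ` says that the curve has constant speed `κ`.
  have hf' : ∀ s, ‖s • v‖ < L → deriv f s * (ψ (f s ^ 2) / (1 + f s ^ 2)) = κ := by
    intro s hs
    have h1 := (h.hasDerivAt_profile (f s)).comp s (hfsm s hs)
    have h2 : (fun σ => σ * A (σ ^ 2)) ∘ f =ᶠ[𝓝 s] fun s => s * κ := by
      filter_upwards [hopen s hs] with r hr
      exact (hcf r hr).2
    have h3 := h1.unique (((hasDerivAt_id' s).mul_const κ).congr_of_eventuallyEq h2)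
    linarith
  have hc' : ∀ s, ‖s • v‖ < L → deriv c s = deriv f s • ξ := by
    intro s hs
    refine HasDerivAt.deriv (((hfsm s hs).smul_const ξ).congr_of_eventuallyEq ?_)
    filter_upwards [hopen s hs] with r hr
    exact (hcf r hr).1
  -- Constant speed eliminates `f'` from the momentum, so only first derivatives of `f` occur in the
  -- equation to be checked.
  have hmom : (fun s => radialForm ψ (c s) (deriv c s) X) =ᶠ[𝓝 t]
      fun s => κ * (ψ (f s ^ 2) / (1 + f s ^ 2)) * inner ℝ ξ X := by
    filter_upwards [hopen t ht] with s hs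
    rw [hc' s hs, (hcf s hs).1, radialForm_ray hξ, ← hf' s hs]
    ring
  refine HasDerivAt.congr_of_eventuallyEq ?_ hmom
  rw [hc' t ht, (hcf t ht).1, h.fderiv_radialForm_ray hξ]
  have hd := hfsm t ht
  have d2 : HasDerivAt (fun s => f s ^ 2) (2 * f t * deriv f t) t :=
    HasDerivAt.congr_deriv (hd.pow 2) (by simp)
  have dψ : HasDerivAt (fun s => ψ (f s ^ 2)) (deriv ψ (f t ^ 2) * (2 * f t * deriv f t)) t := by
    have : HasDerivAt ψ (deriv ψ (f t ^ 2)) (f t ^ 2) :=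
      ((h.smooth_factor _ (sq_nonneg _)).differentiableAt (by simp)).hasDerivAt
    exact HasDerivAt.comp (h := fun s => f s ^ 2) t this d2
  have hpos : 1 + f t ^ 2 ≠ 0 := by positivity
  have d := ((dψ.div (d2.const_add 1) hpos).const_mul κ).mul_const (inner ℝ ξ X)
  refine HasDerivAt.congr_deriv d ?_
  rw [← hf' t ht]
  field_simp

/-- The identity `det (1 + U V) = det (1 + V U)` reduces to a `2 × 2` determinant, which is diagonal
because `a` and `b` are orthogonal. -/
lemma det_smul_one_add_rankTwo {n : Type*} [Fintype n] [DecidableEq n] {c x y s : ℝ} (hc : c ≠ 0)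
    {a b : n → ℝ} (haa : ∑ i, a i * a i = s) (hbb : ∑ i, b i * b i = s) (hab : ∑ i, a i * b i = 0) :
    Matrix.det (Matrix.of fun i j : n => (if i = j then c else 0) + x * (a i * a j)
      + y * (b i * b j)) = c ^ Fintype.card n * ((1 + x / c * s) * (1 + y / c * s)) := by
  let U : Matrix n (Fin 2) ℝ := Matrix.of fun i k => ![a i, b i] k
  let V : Matrix (Fin 2) n ℝ := Matrix.of fun k j => ![x / c * a j, y / c * b j] k
  have h1 : (Matrix.of fun i j : n => (if i = j then c else 0) + x * (a i * a j)
      + y * (b i * b j)) = c • (1 + U * V) := by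
    ext i j
    simp [U, V, Matrix.mul_apply, Fin.sum_univ_two, Matrix.one_apply]
    split_ifs <;> field_simp <;> ring
  have hba : ∑ i, b i * a i = 0 := by simpa only [mul_comm] using hab
  have h2 : V * U = Matrix.of ![![x / c * s, 0], ![0, y / c * s]] := by
    ext k l
    fin_cases k <;> fin_cases l <;>
      simp [U, V, Matrix.mul_apply, mul_assoc, ← Finset.mul_sum, haa, hbb, hab, hba]
  rw [h1, Matrix.det_smul, Matrix.det_one_add_mul_comm, h2, Matrix.det_fin_two]
  simp

lemma finrank_model : Module.finrank ℝ Model = 4 := by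
  rw [← Module.finrank_mul_finrank ℝ ℂ Model]
  simp

/-- The Gram determinant of the metric `radialForm ψ` in geodesic coordinates. -/
lemma IsRadialProfile.det_radialForm (h : IsRadialProfile A ψ L) (w : Model)
    {u : Fin 4 → Model} (hu : Orthonormal ℝ fun i => fderiv ℝ (radialMap A) w (u i))
    (hvol : A (‖w‖ ^ 2) ^ 3 * (1 + ‖w‖ ^ 2) ^ 2 = ψ (‖w‖ ^ 2) ^ 3) :
    Matrix.det (Matrix.of fun i j : Fin 4 => radialForm ψ w (u i) (u j)) = 1 := by
  set s := ‖w‖ ^ 2 with hs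
  have hs0 : 0 ≤ s := by positivity
  have hA := h.pos s hs0
  have hψ := h.pos_factor s hs0
  have hode := h.ode s hs0
  set D := fderiv ℝ (radialMap A) w with hD
  obtain ⟨b, hb⟩ := Orthonormal.exists_orthonormalBasis_extension_of_card_eq (𝕜 := ℝ)
    (v := fun i => D (u i)) (s := univ) (by simp [finrank_model])
    (by
      exact hu.comp _ Subtype.val_injective)
  have hb' : ∀ i, b i = D (u i) := fun i => hb i (mem_univ i)
  set w' : Model := Complex.I • w with hw'
  have him : ∀ x : Model, (inner ℂ w x : ℂ).im = inner ℝ w' x := fun x => by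
    rw [inner_model_eq_re, hw', inner_smul_left]
    simp
  have hww' : inner ℝ w w' = 0 := by
    rw [inner_model_eq_re, hw', inner_smul_right, inner_self_eq_norm_sq_to_K]
    simp [← Complex.ofReal_pow]
  have hw'w' : inner ℝ w' w' = s := by
    rw [real_inner_self_eq_norm_sq, hw', norm_smul, Complex.norm_I, one_mul]
  -- Parseval for the orthonormal basis `DH(u i)`.
  have pars : ∀ x y : Model, ∑ i, inner ℝ x (D (u i)) * inner ℝ y (D (u i)) = inner ℝ x y := by
    intro x y
    rw [← b.sum_inner_mul_inner x y]
    exact Finset.sum_congr rfl fun i _ => by rw [hb', real_inner_comm y]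
  have h1 : ∀ i, inner ℝ w (D (u i)) = ψ s / (1 + s) * inner ℝ w (u i) := fun i =>
    h.inner_fderiv_radialMap w (u i)
  have h2 : ∀ i, inner ℝ w' (D (u i)) = A s * inner ℝ w' (u i) := fun i => by
    rw [← him, ← him]; exact h.im_inner_fderiv_radialMap w (u i)
  -- Orthonormality of the `DH(u i)`, solved below for `⟨u i, u j⟩`: it turns the metric into a
  -- multiple of the identity plus rank-one terms along `w` and `iw`.
  have h3 : ∀ i j, (if i = j then (1 : ℝ) else 0) = A s ^ 2 * inner ℝ (u i) (u j) +
      (4 * A s * deriv A s + 4 * deriv A s ^ 2 * s) * (inner ℝ w (u i) * inner ℝ w (u j)) := by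
    intro i j
    have := orthonormal_iff_ite.1 hu i j
    simp only [hD] at this
    rw [← this, h.fderiv_radialMap, h.fderiv_radialMap]
    simp only [inner_add_left, inner_add_right, real_inner_smul_left, real_inner_smul_right,
      real_inner_self_eq_norm_sq, ← hs, real_inner_comm w (u i)]
    ring
  -- The coefficients come from substituting `h1`, `h2` and `h3` into `fubiniStudyForm_apply`. The
  -- term with `A'` in `h3` is absorbed into `x`.
  set c := ψ s ^ 2 / (1 + s) / A s ^ 2 with hc
  set y := -(ψ s ^ 2 / (1 + s) ^ 2) / A s ^ 2 with hy
  set x := (-(ψ s ^ 2 / (1 + s) ^ 2) - c * (4 * A s * deriv A s + 4 * deriv A s ^ 2 * s)) /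
    (ψ s / (1 + s)) ^ 2 with hx
  have h4 : (Matrix.of fun i j : Fin 4 => radialForm ψ w (u i) (u j)) =
      Matrix.of fun i j : Fin 4 => (if i = j then c else 0)
        + x * (inner ℝ w (D (u i)) * inner ℝ w (D (u j)))
        + y * (inner ℝ w' (D (u i)) * inner ℝ w' (D (u j))) := by
    ext i j
    have h5 : radialForm ψ w (u i) (u j) = ψ s ^ 2 * fubiniStudyForm w (u i) (u j) := rfl
    have h6 : (if i = j then c else 0) = c * (if i = j then (1 : ℝ) else 0) := by simp
    simp only [Matrix.of_apply]
    rw [h5, fubiniStudyForm_apply, h6, h3 i j, h1, h1, h2, h2, him, him, ← hs, hx, hy, hc]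
    field_simp
    ring
  have hcne : c ≠ 0 := by positivity
  rw [h4, det_smul_one_add_rankTwo hcne (s := s) (by rw [pars, real_inner_self_eq_norm_sq])
    (by rw [pars, hw'w']) (by rw [pars, hww'])]
  -- This is `c + x s = 1`: in geodesic coordinates the eigenvalue in the radial direction is `1`.
  -- In the direction of `iw` it is `c / (1 + s)`, and the determinant becomes `c³ / (1 + s)`.
  have e1 : 1 + x / c * s = 1 / c := by
    have hμ : (ψ s / (1 + s)) ^ 2 = A s ^ 2 + (4 * A s * deriv A s + 4 * deriv A s ^ 2 * s) * s := by
      rw [← hode]; ring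
    have : c + x * s = 1 := by
      rw [hx, div_mul_eq_mul_div, ← eq_sub_iff_add_eq', div_eq_iff (by positivity)]
      have : c * A s ^ 2 = ψ s ^ 2 / (1 + s) := by rw [hc]; field_simp
      have e : (ψ s / (1 + s)) ^ 2 - ψ s ^ 2 / (1 + s) = -(ψ s ^ 2 / (1 + s) ^ 2) * s := by
        field_simp
        ring
      linear_combination -e + c * hμ + this
    field_simp
    linarith
  have e2 : 1 + y / c * s = 1 / (1 + s) := by
    rw [hy, hc]; field_simp; ring
  rw [e1, e2, Fintype.card_fin, hc]
  have : (ψ s ^ 2 / (1 + s) / A s ^ 2) ^ 4 * (1 / (ψ s ^ 2 / (1 + s) / A s ^ 2) * (1 / (1 + s))) =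
    (ψ s ^ 3) ^ 2 / (A s ^ 3 * (1 + s) ^ 2) ^ 2 := by field_simp
  rw [this, hvol, div_self (by positivity)]

end Radial

/-! ### Exponential map, injectivity radius and volume density in a radial chart. -/

section RadialChart

variable {M : Type*} [TopologicalSpace M] [ChartedSpace Model M]

/-- `e` is a chart onto `ℂ²`, centred at `P`, in which the metric `g` is `radialForm ψ`. -/
structure IsRadialChart (g : MetricField Model M) (e : OpenPartialHomeomorph M Model) (P : M)
    (ψ : ℝ → ℝ) : Prop where
  mem : e ∈ IsManifold.maximalAtlas 𝓘(ℝ, Model) ∞ M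
  target : e.target = univ
  mem_source : P ∈ e.source
  center : e P = 0
  metric : ∀ x u v, chartMetric g e x u v = radialForm ψ x u v

/-- The differential at `P` of a chart centred at `P`. -/
def chartDeriv (e : OpenPartialHomeomorph M Model) (P : M) (v : TangentSpace 𝓘(ℝ, Model) P) :
    Model :=
  mfderiv 𝓘(ℝ, Model) 𝓘(ℝ, Model) e P v

variable {g : MetricField Model M} {e : OpenPartialHomeomorph M Model} {P : M} {A ψ : ℝ → ℝ}
  {L : ℝ}

lemma IsRadialChart.mem_target (hC : IsRadialChart g e P ψ) (x : Model) : x ∈ e.target :=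
  hC.target ▸ mem_univ x

lemma IsRadialChart.apply_eq (hC : IsRadialChart g e P ψ) {Q : M} (hQ : Q ∈ e.source)
    (a b : TangentSpace 𝓘(ℝ, Model) Q) :
    g Q a b = radialForm ψ (e Q) (chartDeriv e Q a) (chartDeriv e Q b) := by
  rw [metric_eq_chartMetric g hC.mem hQ]
  exact hC.metric _ _ _

/-- At the origin the Fubini–Study form is Euclidean and `ψ 0 = 1`, so lengths and frames at `P` are
Euclidean in the chart. -/
lemma IsRadialChart.apply_center (hC : IsRadialChart g e P ψ) (hR : IsRadialProfile A ψ L)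
    (a b : TangentSpace 𝓘(ℝ, Model) P) :
    g P a b = inner ℝ (chartDeriv e P a) (chartDeriv e P b) := by
  have h : radialForm ψ 0 (chartDeriv e P a) (chartDeriv e P b) = ψ (‖(0 : Model)‖ ^ 2) ^ 2 *
    fubiniStudyForm 0 (chartDeriv e P a) (chartDeriv e P b) := rfl
  rw [hC.apply_eq hC.mem_source, hC.center, h, fubiniStudyForm_apply]
  simp [hR.zero_factor]

lemma IsRadialChart.vectorNorm_eq (hC : IsRadialChart g e P ψ) (hR : IsRadialProfile A ψ L)
    (v : TangentSpace 𝓘(ℝ, Model) P) : vectorNorm g P v = ‖chartDeriv e P v‖ := by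
  rw [vectorNorm, hC.apply_center hR, real_inner_self_eq_norm_sq, Real.sqrt_sq (norm_nonneg _)]

lemma IsRadialChart.tangentBall_eq (hC : IsRadialChart g e P ψ) (hR : IsRadialProfile A ψ L) :
    tangentBall g P (ENNReal.ofReal L) = {v | ‖chartDeriv e P v‖ < L} := by
  ext v
  rw [tangentBall, mem_ofPred_eq, mem_ofPred_eq, hC.vectorNorm_eq hR,
    ENNReal.ofReal_lt_ofReal_iff hR.L_pos]

lemma chartDeriv_bijective (he : e ∈ IsManifold.maximalAtlas 𝓘(ℝ, Model) ∞ M)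
    (hP : P ∈ e.source) : Function.Bijective (chartDeriv e P) :=
  (mdifferentiable_chart_of_mem he).mfderiv_bijective hP

/-- The differential at `P` of a chart around `P`, as a linear equivalence. -/
def chartDerivEquiv (he : e ∈ IsManifold.maximalAtlas 𝓘(ℝ, Model) ∞ M) (hP : P ∈ e.source) :
    Model ≃L[ℝ] Model :=
  (LinearEquiv.ofBijective
    (show Model →L[ℝ] Model from mfderiv 𝓘(ℝ, Model) 𝓘(ℝ, Model) e P : Model →ₗ[ℝ] Model)
    (chartDeriv_bijective he hP)).toContinuousLinearEquiv

lemma IsRadialProfile.contDiffAt_ray (hR : IsRadialProfile A ψ L) {a : Model} {t : ℝ}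
    (ht : ‖t • a‖ < L) : ContDiffAt ℝ ∞ (fun s : ℝ => radialInv A (s • a)) t :=
  ContDiffAt.comp t (hR.contDiffAt_radialInv ht) (contDiff_id.smul contDiff_const).contDiffAt

lemma IsRadialProfile.deriv_ray (hR : IsRadialProfile A ψ L) (a : Model) :
    deriv (fun s : ℝ => radialInv A (s • a)) 0 = a := by
  have h1 : HasFDerivAt (radialInv A) (fderiv ℝ (radialInv A) 0) ((0 : ℝ) • a) := by
    rw [zero_smul]
    exact ((hR.contDiffAt_radialInv (by simpa using hR.L_pos)).differentiableAt
      (by simp)).hasFDerivAt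
  have h2 : HasDerivAt (fun s : ℝ => s • a) a 0 := by
    simpa using (hasDerivAt_id (0 : ℝ)).smul_const a
  have h3 : HasDerivAt (fun s : ℝ => radialInv A (s • a)) _ 0 := h1.comp_hasDerivAt (0 : ℝ) h2
  rw [h3.deriv, hR.fderiv_radialInv_zero]

lemma IsRadialChart.isGeodesicFrom (hC : IsRadialChart g e P ψ) (hR : IsRadialProfile A ψ L)
    {U : Set M} (hU : e.source ⊆ U) {v : TangentSpace 𝓘(ℝ, Model) P}
    (hv : ‖chartDeriv e P v‖ < L) :
    IsGeodesicFrom g U P v (e.symm ∘ fun s : ℝ => radialInv A (s • chartDeriv e P v)) := by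
  set a := chartDeriv e P v with ha
  -- A geodesic needs an open interval around `[0, 1]`; this `ε` keeps `t a` in the ball of radius
  -- `L` for `t < 1 + ε`.
  obtain ⟨ε, hε, hlt⟩ := exists_pos_mul_lt (sub_pos.2 hv) ‖a‖
  have hball : ∀ t ∈ Ioo (-ε) (1 + ε), ‖t • a‖ < L := by
    intro t ht
    have : |t| ≤ 1 + ε := abs_le.2 ⟨by linarith [ht.1], ht.2.le⟩
    rw [norm_smul, Real.norm_eq_abs]
    nlinarith [mul_le_mul_of_nonneg_right this (norm_nonneg a)]
  refine isGeodesicFrom_symm_comp hC.mem hC.target hC.metric hR.contDiff_radialForm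
    IsRadialProfile.radialForm_symm hε (fun t ht => (hR.contDiffAt_ray (hball t ht)).contDiffWithinAt)
    (fun t _ => hU (e.map_target (hC.mem_target _))) (fun t ht => hR.geodesicEqAt (hball t ht))
    hC.mem_source ?_ ?_
  · rw [zero_smul, hR.radialInv_zero, hC.center]
  · exact hR.deriv_ray a

/-- No bound on the initial velocity itself is assumed, only on the length covered up to time `t`.
Geodesics of length exactly `L` can thus be followed up to their endpoint. -/
lemma IsRadialChart.geodesic_eq [T2Space M] (hC : IsRadialChart g e P ψ)
    (hR : IsRadialProfile A ψ L) {U : Set M} {v : TangentSpace 𝓘(ℝ, Model) P} {γ : ℝ → M}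
    (hγ : IsGeodesicFrom g U P v γ) {t : ℝ} (ht0 : 0 ≤ t) (ht1 : t ≤ 1)
    (ht : t * ‖chartDeriv e P v‖ < L) :
    γ t = e.symm (radialInv A (t • chartDeriv e P v)) := by
  have hγ0 := hγ.apply_zero
  have hγd := hγ.deriv_chart hC.mem hC.mem_source
  obtain ⟨⟨ε, hε, hgeo⟩, -⟩ := hγ
  change _ = chartDeriv e P v at hγd
  set a := chartDeriv e P v with ha
  obtain ⟨δ', hδ', hlt⟩ := exists_pos_mul_lt (sub_pos.2 ht) ‖a‖
  set δ := min ε δ' with hδ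
  have hδ0 : 0 < δ := lt_min hε hδ'
  have hball : ∀ s ∈ Ioo (-δ) (t + δ), ‖s • a‖ < L := by
    intro s hs
    have : |s| ≤ t + δ' := abs_le.2 ⟨by linarith [hs.1, min_le_right ε δ'],
      by linarith [hs.2, min_le_right ε δ']⟩
    rw [norm_smul, Real.norm_eq_abs]
    nlinarith [mul_le_mul_of_nonneg_right this (norm_nonneg a)]
  have hδε : δ ≤ ε := min_le_left _ _
  exact (hgeo.mono (Ioo_subset_Ioo (by linarith) (by linarith))).eqOn_symm_comp hC.mem hC.target
    hC.metric hR.contDiff_radialForm hR.radialForm_nondegenerate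
    (c := fun s : ℝ => radialInv A (s • a))
    (fun t ht => (hR.contDiffAt_ray (hball t ht)).contDiffWithinAt)
    (fun t ht => hR.geodesicEqAt (hball t ht)) ⟨by linarith, by linarith⟩
    (by rw [hγ0, zero_smul, hR.radialInv_zero, ← hC.center, e.left_inv hC.mem_source])
    (by rw [hγd, hR.deriv_ray]) ⟨by linarith, by linarith⟩

/-- `expMap` chooses an unspecified geodesic, which uniqueness identifies with the ray. -/
lemma IsRadialChart.expMap_eq [T2Space M] (hC : IsRadialChart g e P ψ)
    (hR : IsRadialProfile A ψ L) {U : Set M} (hU : e.source ⊆ U)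
    {v : TangentSpace 𝓘(ℝ, Model) P} (hv : ‖chartDeriv e P v‖ < L) :
    expMap g U P v = e.symm (radialInv A (chartDeriv e P v)) := by
  have h : ∃ γ, IsGeodesicFrom g U P v γ := ⟨_, hC.isGeodesicFrom hR hU hv⟩
  rw [expMap, dif_pos h, hC.geodesic_eq hR h.choose_spec zero_le_one le_rfl (by simpa using hv),
    one_smul]

/-- The map `x ↦ e⁻¹(H⁻¹(S x))`, where `H` is the radial map, is a diffeomorphism onto the domain
of the chart. -/
def radialDiffeo (hC : IsRadialChart g e P ψ) (hR : IsRadialProfile A ψ L) {F : Type*}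
    [NormedAddCommGroup F] [NormedSpace ℝ F] (S : F ≃L[ℝ] Model) :
    PartialDiffeomorph 𝓘(ℝ, F) 𝓘(ℝ, Model) F M ∞ where
  toFun x := e.symm (radialInv A (S x))
  invFun Q := S.symm (radialMap A (e Q))
  source := {x | ‖S x‖ < L}
  target := e.source
  map_source' x _ := e.map_target (hC.mem_target _)
  map_target' Q _ := by
    simpa using hR.radialMap_mem_ball (e Q)
  left_inv' x hx := by
    rw [e.right_inv (hC.mem_target _), hR.radialMap_radialInv hx, S.symm_apply_apply]
  right_inv' Q hQ := by
    rw [S.apply_symm_apply, hR.radialInv_radialMap, e.left_inv hQ]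
  open_source := isOpen_lt (by fun_prop) continuous_const
  open_target := e.open_source
  contMDiffOn_toFun x hx := by
    have h1 : ContDiffAt ℝ ∞ (fun x => radialInv A (S x)) x :=
      ContDiffAt.comp x (hR.contDiffAt_radialInv hx) S.contDiff.contDiffAt
    exact ((contMDiffAt_symm_of_mem_maximalAtlas hC.mem (hC.mem_target _)).comp x
      h1.contMDiffAt).contMDiffWithinAt
  contMDiffOn_invFun := by
    have h1 : ContDiff ℝ ∞ (fun y => S.symm (radialMap A y)) :=
      S.symm.contDiff.comp hR.contDiff_radialMap
    exact h1.contMDiff.comp_contMDiffOn (contMDiffOn_of_mem_maximalAtlas hC.mem)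

variable {F : Type*} [NormedAddCommGroup F] [NormedSpace ℝ F]

lemma IsRadialChart.isLocalDiffeomorphOn (hC : IsRadialChart g e P ψ) (hR : IsRadialProfile A ψ L)
    (S : F ≃L[ℝ] Model) {f : F → M}
    (hf : ∀ x, ‖S x‖ < L → f x = e.symm (radialInv A (S x))) :
    IsLocalDiffeomorphOn 𝓘(ℝ, F) 𝓘(ℝ, Model) ∞ f {x | ‖S x‖ < L} := fun x =>
  ⟨radialDiffeo hC hR S, x.2, fun y hy => hf y hy⟩

lemma IsRadialChart.bijOn (hC : IsRadialChart g e P ψ) (hR : IsRadialProfile A ψ L)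
    (S : F ≃L[ℝ] Model) {f : F → M}
    (hf : ∀ x, ‖S x‖ < L → f x = e.symm (radialInv A (S x))) :
    BijOn f {x | ‖S x‖ < L} e.source :=
  ((radialDiffeo hC hR S).toPartialEquiv.bijOn).congr fun x hx => (hf x hx).symm

/-- The injectivity radius at the centre of a radial chart is at least the length of the rays in
the chart. -/
lemma IsRadialChart.le_injRadius [T2Space M] (hC : IsRadialChart g e P ψ)
    (hR : IsRadialProfile A ψ L) {U : Set M} (hU : e.source ⊆ U) :
    ENNReal.ofReal L ≤ injRadius g U P := by
  have hexp : ∀ x : Model, ‖chartDerivEquiv hC.mem hC.mem_source x‖ < L →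
      expMap g U P x = e.symm (radialInv A (chartDerivEquiv hC.mem hC.mem_source x)) :=
    fun x hx => hC.expMap_eq hR hU (v := x) hx
  refine le_sSup ⟨?_, ?_, ?_⟩
  · rw [hC.tangentBall_eq hR]
    exact fun v hv => ⟨_, hC.isGeodesicFrom hR hU hv⟩
  · rw [hC.tangentBall_eq hR]
    exact (hC.bijOn hR (chartDerivEquiv hC.mem hC.mem_source) hexp).injOn
  · rw [hC.tangentBall_eq hR]
    exact hC.isLocalDiffeomorphOn hR (chartDerivEquiv hC.mem hC.mem_source) hexp

/-- A ball of radius above `L` contains the sphere of radius `L`, so it suffices that the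
exponential map cannot be both defined and injective there. Definedness fails on the chart domain,
injectivity on all of `CP2`. -/
lemma IsRadialChart.injRadius_eq [T2Space M] (hC : IsRadialChart g e P ψ)
    (hR : IsRadialProfile A ψ L) {U : Set M} (hU : e.source ⊆ U)
    (hup : (∀ v, ‖chartDeriv e P v‖ = L → v ∈ expDomain g U P) →
      InjOn (expMap g U P) {v | ‖chartDeriv e P v‖ = L} → False) :
    injRadius g U P = ENNReal.ofReal L := by
  refine le_antisymm (sSup_le fun ρ hρ => ?_) (hC.le_injRadius hR hU)
  by_contra! hlt
  have hsub : {v | ‖chartDeriv e P v‖ = L} ⊆ tangentBall g P ρ := fun v hv => by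
    rw [tangentBall, mem_ofPred_eq, hC.vectorNorm_eq hR, show ‖chartDeriv e P v‖ = L from hv]
    exact hlt
  exact hup (fun v hv => hρ.1 (hsub hv)) (hρ.2.1.mono hsub)

lemma exists_chartDeriv_eq (he : e ∈ IsManifold.maximalAtlas 𝓘(ℝ, Model) ∞ M)
    (hP : P ∈ e.source) {l : ℝ} (hl : 0 ≤ l) : ∃ v, ‖chartDeriv e P v‖ = l := by
  obtain ⟨a, ha⟩ := exists_norm_eq Model hl
  obtain ⟨v, hv⟩ := (chartDeriv_bijective he hP).2 a
  exact ⟨v, by rw [hv, ha]⟩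

/-- In the domain of a radial chart, no geodesic starting at the centre has length `L`. -/
lemma IsRadialChart.injRadius_source [T2Space M] (hC : IsRadialChart g e P ψ)
    (hR : IsRadialProfile A ψ L) : injRadius g e.source P = ENNReal.ofReal L := by
  refine hC.injRadius_eq hR subset_rfl fun hdom _ => ?_
  obtain ⟨v, hv⟩ := exists_chartDeriv_eq hC.mem hC.mem_source hR.L_pos.le
  obtain ⟨γ, hγ⟩ := hdom v hv
  obtain ⟨ε, hε, hgeo⟩ := hγ.1
  have h1 : (1 : ℝ) ∈ Ioo (-ε) (1 + ε) := ⟨by linarith, by linarith⟩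
  have hsrc : γ 1 ∈ e.source := hgeo.mapsTo h1
  -- For `t < 1` the radial map takes `e (γ t)` to `t v`, which tends to a vector of norm `L`. If `γ
  -- 1` lay in the chart, that vector would be a value of the radial map, and these have norm below
  -- `L`.
  have hcont : ContinuousAt (fun t => radialMap A (e (γ t))) 1 :=
    hR.contDiff_radialMap.continuous.continuousAt.comp ((e.continuousAt hsrc).comp
      ((hgeo.smooth 1 h1).contMDiffAt (isOpen_Ioo.mem_nhds h1)).continuousAt)
  have hlim : Tendsto (fun t : ℝ => t • chartDeriv e P v) (𝓝[<] 1) (𝓝 (chartDeriv e P v)) := by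
    have : Continuous fun t : ℝ => t • chartDeriv e P v := by fun_prop
    simpa using (this.tendsto 1).mono_left nhdsWithin_le_nhds
  have heq : (fun t => radialMap A (e (γ t))) =ᶠ[𝓝[<] 1] fun t => t • chartDeriv e P v := by
    filter_upwards [Ioo_mem_nhdsLT (zero_lt_one' ℝ)] with t ht
    have hlt : t * ‖chartDeriv e P v‖ < L := by rw [hv]; nlinarith [ht.2, hR.L_pos]
    rw [hC.geodesic_eq hR hγ ht.1.le ht.2.le hlt, e.right_inv (hC.mem_target _),
      hR.radialMap_radialInv (by rwa [norm_smul, Real.norm_of_nonneg ht.1.le])]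
  have := tendsto_nhds_unique ((hcont.tendsto.mono_left nhdsWithin_le_nhds).congr' heq) hlim
  have hlt := hR.radialMap_mem_ball (e (γ 1))
  rw [this, hv] at hlt
  exact lt_irrefl _ hlt

/-- The linear isometry from `ℝ⁴` given by an orthonormal frame. -/
lemma IsRadialChart.exists_frame_isometry (hC : IsRadialChart g e P ψ)
    (hR : IsRadialProfile A ψ L) {f : Fin 4 → TangentSpace 𝓘(ℝ, Model) P}
    (hf : IsOrthonormalFrame g P f) : ∃ S : EuclideanSpace ℝ (Fin 4) ≃ₗᵢ[ℝ] Model,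
      ∀ x, S x = chartDeriv e P (∑ i, x i • f i) := by
  have ho : Orthonormal ℝ fun i => chartDeriv e P (f i) :=
    orthonormal_iff_ite.2 fun i j => by rw [← hC.apply_center hR, hf i j]
  obtain ⟨b, hb⟩ := Orthonormal.exists_orthonormalBasis_extension_of_card_eq (𝕜 := ℝ)
    (v := fun i => chartDeriv e P (f i)) (s := univ) (by simp [finrank_model])
    (ho.comp _ Subtype.val_injective)
  refine ⟨b.repr.symm, fun x => ?_⟩
  have h1 : chartDeriv e P (∑ i, x i • f i) = ∑ i, x i • chartDeriv e P (f i) := by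
    unfold chartDeriv
    rw [map_sum]
    exact Finset.sum_congr rfl fun i _ => map_smul _ _ _
  rw [h1, ← b.sum_repr (b.repr.symm x)]
  exact Finset.sum_congr rfl fun i _ => by rw [hb i (mem_univ i)]; simp

/-- In the chart the coordinate fields are `D(H⁻¹)(S eᵢ)`, so `DH` sends them to the orthonormal
vectors `S eᵢ` and `IsRadialProfile.det_radialForm` applies. -/
lemma IsRadialChart.volumeDensity_eq_one [T2Space M] (hC : IsRadialChart g e P ψ)
    (hR : IsRadialProfile A ψ L) {U : Set M} (hU : e.source ⊆ U)
    (hvol : ∀ s, 0 ≤ s → A s ^ 3 * (1 + s) ^ 2 = ψ s ^ 3)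
    {f : Fin 4 → TangentSpace 𝓘(ℝ, Model) P}
    {S : EuclideanSpace ℝ (Fin 4) ≃ₗᵢ[ℝ] Model}
    (hS : ∀ x, S x = chartDeriv e P (∑ i, x i • f i)) {x : EuclideanSpace ℝ (Fin 4)}
    (hx : ‖x‖ < L) : volumeDensity g U P f x = 1 := by
  have hgc : ∀ y, ‖y‖ < L → geodesicCoord g U P f y = e.symm (radialInv A (S y)) := fun y hy => by
    rw [geodesicCoord, hC.expMap_eq hR hU (by rw [← hS, S.norm_map]; exact hy), hS]
  have hSx : ‖S x‖ < L := by rwa [S.norm_map]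
  set w := radialInv A (S x) with hw
  have hQ : geodesicCoord g U P f x ∈ e.source := by
    rw [hgc x hx]; exact e.map_target (hC.mem_target _)
  have heQ : e (geodesicCoord g U P f x) = w := by
    rw [hgc x hx, e.right_inv (hC.mem_target _)]
  have hloc : IsLocalDiffeomorphOn (𝓡 4) 𝓘(ℝ, Model) ∞ (geodesicCoord g U P f)
      {x | ‖S.toContinuousLinearEquiv x‖ < L} :=
    hC.isLocalDiffeomorphOn hR S.toContinuousLinearEquiv fun y hy =>
      hgc y (by rw [← S.norm_map]; exact hy)
  have hmd : MDifferentiableAt (𝓡 4) 𝓘(ℝ, Model) (geodesicCoord g U P f) x :=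
    (hloc ⟨x, hSx⟩).mdifferentiableAt (by simp)
  have hcoord : ∀ i, chartDeriv e (geodesicCoord g U P f x) (coordVector g U P f x i) =
      fderiv ℝ (radialInv A) (S x) (S (EuclideanSpace.single i 1)) := by
    intro i
    have h1 := mfderiv_comp (I'' := 𝓘(ℝ, Model)) x
      ((mdifferentiable_chart_of_mem hC.mem).mdifferentiableAt hQ) hmd
    have h2 : (e ∘ geodesicCoord g U P f) =ᶠ[𝓝 x] radialInv A ∘ S := by
      have : {y : EuclideanSpace ℝ (Fin 4) | ‖y‖ < L} ∈ 𝓝 x :=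
        (isOpen_lt continuous_norm continuous_const).mem_nhds hx
      filter_upwards [this] with y hy
      rw [Function.comp_apply, hgc y hy, e.right_inv (hC.mem_target _)]; rfl
    have h3 : HasFDerivAt (radialInv A ∘ S) _ x :=
      ((hR.contDiffAt_radialInv hSx).differentiableAt (by simp)).hasFDerivAt.comp x
        S.toContinuousLinearEquiv.hasFDerivAt
    rw [mfderiv_eq_fderiv, h2.fderiv_eq, h3.fderiv] at h1
    exact (congrArg (fun T => T (EuclideanSpace.single i (1 : ℝ))) h1).symm
  have hdet : Matrix.det (Matrix.of fun i j : Fin 4 => g (geodesicCoord g U P f x)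
      (coordVector g U P f x i) (coordVector g U P f x j)) = 1 := by
    simp only [hC.apply_eq hQ, hcoord, heQ]
    refine hR.det_radialForm w ?_ (hvol _ (by positivity))
    simp only [hw, hR.fderiv_radialMap_fderiv_radialInv hSx]
    refine (EuclideanSpace.orthonormal_single (𝕜 := ℝ) (ι := Fin 4)).comp_linearIsometryEquiv S
  rw [volumeDensity, hdet, Real.sqrt_one]

end RadialChart

/-! ### The profile of the Fubini–Study metric: `σ A(σ²) = arctan σ`. -/

section FubiniStudyProfile

/-- The power series of `arctan √s / √s`. -/
def arctanSeries : FormalMultilinearSeries ℝ ℝ ℝ :=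
  FormalMultilinearSeries.ofScalars ℝ fun n => (-1 : ℝ) ^ n / (2 * n + 1 : ℕ)

open Classical in
/-- The function `arctan √s / √s`, continued analytically to `s > -1`. -/
def arctanQuot (s : ℝ) : ℝ :=
  if 0 < s then Real.arctan √s / √s else arctanSeries.sum s

lemma one_le_radius_arctanSeries : 1 ≤ arctanSeries.radius := by
  refine mod_cast arctanSeries.le_radius_of_bound (r := 1) 1 fun n => ?_
  simp only [arctanSeries, FormalMultilinearSeries.ofScalars_norm, NNReal.coe_one, one_pow, mul_one,
    norm_div, norm_pow, norm_neg, norm_one]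
  rw [div_le_one (by simp; positivity)]
  simp only [Real.norm_natCast]
  exact_mod_cast Nat.le_add_left 1 _

/-- The series of `arctan √s` has only odd powers of `√s`; dividing by `√s` leaves a power series in
`s`. -/
lemma arctanSeries_sum {s : ℝ} (h0 : 0 < s) (h1 : s < 1) :
    arctanSeries.sum s = Real.arctan √s / √s := by
  have hs : 0 < √s := Real.sqrt_pos.2 h0
  have h2 : ‖√s‖ < 1 := by
    rw [Real.norm_of_nonneg hs.le, Real.sqrt_lt' one_pos]
    simpa using h1
  have h3 := (Real.hasSum_arctan h2).div_const (√s)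
  rw [← h3.tsum_eq, FormalMultilinearSeries.sum]
  refine tsum_congr fun n => ?_
  rw [arctanSeries, FormalMultilinearSeries.ofScalars_apply_eq, smul_eq_mul, pow_succ, pow_mul,
    Real.sq_sqrt h0.le]
  field_simp

lemma arctanQuot_zero : arctanQuot 0 = 1 := by
  rw [arctanQuot, if_neg (lt_irrefl _), FormalMultilinearSeries.sum, tsum_eq_single 0]
  · simp [arctanSeries]
  · intro n hn
    simp [arctanSeries, hn]

lemma arctanQuot_of_pos {s : ℝ} (h0 : 0 < s) : arctanQuot s = Real.arctan √s / √s := if_pos h0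

lemma hasDerivAt_arctanQuot {s : ℝ} (h0 : 0 < s) :
    HasDerivAt arctanQuot ((1 / (1 + s) - arctanQuot s) / (2 * s)) s := by
  have h1 : arctanQuot =ᶠ[𝓝 s] fun s => Real.arctan √s / √s := by
    filter_upwards [Ioi_mem_nhds h0] with r hr using arctanQuot_of_pos hr
  have hs : 0 < √s := Real.sqrt_pos.2 h0
  have h2 := ((Real.hasDerivAt_sqrt h0.ne').arctan.div (Real.hasDerivAt_sqrt h0.ne') hs.ne')
  refine HasDerivAt.congr_deriv (h2.congr_of_eventuallyEq h1) ?_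
  rw [arctanQuot_of_pos h0]
  have h3 : √s ^ 2 = s := Real.sq_sqrt h0.le
  have h4 : 1 + s ≠ 0 := by positivity
  rw [h3]
  generalize Real.arctan √s = a
  field_simp

/-- At `s = 0` the two branches glue to the analytic sum of the series, since they agree on `(0,
1)`. -/
lemma contDiffAt_arctanQuot {s : ℝ} (h0 : 0 ≤ s) : ContDiffAt ℝ ∞ arctanQuot s := by
  rcases h0.eq_or_lt with rfl | h0
  · have h1 : AnalyticAt ℝ arctanSeries.sum 0 :=
      (arctanSeries.hasFPowerSeriesOnBall
        (one_pos.trans_le one_le_radius_arctanSeries)).analyticAt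
    refine h1.contDiffAt.congr_of_eventuallyEq ?_
    filter_upwards [Iio_mem_nhds (zero_lt_one' ℝ)] with r hr
    rw [arctanQuot]
    split_ifs with h
    · exact (arctanSeries_sum h hr).symm
    · rfl
  · have h1 : arctanQuot =ᶠ[𝓝 s] fun s => Real.arctan √s / √s := by
      filter_upwards [Ioi_mem_nhds h0] with r hr using arctanQuot_of_pos hr
    refine ContDiffAt.congr_of_eventuallyEq ?_ h1
    have h2 : ContDiffAt ℝ ∞ Real.sqrt s := Real.contDiffAt_sqrt h0.ne'
    exact (h2.arctan).div h2 (Real.sqrt_pos.2 h0).ne'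

lemma mul_arctanQuot_sq {σ : ℝ} (hσ : 0 ≤ σ) : σ * arctanQuot (σ ^ 2) = Real.arctan σ := by
  rcases hσ.eq_or_lt with rfl | hσ
  · simp
  · rw [arctanQuot_of_pos (by positivity), Real.sqrt_sq hσ.le, mul_div_cancel₀ _ hσ.ne']

lemma isRadialProfile_fubiniStudy :
    IsRadialProfile arctanQuot (fun _ => 1) (Real.pi / 2) where
  smooth _ := contDiffAt_arctanQuot
  smooth_factor _ _ := contDiffAt_const
  pos s hs := by
    rcases hs.eq_or_lt with rfl | hs
    · simp [arctanQuot_zero]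
    · rw [arctanQuot_of_pos hs]
      have : 0 < √s := Real.sqrt_pos.2 hs
      exact div_pos (Real.arctan_pos.2 this) this
  pos_factor _ _ := one_pos
  zero := arctanQuot_zero
  zero_factor := rfl
  ode s hs := by
    rcases hs.eq_or_lt with rfl | hs
    · simp [arctanQuot_zero]
    · rw [(hasDerivAt_arctanQuot hs).deriv]
      field_simp
      ring
  lt σ hσ := by rw [mul_arctanQuot_sq hσ]; exact Real.arctan_lt_pi_div_two σ
  exists_le l hl := by
    -- Negative `l` is replaced by `0`, so that the tangent is a nonnegative witness.
    have h0 : 0 ≤ max l 0 := le_max_right _ _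
    have h1 : max l 0 < Real.pi / 2 := max_lt hl (by positivity)
    have h2 : 0 ≤ Real.tan (max l 0) := Real.tan_nonneg_of_nonneg_of_le_pi_div_two h0 h1.le
    refine ⟨Real.tan (max l 0), h2, ?_⟩
    rw [mul_arctanQuot_sq h2, Real.arctan_tan (by linarith [Real.pi_pos]) h1]
    exact le_max_left _ _

end FubiniStudyProfile

/-! ### The profile of the deformed metric. -/

section DeformedProfile

/-- The factor of `phiAux` which is smooth at `y = 0`. -/
def phiAux₀ (y : ℝ) : ℝ :=
  3 ^ (3 / 4 : ℝ) * Real.exp (Real.pi / (2 * √3)) *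
    Real.exp (-(1 / 2) * √3 * Real.arctan ((2 * y + 1) / √3)) * (y + y ^ 2 + 1) ^ (-(3 / 4) : ℝ)

/-- The conformal factor `φ_{1,4}(r)` as a function of `y = cos^{2/3} r`. -/
def phiAux (y : ℝ) : ℝ := phiAux₀ y * y ^ (-(1 / 2) : ℝ)

lemma quad_pos (y : ℝ) : 0 < y + y ^ 2 + 1 := by nlinarith [sq_nonneg (y + 1 / 2)]

lemma phiAux₀_pos (y : ℝ) : 0 < phiAux₀ y := by
  have := quad_pos y
  unfold phiAux₀
  positivity

lemma phiAux_pos {y : ℝ} (hy : 0 < y) : 0 < phiAux y :=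
  mul_pos (phiAux₀_pos y) (Real.rpow_pos_of_pos hy _)

lemma contDiff_phiAux₀ : ContDiff ℝ ∞ phiAux₀ := by
  refine ContDiff.mul ?_ ?_
  · exact contDiff_const.mul (contDiff_const.mul (ContDiff.arctan (by fun_prop))).exp
  · exact (by fun_prop : ContDiff ℝ ∞ fun y : ℝ => y + y ^ 2 + 1).rpow_const_of_ne
      fun y => (quad_pos y).ne'

lemma contDiffAt_phiAux {y : ℝ} (hy : 0 < y) : ContDiffAt ℝ ∞ phiAux y :=
  contDiff_phiAux₀.contDiffAt.mul (contDiffAt_id.rpow_const_of_ne hy.ne')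

/-- The constant in `phiAux₀` is the normalization at `y = 1`, where the arctangent is `π / 3` and
the quadratic is `3`. -/
lemma phiAux_one : phiAux 1 = 1 := by
  have h1 : Real.arctan ((2 * 1 + 1) / √3) = Real.pi / 3 := by
    rw [← Real.arctan_sqrt_three]
    congr 1
    rw [div_eq_iff (by positivity), Real.mul_self_sqrt (by norm_num)]
    norm_num
  have h2 : Real.pi / (2 * √3) + -(1 / 2) * √3 * (Real.pi / 3) = 0 := by
    have : √3 ^ 2 = 3 := Real.sq_sqrt (by norm_num)
    field_simp
    rw [this]
    norm_num
  have h3 : (3 : ℝ) ^ (3 / 4 : ℝ) * 3 ^ (-(3 / 4) : ℝ) = 1 := by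
    rw [← Real.rpow_add (by norm_num)]; simp
  rw [phiAux, phiAux₀, h1, Real.one_rpow, mul_one, mul_assoc (3 ^ (3 / 4 : ℝ)), ← Real.exp_add, h2,
    Real.exp_zero, mul_one, show (1 : ℝ) + 1 ^ 2 + 1 = 3 by norm_num, h3]

/-- With `q = y² + y + 1`, the three factors contribute `-3 / (4 q)`, `-3 (1 + 2 y) / (4 q)` and `-1
/ (2 y)` to the logarithmic derivative, and `4 q - 3 = (2 y + 1)²`. -/
lemma hasDerivAt_phiAux {y : ℝ} (hy : 0 < y) :
    HasDerivAt phiAux (-(phiAux y * (2 * y + 1) ^ 2 / (2 * y * (y + y ^ 2 + 1)))) y := by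
  have hq := quad_pos y
  have h3 : √3 ^ 2 = 3 := Real.sq_sqrt (by norm_num)
  have d0 : HasDerivAt (fun y : ℝ => (2 * y + 1) / √3) (2 / √3) y := by
    simpa using (((hasDerivAt_id' y).const_mul 2).add_const 1).div_const √3
  have d1 := (d0.arctan.const_mul (-(1 / 2) * √3)).exp.const_mul
    (3 ^ (3 / 4 : ℝ) * Real.exp (Real.pi / (2 * √3)))
  have dq : HasDerivAt (fun y : ℝ => y + y ^ 2 + 1) (1 + 2 * y) y := by
    have := ((hasDerivAt_id' y).add (hasDerivAt_pow 2 y)).add_const 1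
    exact HasDerivAt.congr_deriv this (by simp)
  have d2 := dq.rpow_const (p := -(3 / 4)) (Or.inl hq.ne')
  have d3 := (hasDerivAt_id' y).rpow_const (p := -(1 / 2)) (Or.inl hy.ne')
  have d := (d1.mul d2).mul d3
  refine HasDerivAt.congr_deriv d ?_
  rw [Real.rpow_sub_one hq.ne', Real.rpow_sub_one hy.ne', phiAux, phiAux₀]
  have h4 : 1 + ((2 * y + 1) / √3) ^ 2 = 4 / 3 * (y + y ^ 2 + 1) := by
    rw [div_pow, h3]; ring
  rw [h4]
  simp only [Pi.mul_apply]
  generalize Real.exp (-(1 / 2) * √3 * Real.arctan ((2 * y + 1) / √3)) = E1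
  generalize (y + y ^ 2 + 1) ^ (-(3 / 4) : ℝ) = E2
  generalize y ^ (-(1 / 2) : ℝ) = E3
  generalize (3 : ℝ) ^ (3 / 4 : ℝ) * Real.exp (Real.pi / (2 * √3)) = E4
  field_simp
  ring

/-- `cos^{2/3} r` as a function of `s = tan² r`. -/
def cosPow (s : ℝ) : ℝ := (1 + s) ^ (-(1 / 3) : ℝ)

lemma cosPow_pos {s : ℝ} (hs : 0 ≤ s) : 0 < cosPow s := Real.rpow_pos_of_pos (by linarith) _

lemma cosPow_cube {s : ℝ} (hs : 0 ≤ s) : cosPow s ^ 3 = (1 + s)⁻¹ := by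
  rw [cosPow, ← Real.rpow_mul_natCast (by linarith), ← Real.rpow_neg_one]
  norm_num

lemma contDiffAt_cosPow {s : ℝ} (hs : 0 ≤ s) : ContDiffAt ℝ ∞ cosPow s :=
  (contDiffAt_const.add contDiffAt_id).rpow_const_of_ne (by simp; linarith)

lemma hasDerivAt_cosPow {s : ℝ} (hs : 0 ≤ s) :
    HasDerivAt cosPow (-(1 / 3) * cosPow s / (1 + s)) s := by
  have hs' : 1 + s ≠ 0 := by linarith
  have := ((hasDerivAt_id' s).const_add 1).rpow_const (p := -(1 / 3)) (Or.inl hs')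
  refine HasDerivAt.congr_deriv this ?_
  rw [Real.rpow_sub_one hs', cosPow]
  ring

/-- The conformal factor as a function of `s = tan² r`. -/
def deformFactor (s : ℝ) : ℝ := phiAux (cosPow s)

/-- The quotient of the radius in the deformed metric by `tan r`, as a function of `s = tan² r`. -/
def deformQuot (s : ℝ) : ℝ := phiAux (cosPow s) * cosPow s ^ 2

/-- The condition for unit volume density. It dictates the factor `cosPow s ^ 2 = (1 + s)^(-2/3)` in
`deformQuot`. -/
lemma deformQuot_cube {s : ℝ} (hs : 0 ≤ s) :
    deformQuot s ^ 3 * (1 + s) ^ 2 = deformFactor s ^ 3 := by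
  have h : (cosPow s ^ 2) ^ 3 * (1 + s) ^ 2 = 1 := by
    rw [← pow_mul, mul_comm 2 3, pow_mul, cosPow_cube hs]
    field_simp
  rw [deformQuot, deformFactor, mul_pow, mul_assoc, h, mul_one]

/-- Since `σ² = y⁻³ - 1`, one has `σ y^(3/2) = √(1 - y³)`. The singular factor `y^(-1/2)` of
`phiAux` is absorbed, so the radius has the finite limit `phiAux₀ 0` as `y → 0`, that is, as `σ →
∞`. -/
lemma mul_deformQuot_sq {σ : ℝ} (hσ : 0 ≤ σ) : σ * deformQuot (σ ^ 2) =
    phiAux₀ (cosPow (σ ^ 2)) * √(1 - cosPow (σ ^ 2) ^ 3) := by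
  set y := cosPow (σ ^ 2) with hy
  have hy0 : 0 < y := cosPow_pos (sq_nonneg σ)
  have h1 : 1 - y ^ 3 = (σ * (y * √y)) ^ 2 := by
    have h2 : y ^ 3 * (1 + σ ^ 2) = 1 := by
      rw [hy, cosPow_cube (sq_nonneg σ), inv_mul_cancel₀ (by positivity)]
    rw [mul_pow, mul_pow, Real.sq_sqrt hy0.le]
    linear_combination -h2
  have h3 : y ^ (-(1 / 2) : ℝ) * y ^ 2 = y * √y := by
    rw [Real.rpow_neg hy0.le, ← Real.sqrt_eq_rpow, inv_mul_eq_iff_eq_mul₀ (by positivity)]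
    nlinarith [Real.mul_self_sqrt hy0.le]
  rw [h1, Real.sqrt_sq (by positivity), deformQuot, ← hy, phiAux, mul_assoc, h3]
  ring

lemma phiAux₀_le {y : ℝ} (hy : 0 < y) : phiAux₀ y < phiAux₀ 0 := by
  have h1 : Real.arctan ((2 * 0 + 1) / √3) ≤ Real.arctan ((2 * y + 1) / √3) := by
    apply Real.arctan_strictMono.monotone
    gcongr
  have h2 : (y + y ^ 2 + 1) ^ (-(3 / 4) : ℝ) < ((0 : ℝ) + 0 ^ 2 + 1) ^ (-(3 / 4) : ℝ) := by
    apply Real.rpow_lt_rpow_of_neg (by norm_num) _ (by norm_num)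
    nlinarith
  have h4 : Real.exp (-(1 / 2) * √3 * Real.arctan ((2 * y + 1) / √3)) ≤
      Real.exp (-(1 / 2) * √3 * Real.arctan ((2 * 0 + 1) / √3)) := by
    apply Real.exp_le_exp.2
    nlinarith [Real.sqrt_nonneg 3]
  unfold phiAux₀
  refine mul_lt_mul' (mul_le_mul_of_nonneg_left h4 (by positivity)) h2 ?_ (by positivity)
  have := quad_pos y
  positivity

lemma isRadialProfile_deformed : IsRadialProfile deformQuot deformFactor (phiAux₀ 0) where
  smooth s hs := (ContDiffAt.comp s (contDiffAt_phiAux (cosPow_pos hs)) (contDiffAt_cosPow hs)).mul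
    ((contDiffAt_cosPow hs).pow 2)
  smooth_factor s hs := ContDiffAt.comp s (contDiffAt_phiAux (cosPow_pos hs)) (contDiffAt_cosPow hs)
  pos s hs := mul_pos (phiAux_pos (cosPow_pos hs)) (pow_pos (cosPow_pos hs) 2)
  pos_factor s hs := phiAux_pos (cosPow_pos hs)
  zero := by simp [deformQuot, cosPow, phiAux_one]
  zero_factor := by simp [deformFactor, cosPow, phiAux_one]
  ode s hs := by
    have hy0 := cosPow_pos hs
    have hq := quad_pos (cosPow s)
    have d1 : HasDerivAt (fun s => phiAux (cosPow s)) _ s :=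
      (hasDerivAt_phiAux hy0).comp s (hasDerivAt_cosPow hs)
    have d : HasDerivAt deformQuot _ s := d1.mul ((hasDerivAt_cosPow hs).pow 2)
    rw [d.deriv, deformQuot, deformFactor]
    -- With `s = y⁻³ - 1` the equation becomes a rational identity in `y`, linear in `Φ`.
    have hs' : 1 + s = (cosPow s ^ 3)⁻¹ := by rw [cosPow_cube hs, inv_inv]
    generalize cosPow s = y at *
    generalize phiAux y = Φ at *
    have hs'' : s = (y ^ 3)⁻¹ - 1 := by linarith
    rw [hs', hs'']
    field_simp
    ring
  lt σ hσ := by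
    rw [mul_deformQuot_sq hσ]
    have h1 : √(1 - cosPow (σ ^ 2) ^ 3) ≤ 1 := by
      have := pow_pos (cosPow_pos (sq_nonneg σ)) 3
      exact (Real.sqrt_le_sqrt (by linarith)).trans_eq Real.sqrt_one
    calc _ ≤ phiAux₀ (cosPow (σ ^ 2)) * 1 := by gcongr; exact (phiAux₀_pos _).le
      _ < phiAux₀ 0 := by rw [mul_one]; exact phiAux₀_le (cosPow_pos (sq_nonneg σ))
  exists_le l hl := by
    have h1 : Tendsto (fun σ : ℝ => cosPow (σ ^ 2)) atTop (𝓝 0) := by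
      have h2 : Tendsto (fun σ : ℝ => 1 + σ ^ 2) atTop atTop :=
        tendsto_atTop_add_const_left _ _ (tendsto_pow_atTop two_ne_zero)
      exact (tendsto_rpow_neg_atTop (by norm_num : (0 : ℝ) < 1 / 3)).comp h2
    have h3 : Tendsto (fun y : ℝ => phiAux₀ y * √(1 - y ^ 3)) (𝓝 0) (𝓝 (phiAux₀ 0)) := by
      have : Continuous fun y : ℝ => phiAux₀ y * √(1 - y ^ 3) :=
        contDiff_phiAux₀.continuous.mul (by fun_prop)
      simpa using this.tendsto 0
    obtain ⟨σ, h4, h5⟩ := ((h3.comp h1).eventually (lt_mem_nhds hl) |>.and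
      (eventually_ge_atTop 0)).exists
    exact ⟨σ, h5, by rw [mul_deformQuot_sq h5]; exact h4.le⟩

end DeformedProfile

/-! ### Identification of the closed form with `phiAux`. -/

section PhiFormula

/-- Since `sin² r = 1 - y³ = (1 - y)(y + y² + 1)`, the factor `√(1 - y)` cancels. This removes the
`0 / 0` at `r = 0` and lowers the exponent `5 / 4` to `3 / 4`. -/
lemma phiFormula_eq {r : ℝ} (hr : r ∈ Ioo 0 (Real.pi / 2)) :
    phiFormula r = phiAux (Real.cos r ^ (2 / 3 : ℝ)) := by
  have hc : 0 < Real.cos r := Real.cos_pos_of_mem_Ioo ⟨by linarith [hr.1, hr.2], hr.2⟩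
  have hs : 0 < Real.sin r := Real.sin_pos_of_pos_of_lt_pi hr.1 (by linarith [hr.2, Real.pi_pos])
  set y := Real.cos r ^ (2 / 3 : ℝ) with hy
  have hy0 : 0 < y := Real.rpow_pos_of_pos hc _
  have h1 : Real.cos r ^ (4 / 3 : ℝ) = y ^ 2 := by
    rw [hy, ← Real.rpow_mul_natCast hc.le]; norm_num
  have h2 : Real.cos r ^ (1 / 3 : ℝ) = y ^ (1 / 2 : ℝ) := by
    rw [hy, ← Real.rpow_mul hc.le]; norm_num
  have h3 : y ^ 3 = Real.cos r ^ 2 := by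
    rw [hy, ← Real.rpow_mul_natCast hc.le]; norm_num
  have hq := quad_pos y
  have h4 : Real.sin r ^ 2 = (1 - y) * (y + y ^ 2 + 1) := by
    rw [Real.sin_sq, ← h3]; ring
  have h5 : 0 < 1 - y := by
    have : 0 < (1 - y) * (y + y ^ 2 + 1) := h4 ▸ by positivity
    exact pos_of_mul_pos_left this hq.le
  have h6 : Real.sin r = √(1 - y) * (y + y ^ 2 + 1) ^ (1 / 2 : ℝ) := by
    rw [← Real.sqrt_eq_rpow, ← Real.sqrt_mul h5.le, ← h4, Real.sqrt_sq hs.le]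
  have h7 : (y + y ^ 2 + 1) ^ (-(3 / 4) : ℝ) =
      (y + y ^ 2 + 1) ^ (1 / 2 : ℝ) * ((y + y ^ 2 + 1) ^ (5 / 4 : ℝ))⁻¹ := by
    rw [← Real.rpow_neg hq.le, ← Real.rpow_add hq]; norm_num
  have h8 : 0 < √(1 - y) := Real.sqrt_pos.2 h5
  rw [phiFormula, phiAux, phiAux₀, ← hy, h1, h2, h6, h7, Real.rpow_neg hy0.le]
  have h9 : 0 < (y + y ^ 2 + 1) ^ (5 / 4 : ℝ) := Real.rpow_pos_of_pos hq _
  have h10 : 0 < y ^ (1 / 2 : ℝ) := Real.rpow_pos_of_pos hy0 _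
  field_simp

/-- `phiAux (cos^(2/3) r)` is continuous at every point of the half-open interval, so it is the
limit that `extendFrom` takes, at `0` and at interior points alike. -/
lemma phi_eq {r : ℝ} (hr : r ∈ Ico 0 (Real.pi / 2)) :
    phi r = phiAux (Real.cos r ^ (2 / 3 : ℝ)) := by
  have hpi := Real.pi_pos
  have hc : 0 < Real.cos r := Real.cos_pos_of_mem_Ioo ⟨by linarith [hr.1, hr.2], hr.2⟩
  refine extendFrom_eq ?_ ?_
  · rw [closure_Ioo (by positivity)]
    exact ⟨hr.1, hr.2.le⟩
  · have h1 : ContinuousAt (fun r => phiAux (Real.cos r ^ (2 / 3 : ℝ))) r := by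
      refine ContinuousAt.comp (g := phiAux)
        (contDiffAt_phiAux (Real.rpow_pos_of_pos hc _)).continuousAt ?_
      exact Real.continuous_cos.continuousAt.rpow_const (Or.inl hc.ne')
    refine (h1.tendsto.mono_left nhdsWithin_le_nhds).congr' ?_
    filter_upwards [self_mem_nhdsWithin] with x hx using (phiFormula_eq hx).symm

lemma phi_zero : phi 0 = 1 := by
  rw [phi_eq ⟨le_rfl, by positivity⟩, Real.cos_zero, Real.one_rpow, phiAux_one]

lemma phi_eq_phiFormula {r : ℝ} (hr : r ∈ Ioo 0 (Real.pi / 2)) : phi r = phiFormula r := by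
  rw [phi_eq (Ioo_subset_Ico_self hr), phiFormula_eq hr]

lemma tendsto_phiFormula : Tendsto phiFormula (𝓝[>] 0) (𝓝 1) := by
  have h1 : ContinuousAt (fun r => phiAux (Real.cos r ^ (2 / 3 : ℝ))) 0 := by
    refine ContinuousAt.comp (g := phiAux) (contDiffAt_phiAux (by simp)).continuousAt ?_
    exact Real.continuous_cos.continuousAt.rpow_const (Or.inl (by simp))
  have h2 := h1.tendsto.mono_left (nhdsWithin_le_nhds (s := Ioi 0))
  simp only [Real.cos_zero, Real.one_rpow, phiAux_one] at h2
  refine h2.congr' ?_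
  filter_upwards [Ioo_mem_nhdsGT (by positivity : (0 : ℝ) < Real.pi / 2)] with x hx
    using (phiFormula_eq hx).symm

lemma phi_arctan {σ : ℝ} (hσ : 0 ≤ σ) : phi (Real.arctan σ) = deformFactor (σ ^ 2) := by
  rw [phi_eq ⟨Real.arctan_nonneg.2 hσ, Real.arctan_lt_pi_div_two σ⟩, Real.cos_arctan, deformFactor,
    cosPow, one_div, Real.sqrt_eq_rpow, ← Real.rpow_neg (by positivity),
    ← Real.rpow_mul (by positivity)]
  norm_num

end PhiFormula

/-! ### The Fubini–Study form in homogeneous coordinates. -/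

section HomogeneousForm

variable {V : Type*} [NormedAddCommGroup V] [InnerProductSpace ℂ V]

/-- The Fubini–Study form in homogeneous coordinates, at the point `[z]`. -/
def homForm (z ζ η : V) : ℝ :=
  ((inner ℂ z z * inner ℂ ζ η - inner ℂ ζ z * inner ℂ z η) / inner ℂ z z ^ 2 : ℂ).re

/-- Invariance under rescaling and under adding multiples of `z` to the tangent vectors: the form
depends only on the line and on tangent vectors modulo it. -/
lemma homForm_smul_add {z : V} (hz : z ≠ 0) (ζ η : V) {c : ℂ} (hc : c ≠ 0) (a b : ℂ) :
    homForm (c • z) (c • ζ + a • z) (c • η + b • z) = homForm z ζ η := by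
  have hN : (inner ℂ z z : ℂ) ≠ 0 := inner_self_ne_zero.2 hz
  have hc' : (starRingEnd ℂ) c ≠ 0 := (map_ne_zero _).2 hc
  simp only [homForm, inner_add_left, inner_add_right, inner_smul_left, inner_smul_right]
  congr 1
  field_simp
  ring

lemma homForm_map {W : Type*} [NormedAddCommGroup W] [InnerProductSpace ℂ W] (T : V →ₗᵢ[ℂ] W)
    (z ζ η : V) : homForm (T z) (T ζ) (T η) = homForm z ζ η := by
  simp only [homForm, T.inner_map_map]

lemma homForm_self (z ζ : V) :
    homForm z ζ ζ = (‖z‖ ^ 2 * ‖ζ‖ ^ 2 - ‖(inner ℂ z ζ : ℂ)‖ ^ 2) / (‖z‖ ^ 2) ^ 2 := by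
  have h1 : (inner ℂ ζ z * inner ℂ z ζ : ℂ) = ((‖(inner ℂ z ζ : ℂ)‖ ^ 2 : ℝ) : ℂ) := by
    rw [← inner_conj_symm, ← Complex.normSq_eq_norm_sq, Complex.normSq_eq_conj_mul_self]
  have h2 : ((‖z‖ : ℂ) ^ 2 * (‖ζ‖ : ℂ) ^ 2 - ((‖(inner ℂ z ζ : ℂ)‖ ^ 2 : ℝ) : ℂ)) /
      ((‖z‖ : ℂ) ^ 2) ^ 2 =
      (((‖z‖ ^ 2 * ‖ζ‖ ^ 2 - ‖(inner ℂ z ζ : ℂ)‖ ^ 2) / (‖z‖ ^ 2) ^ 2 : ℝ) : ℂ) := by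
    push_cast; rfl
  rw [homForm, h1, inner_self_eq_norm_sq_to_K, inner_self_eq_norm_sq_to_K]
  exact (congrArg Complex.re h2).trans (Complex.ofReal_re _)

end HomogeneousForm

/-! ### Affine charts with respect to unitary frames. -/

section Charts

/-- `ℂ³`. -/
abbrev HomSpace : Type := EuclideanSpace ℂ (Fin 3)

/-- The linear part of `homVec i`. -/
def homVecLinear (i : Fin 3) : Model →L[ℝ] HomSpace :=
  LinearMap.toContinuousLinearMap
    { toFun := fun w => WithLp.toLp 2 (i.insertNth (α := fun _ => ℂ) 0 w.ofLp)
      map_add' := fun w w' => by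
        ext k
        rcases Fin.eq_self_or_eq_succAbove i k with rfl | ⟨j, rfl⟩ <;> simp
      map_smul' := fun c w => by
        ext k
        rcases Fin.eq_self_or_eq_succAbove i k with rfl | ⟨j, rfl⟩ <;> simp }

lemma homVecLinear_same (i : Fin 3) (w : Model) : homVecLinear i w i = 0 := by
  simp [homVecLinear]

lemma homVecLinear_succAbove (i : Fin 3) (w : Model) (j : Fin 2) :
    homVecLinear i w (i.succAbove j) = w j := by
  simp [homVecLinear]

lemma homVec_eq_add (i : Fin 3) (w : Model) : homVec i w = homVec i 0 + homVecLinear i w := by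
  ext k
  rcases Fin.eq_self_or_eq_succAbove i k with rfl | ⟨j, rfl⟩
  · simp [homVec_same, homVecLinear_same]
  · simp [homVec_succAbove, homVecLinear_succAbove]

lemma hasFDerivAt_homVec (i : Fin 3) (w : Model) :
    HasFDerivAt (homVec i) (homVecLinear i) w := by
  have h : homVec i = fun w => homVec i 0 + homVecLinear i w := funext (homVec_eq_add i)
  rw [h]
  exact (homVecLinear i).hasFDerivAt.const_add _

lemma contDiff_homVec (i : Fin 3) : ContDiff ℝ ∞ (homVec i) := by
  have h : homVec i = fun w => homVec i 0 + homVecLinear i w := funext (homVec_eq_add i)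
  rw [h]
  exact contDiff_const.add (homVecLinear i).contDiff

lemma contDiffAt_affineCoord {i : Fin 3} {z : HomSpace} (hz : z i ≠ 0) :
    ContDiffAt ℝ ∞ (affineCoord i) z := by
  have h1 : ∀ k, ContDiff ℝ ∞ (fun z : HomSpace => z k) := fun k =>
    ((EuclideanSpace.proj (𝕜 := ℂ) k : HomSpace →L[ℂ] ℂ).restrictScalars ℝ).contDiff
  refine (PiLp.contDiff_toLp (𝕜 := ℝ) (p := 2)).contDiffAt.comp z (contDiffAt_pi.2 fun j => ?_)
  simp only [div_eq_mul_inv]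
  exact (h1 _).contDiffAt.mul ((h1 i).contDiffAt.inv hz)

lemma inner_homVecLinear (i : Fin 3) (u v : Model) :
    (inner ℂ (homVecLinear i u) (homVecLinear i v) : ℂ) = inner ℂ u v := by
  rw [PiLp.inner_apply, PiLp.inner_apply, Fin.sum_univ_succAbove _ i]
  simp [homVecLinear_same, homVecLinear_succAbove]

lemma inner_homVec_homVecLinear (i : Fin 3) (w v : Model) :
    (inner ℂ (homVec i w) (homVecLinear i v) : ℂ) = inner ℂ w v := by
  rw [PiLp.inner_apply, PiLp.inner_apply, Fin.sum_univ_succAbove _ i]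
  simp [homVec_same, homVecLinear_same, homVecLinear_succAbove, homVec_succAbove]

lemma inner_homVec_self (i : Fin 3) (w : Model) :
    (inner ℂ (homVec i w) (homVec i w) : ℂ) = ((1 + ‖w‖ ^ 2 : ℝ) : ℂ) := by
  rw [PiLp.inner_apply, Fin.sum_univ_succAbove _ i]
  have h : (∑ j, inner ℂ (w j) (w j) : ℂ) = inner ℂ w w := (PiLp.inner_apply w w).symm
  simp only [homVec_same, homVec_succAbove, h]
  rw [inner_self_eq_norm_sq_to_K w]
  simp

lemma norm_homVec_sq (i : Fin 3) (w : Model) : ‖homVec i w‖ ^ 2 = 1 + ‖w‖ ^ 2 := by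
  have h := inner_homVec_self i w
  rw [inner_self_eq_norm_sq_to_K] at h
  apply Complex.ofReal_injective
  rw [← h]
  push_cast
  rfl

lemma fubiniStudyForm_eq_homForm (i : Fin 3) (w u v : Model) :
    fubiniStudyForm w u v = homForm (homVec i w) (homVecLinear i u) (homVecLinear i v) := by
  have h1 : (inner ℂ (homVecLinear i u) (homVec i w) : ℂ) = (starRingEnd ℂ) (inner ℂ w u) := by
    rw [← inner_conj_symm, inner_homVec_homVecLinear]
  rw [homForm, inner_homVec_self, inner_homVecLinear, inner_homVec_homVecLinear, h1,
    ← Complex.ofReal_pow, Complex.div_ofReal_re, Complex.sub_re, Complex.re_ofReal_mul,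
    Complex.mul_re, Complex.conj_re, Complex.conj_im, fubiniStudyForm_apply, ← inner_model_eq_re,
    ← inner_model_eq_re, ← inner_model_eq_re]
  have : 1 + ‖w‖ ^ 2 ≠ 0 := by positivity
  field_simp
  ring

/-- The Fubini–Study form in the affine coordinates is the form in homogeneous coordinates. -/
lemma fubiniStudyForm_affineCoord {i : Fin 3} {z : HomSpace} (hz : z i ≠ 0) (ζ η : HomSpace) :
    fubiniStudyForm (affineCoord i z) (fderiv ℝ (affineCoord i) z ζ)
      (fderiv ℝ (affineCoord i) z η) = homForm z ζ η := by
  have hz0 : z ≠ 0 := fun h => hz (by simp [h])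
  have hopen : ∀ᶠ y : HomSpace in 𝓝 z, y i ≠ 0 :=
    (isOpen_ne_fun (f := fun y : HomSpace => y i) (by fun_prop) continuous_const).mem_nhds hz
  -- Differentiating `z ↦ z / z_i` gives `ζ / z_i` plus a multiple of `z`, which `homForm` does not
  -- see.
  have h1 : homVec i ∘ affineCoord i =ᶠ[𝓝 z] fun y => (y i)⁻¹ • y := by
    filter_upwards [hopen] with y hy
    have := congrArg (fun x => (y i)⁻¹ • x) (smul_homVec_affineCoord i y hy)
    simp only [smul_smul, inv_mul_cancel₀ hy, one_smul] at this
    exact this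
  have h2 : HasFDerivAt (homVec i ∘ affineCoord i) _ z := (hasFDerivAt_homVec i _).comp z
    ((contDiffAt_affineCoord hz).differentiableAt (by simp)).hasFDerivAt
  have hproj : HasFDerivAt (fun y : HomSpace => y i)
      ((EuclideanSpace.proj (𝕜 := ℂ) i : HomSpace →L[ℂ] ℂ).restrictScalars ℝ) z :=
    ((EuclideanSpace.proj (𝕜 := ℂ) i : HomSpace →L[ℂ] ℂ).restrictScalars ℝ).hasFDerivAt
  have hinv : HasFDerivAt (fun y : HomSpace => (y i)⁻¹)
      (fderiv ℝ (fun y : HomSpace => (y i)⁻¹) z) z :=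
    (hproj.differentiableAt.inv hz).hasFDerivAt
  have h3 : HasFDerivAt (fun y : HomSpace => (y i)⁻¹ • y) _ z := hinv.smul (hasFDerivAt_id z)
  have h4 := h2.unique (h3.congr_of_eventuallyEq h1)
  have key : ∀ ζ, homVecLinear i (fderiv ℝ (affineCoord i) z ζ) =
      (z i)⁻¹ • ζ + (fderiv ℝ (fun y : HomSpace => (y i)⁻¹) z ζ) • z := fun ζ => by
    have := congrArg (fun T => T ζ) h4
    simpa using this
  have h5 : homVec i (affineCoord i z) = (z i)⁻¹ • z := h1.self_of_nhds
  rw [fubiniStudyForm_eq_homForm i, key, key, h5, homForm_smul_add hz0 _ _ (inv_ne_zero hz)]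

/-- The point of the projective plane with homogeneous coordinates `z`. -/
abbrev proj (z : HomSpace) (hz : z ≠ 0) : CP2 := Projectivization.mk ℂ z hz

lemma affineChart_mk (i : Fin 3) (z : HomSpace) (hz : z ≠ 0) :
    affineChart i (proj z hz) = affineCoord i z := by
  obtain ⟨c, hc, h⟩ := rep_mk z hz
  change affineCoord i (Projectivization.mk ℂ z hz).rep = _
  rw [h, affineCoord_smul i c hc]

lemma mk_mem_affineChart_source (i : Fin 3) (z : HomSpace) (hz : z ≠ 0) :
    proj z hz ∈ (affineChart i).source ↔ z i ≠ 0 := by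
  obtain ⟨c, hc, h⟩ := rep_mk z hz
  change (Projectivization.mk ℂ z hz).rep i ≠ 0 ↔ _
  simp [h, hc]

lemma exists_chartAt_eq (p : CP2) : ∃ i, chartAt Model p = affineChart i ∧ p.rep i ≠ 0 :=
  ⟨(exists_rep_ne_zero p).choose, rfl, (exists_rep_ne_zero p).choose_spec⟩

lemma continuous_proj_comp {X : Type*} [TopologicalSpace X] {f : X → HomSpace} (hf : Continuous f)
    (h0 : ∀ x, f x ≠ 0) : Continuous fun x => proj (f x) (h0 x) :=
  isQuotientMap_mk.continuous.comp (hf.subtype_mk h0)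

lemma map_ne_zero_of_isometry (R : HomSpace ≃ₗᵢ[ℂ] HomSpace) {z : HomSpace} (hz : z ≠ 0) :
    R z ≠ 0 := by simpa using hz

lemma continuous_projMap (R : HomSpace ≃ₗᵢ[ℂ] HomSpace) : Continuous
    (Projectivization.map (R.toLinearEquiv : HomSpace →ₗ[ℂ] HomSpace) R.injective : CP2 → CP2) := by
  rw [isQuotientMap_mk.continuous_iff]
  exact continuous_proj_comp (f := fun z : {z : HomSpace // z ≠ 0} => R z.1)
    (R.continuous.comp continuous_subtype_val) fun z => map_ne_zero_of_isometry R z.2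

/-- The action of a unitary map on the projective plane. -/
def unitaryHomeomorph (R : HomSpace ≃ₗᵢ[ℂ] HomSpace) : CP2 ≃ₜ CP2 where
  toFun := Projectivization.map (R.toLinearEquiv : HomSpace →ₗ[ℂ] HomSpace) R.injective
  invFun := Projectivization.map (R.symm.toLinearEquiv : HomSpace →ₗ[ℂ] HomSpace) R.symm.injective
  left_inv p := by
    induction p using Projectivization.ind with
    | h z hz => simp [Projectivization.map_mk]
  right_inv p := by
    induction p using Projectivization.ind with
    | h z hz => simp [Projectivization.map_mk]
  continuous_toFun := continuous_projMap R
  continuous_invFun := continuous_projMap R.symm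

/-- The affine coordinates with respect to a unitary frame. -/
def unitaryChart (R : HomSpace ≃ₗᵢ[ℂ] HomSpace) : OpenPartialHomeomorph CP2 Model :=
  (unitaryHomeomorph R).transOpenPartialHomeomorph (affineChart 0)

variable (R : HomSpace ≃ₗᵢ[ℂ] HomSpace)

lemma unitaryChart_mk (z : HomSpace) (hz : z ≠ 0) :
    unitaryChart R (proj z hz) = affineCoord 0 (R z) :=
  affineChart_mk 0 (R z) (map_ne_zero_of_isometry R hz)

lemma mk_mem_unitaryChart_source (z : HomSpace) (hz : z ≠ 0) :
    proj z hz ∈ (unitaryChart R).source ↔ R z 0 ≠ 0 :=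
  mk_mem_affineChart_source 0 (R z) (map_ne_zero_of_isometry R hz)

/-- The homogeneous coordinates of the point with given coordinates in `unitaryChart R`. -/
def unitaryLift (w : Model) : HomSpace := R.symm (homVec 0 w)

lemma unitaryLift_ne_zero (w : Model) : unitaryLift R w ≠ 0 :=
  map_ne_zero_of_isometry R.symm (homVec_ne_zero 0 w)

lemma unitaryChart_symm_apply (w : Model) :
    (unitaryChart R).symm w = proj (unitaryLift R w) (unitaryLift_ne_zero R w) := rfl

lemma hasFDerivAt_unitaryLift (w : Model) : HasFDerivAt (unitaryLift R)
    ((R.symm.toContinuousLinearEquiv : HomSpace →L[ℂ] HomSpace).restrictScalars ℝ ∘L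
      homVecLinear 0) w :=
  ((R.symm.toContinuousLinearEquiv : HomSpace →L[ℂ] HomSpace).restrictScalars ℝ).hasFDerivAt.comp w
    (hasFDerivAt_homVec 0 w)

lemma contDiff_unitaryLift : ContDiff ℝ ∞ (unitaryLift R) :=
  ((R.symm.toContinuousLinearEquiv : HomSpace →L[ℂ] HomSpace).restrictScalars ℝ).contDiff.comp
    (contDiff_homVec 0)

lemma unitaryChart_mem_maximalAtlas :
    unitaryChart R ∈ IsManifold.maximalAtlas 𝓘(ℝ, Model) ∞ CP2 := by
  refine OpenPartialHomeomorph.mem_maximalAtlas_of_contMDiffOn _ ?_ ?_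
  · intro Q hQ
    refine ContMDiffAt.contMDiffWithinAt ?_
    obtain ⟨i, hi, hQi⟩ := exists_chartAt_eq Q
    rw [contMDiffAt_iff]
    refine ⟨(unitaryChart R).continuousAt hQ, ?_⟩
    simp only [extChartAt, hi, mfld_simps]
    have h1 : (unitaryChart R ∘ (affineChart i).symm) =
        affineCoord 0 ∘ fun w => R (homVec i w) :=
      funext fun w => unitaryChart_mk R (homVec i w) (homVec_ne_zero i w)
    rw [h1]
    have h2 : R (homVec i (affineChart i Q)) 0 ≠ 0 := by
      rw [← mk_mem_unitaryChart_source R _ (homVec_ne_zero i _)]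
      have : proj (homVec i (affineChart i Q)) (homVec_ne_zero i _) = Q :=
        (affineChart i).left_inv hQi
      rw [this]
      exact hQ
    have h3 : ContDiff ℝ ∞ fun w => R (homVec i w) :=
      ((R.toContinuousLinearEquiv : HomSpace →L[ℂ] HomSpace).restrictScalars ℝ).contDiff.comp
        (contDiff_homVec i)
    exact (ContDiffAt.comp (f := fun w => R (homVec i w)) _ (contDiffAt_affineCoord h2)
      h3.contDiffAt).contDiffWithinAt
  · intro w _
    refine ContMDiffAt.contMDiffWithinAt ?_
    obtain ⟨i, hi, hQi⟩ := exists_chartAt_eq ((unitaryChart R).symm w)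
    rw [contMDiffAt_iff_target]
    refine ⟨(unitaryChart R).continuousAt_symm (mem_univ _), ?_⟩
    rw [contMDiffAt_iff_contDiffAt]
    simp only [extChartAt, hi, mfld_simps]
    have h1 : (affineChart i ∘ (unitaryChart R).symm) = affineCoord i ∘ unitaryLift R :=
      funext fun w => affineChart_mk i _ (unitaryLift_ne_zero R w)
    rw [h1]
    have h2 : unitaryLift R w i ≠ 0 :=
      (mk_mem_affineChart_source i _ (unitaryLift_ne_zero R w)).1 hQi
    exact (contDiffAt_affineCoord h2).comp w (contDiff_unitaryLift R).contDiffAt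

/-- Tangent vectors at a point are recorded in its preferred affine chart, so this differential is
that of `affineCoord i` composed with the linear lift. -/
lemma mfderiv_unitaryChart_symm (w : Model) {i : Fin 3}
    (hi : chartAt Model ((unitaryChart R).symm w) = affineChart i) (hw : unitaryLift R w i ≠ 0)
    (u : Model) : (mfderiv 𝓘(ℝ, Model) 𝓘(ℝ, Model) (unitaryChart R).symm w u : Model) =
      fderiv ℝ (affineCoord i) (unitaryLift R w) (R.symm (homVecLinear 0 u)) := by
  have hmd : MDifferentiableAt 𝓘(ℝ, Model) 𝓘(ℝ, Model) (unitaryChart R).symm w :=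
    (mdifferentiable_chart_of_mem (unitaryChart_mem_maximalAtlas R)).mdifferentiableAt_symm
      (mem_univ w)
  have h1 : (affineChart i ∘ (unitaryChart R).symm) = affineCoord i ∘ unitaryLift R :=
    funext fun w => affineChart_mk i _ (unitaryLift_ne_zero R w)
  have h2 : HasFDerivAt (affineCoord i ∘ unitaryLift R) _ w :=
    ((contDiffAt_affineCoord hw).differentiableAt (by simp)).hasFDerivAt.comp w
      (hasFDerivAt_unitaryLift R w)
  have h3 : fderivWithin ℝ (writtenInExtChartAt 𝓘(ℝ, Model) 𝓘(ℝ, Model) w (unitaryChart R).symm)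
      (range 𝓘(ℝ, Model)) (extChartAt 𝓘(ℝ, Model) w w) =
      fderiv ℝ (affineChart i ∘ (unitaryChart R).symm) w := by
    simp only [writtenInExtChartAt, extChartAt, hi, mfld_simps]
    refine (congrFun (fderivWithin_univ (𝕜 := ℝ) (f := affineChart i ∘ (unitaryChart R).symm)) w)
  rw [h1, h2.fderiv] at h3
  exact congrArg (fun T => T u) (hmd.mfderiv.trans h3)

/-- Unitary maps are isometries of the Fubini–Study metric. -/
lemma chartMetric_unitaryChart (w u v : Model) :
    chartMetric fubiniStudy (unitaryChart R) w u v = fubiniStudyForm w u v := by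
  obtain ⟨i, hi, hQi⟩ := exists_chartAt_eq ((unitaryChart R).symm w)
  have hw : unitaryLift R w i ≠ 0 :=
    (mk_mem_affineChart_source i _ (unitaryLift_ne_zero R w)).1 hQi
  have h1 : chartMetric fubiniStudy (unitaryChart R) w u v =
      fubiniStudyForm (chartAt Model ((unitaryChart R).symm w) ((unitaryChart R).symm w))
        (mfderiv 𝓘(ℝ, Model) 𝓘(ℝ, Model) (unitaryChart R).symm w u : Model)
        (mfderiv 𝓘(ℝ, Model) 𝓘(ℝ, Model) (unitaryChart R).symm w v : Model) := rfl
  have h2 : chartAt Model ((unitaryChart R).symm w) ((unitaryChart R).symm w) =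
      affineCoord i (unitaryLift R w) := by
    rw [hi]; exact affineChart_mk i _ (unitaryLift_ne_zero R w)
  rw [h1, mfderiv_unitaryChart_symm R w hi hw u, mfderiv_unitaryChart_symm R w hi hw v, h2,
    fubiniStudyForm_affineCoord hw, fubiniStudyForm_eq_homForm 0]
  exact homForm_map R.symm.toLinearIsometry _ _ _

end Charts

/-! ### The overlap function and the Hausdorff property. -/

section Overlap

/-- `|⟨p, z⟩|² / |z|²` at the point `[z]`; for a unit vector `p`, this is the square of the cosine
of the distance from `[p]`. -/
def overlap (p : HomSpace) (Q : CP2) : ℝ := ‖(inner ℂ p Q.rep : ℂ)‖ ^ 2 / ‖Q.rep‖ ^ 2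

lemma overlap_mk (p z : HomSpace) (hz : z ≠ 0) :
    overlap p (proj z hz) = ‖(inner ℂ p z : ℂ)‖ ^ 2 / ‖z‖ ^ 2 := by
  obtain ⟨c, hc, h⟩ := rep_mk z hz
  have h1 : ‖z‖ ≠ 0 := norm_ne_zero_iff.2 hz
  have h2 : ‖c‖ ≠ 0 := norm_ne_zero_iff.2 hc
  rw [overlap, h, inner_smul_right, norm_smul, norm_mul]
  field_simp

lemma continuous_overlap (p : HomSpace) : Continuous (overlap p) := by
  rw [isQuotientMap_mk.continuous_iff]
  have : (overlap p ∘ fun z : {z : HomSpace // z ≠ 0} => (Projectivization.mk ℂ z.1 z.2 : CP2)) =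
      fun z => ‖(inner ℂ p z.1 : ℂ)‖ ^ 2 / ‖z.1‖ ^ 2 := funext fun z => overlap_mk p z.1 z.2
  rw [this]
  refine Continuous.div₀ (by fun_prop) (by fun_prop) fun z => ?_
  have := z.2
  positivity

/-- The overlap with `P` separates `P` from any other point: equal values force equality in
Cauchy–Schwarz, hence proportional representatives. -/
lemma t2Space_CP2 : T2Space CP2 := by
  refine ⟨fun P Q hPQ => separated_by_continuous (continuous_overlap P.rep) fun h => hPQ ?_⟩
  have hP := norm_ne_zero_iff.2 P.rep_nonzero
  have hQ := norm_ne_zero_iff.2 Q.rep_nonzero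
  have h1 : ‖(inner ℂ P.rep Q.rep : ℂ)‖ ^ 2 = (‖P.rep‖ * ‖Q.rep‖) ^ 2 := by
    rw [overlap, overlap, inner_self_eq_norm_sq_to_K, div_eq_div_iff (by positivity)
      (by positivity)] at h
    simp only [Complex.coe_algebraMap, norm_pow, Complex.norm_real, norm_norm] at h
    have h2 : ‖P.rep‖ ^ 2 ≠ 0 := by positivity
    apply mul_right_cancel₀ h2
    rw [← h]; ring
  have h2 := (pow_left_inj₀ (norm_nonneg _) (by positivity) two_ne_zero).1 h1
  obtain ⟨r, hr, h3⟩ := (norm_inner_eq_norm_iff P.rep_nonzero Q.rep_nonzero).1 h2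
  rw [← P.mk_rep, ← Q.mk_rep, Projectivization.mk_eq_mk_iff']
  exact ⟨r⁻¹, by rw [h3, smul_smul, inv_mul_cancel₀ hr, one_smul]⟩

end Overlap

/-! ### General lower and upper bounds for the geodesic distance. -/

section GeodesicDistance

variable {E : Type*} [NormedAddCommGroup E] [NormedSpace ℝ E]
  {M : Type*} [TopologicalSpace M] [ChartedSpace E M]

/-- A `1`-Lipschitz function bounds the geodesic distance from below. -/
lemma ofReal_sub_le_geodesicEDist (g : MetricField E M) {h : M → ℝ}
    (hh : ContMDiff 𝓘(ℝ, E) 𝓘(ℝ, ℝ) 1 h)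
    (hb : ∀ Q (u : TangentSpace 𝓘(ℝ, E) Q),
      @abs ℝ _ _ (mfderiv 𝓘(ℝ, E) 𝓘(ℝ, ℝ) h Q u) ≤ vectorNorm g Q u) (P Q : M) :
    ENNReal.ofReal (h Q - h P) ≤ geodesicEDist g P Q := by
  let : ∀ x : M, ENorm (TangentSpace 𝓘(ℝ, E) x) :=
    fun x => ⟨fun u => ENNReal.ofReal (vectorNorm g x u)⟩
  change _ ≤ riemannianEDist 𝓘(ℝ, E) P Q
  refine le_of_forall_gt fun r hr => ?_
  obtain ⟨γ, h0, h1, hγ, hlt⟩ := exists_lt_of_riemannianEDist_lt hr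
  refine lt_of_le_of_lt ?_ hlt
  have hc : ContDiffOn ℝ 1 (h ∘ γ) (Icc 0 1) := contMDiffOn_iff_contDiffOn.1 (hh.comp_contMDiffOn hγ)
  have h2 := enorm_sub_le_lintegral_deriv_of_contDiffOn_Icc hc zero_le_one
  have h3 : ENNReal.ofReal (h Q - h P) ≤ ‖(h ∘ γ) 1 - (h ∘ γ) 0‖ₑ := by
    simp only [Function.comp_apply, h0, h1]
    rw [Real.enorm_eq_ofReal_abs]
    exact ENNReal.ofReal_le_ofReal (le_abs_self _)
  refine h3.trans (h2.trans ?_)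
  -- On the open interval the derivatives of the path are two-sided, and the chain rule applies.
  rw [pathELength_eq_lintegral_mfderiv_Ioo, ← MeasureTheory.restrict_Ioo_eq_restrict_Icc]
  refine MeasureTheory.setLIntegral_mono' measurableSet_Ioo fun t ht => ?_
  have hd : MDifferentiableAt 𝓘(ℝ, ℝ) 𝓘(ℝ, E) γ t :=
    ((hγ t ⟨ht.1.le, ht.2.le⟩).contMDiffAt (Icc_mem_nhds ht.1 ht.2)).mdifferentiableAt one_ne_zero
  have h4 : deriv (h ∘ γ) t =
      mfderiv 𝓘(ℝ, E) 𝓘(ℝ, ℝ) h (γ t) (mfderiv 𝓘(ℝ, ℝ) 𝓘(ℝ, E) γ t (1 : ℝ)) := by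
    have h5 := mfderiv_comp (I := 𝓘(ℝ, ℝ)) (I' := 𝓘(ℝ, E)) (I'' := 𝓘(ℝ, ℝ)) t
      ((hh (γ t)).mdifferentiableAt one_ne_zero) hd
    rw [← fderiv_apply_one_eq_deriv, ← mfderiv_eq_fderiv]
    exact congrArg (fun T => T (1 : ℝ)) h5
  rw [Real.enorm_eq_ofReal_abs, h4]
  exact ENNReal.ofReal_le_ofReal (hb _ _)

lemma vectorNorm_smul (g : MetricField E M) (x : M) (c : ℝ) (u : TangentSpace 𝓘(ℝ, E) x) :
    vectorNorm g x (c • u) = |c| * vectorNorm g x u := by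
  simp only [vectorNorm, map_smul, smul_apply, smul_eq_mul]
  rw [← mul_assoc, ← sq, Real.sqrt_mul (sq_nonneg c), Real.sqrt_sq_eq_abs]

/-- The geodesic distance is at most the length of a path. -/
lemma geodesicEDist_le_of_hasDerivAt (g : MetricField E M) {γ : ℝ → M}
    (hγ : ContMDiff 𝓘(ℝ, ℝ) 𝓘(ℝ, E) 1 γ) {ℓ ℓ' : ℝ → ℝ} (hℓ : ∀ t, HasDerivAt ℓ (ℓ' t) t)
    (hc : Continuous ℓ') (hb : ∀ t, vectorNorm g (γ t) (mfderiv 𝓘(ℝ, ℝ) 𝓘(ℝ, E) γ t (1 : ℝ)) ≤ ℓ' t) :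
    geodesicEDist g (γ 0) (γ 1) ≤ ENNReal.ofReal (ℓ 1 - ℓ 0) := by
  let : ∀ x : M, ENorm (TangentSpace 𝓘(ℝ, E) x) :=
    fun x => ⟨fun u => ENNReal.ofReal (vectorNorm g x u)⟩
  have : ∀ x : M, ENormSMulClass ℝ (TangentSpace 𝓘(ℝ, E) x) := fun x => ⟨fun c u => by
    change ENNReal.ofReal (vectorNorm g x (c • u)) = _ * ENNReal.ofReal (vectorNorm g x u)
    rw [vectorNorm_smul, ENNReal.ofReal_mul (abs_nonneg c), Real.enorm_eq_ofReal_abs]⟩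
  change riemannianEDist 𝓘(ℝ, E) (γ 0) (γ 1) ≤ _
  refine (riemannianEDist_le_pathELength hγ.contMDiffOn rfl rfl zero_le_one).trans ?_
  rw [pathELength_eq_lintegral_mfderiv_Icc]
  have h1 : ∫⁻ t in Icc (0 : ℝ) 1, ‖mfderiv 𝓘(ℝ, ℝ) 𝓘(ℝ, E) γ t (1 : ℝ)‖ₑ ≤
      ∫⁻ t in Icc (0 : ℝ) 1, ENNReal.ofReal (ℓ' t) :=
    MeasureTheory.lintegral_mono fun t => ENNReal.ofReal_le_ofReal (hb t)
  have h0 : ∀ t, 0 ≤ ℓ' t := fun t => (Real.sqrt_nonneg _).trans (hb t)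
  refine h1.trans ?_
  rw [← MeasureTheory.ofReal_integral_eq_lintegral_ofReal hc.continuousOn.integrableOn_Icc
    (MeasureTheory.ae_of_all _ h0), MeasureTheory.integral_Icc_eq_integral_Ioc,
    ← intervalIntegral.integral_of_le zero_le_one,
    intervalIntegral.integral_eq_sub_of_hasDerivAt (fun t _ => hℓ t) (hc.intervalIntegrable _ _)]

end GeodesicDistance

/-! ### The gradient of the overlap in homogeneous coordinates. -/

section Gradient

variable {V : Type*} [NormedAddCommGroup V] [InnerProductSpace ℂ V]

lemma norm_sub_proj_sq {z : V} (hz : z ≠ 0) (x : V) :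
    ‖x - ((inner ℂ z x : ℂ) / (‖z‖ ^ 2 : ℝ)) • z‖ ^ 2 = ‖x‖ ^ 2 - ‖(inner ℂ z x : ℂ)‖ ^ 2 / ‖z‖ ^ 2 := by
  have hN : ‖z‖ ≠ 0 := norm_ne_zero_iff.2 hz
  have h1 : RCLike.re (inner ℂ x (((inner ℂ z x : ℂ) / (‖z‖ ^ 2 : ℝ)) • z)) =
      ‖(inner ℂ z x : ℂ)‖ ^ 2 / ‖z‖ ^ 2 := by
    rw [inner_smul_right, ← inner_conj_symm x z, div_mul_eq_mul_div, Complex.mul_conj]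
    simp only [RCLike.re_to_complex]
    rw [← Complex.ofReal_div, Complex.ofReal_re, Complex.normSq_eq_norm_sq]
  rw [@norm_sub_sq ℂ, h1, norm_smul, norm_div, Complex.norm_real, Real.norm_of_nonneg (by positivity)]
  field_simp
  ring

lemma inner_sub_proj {z : V} (hz : z ≠ 0) (x : V) :
    (inner ℂ z (x - ((inner ℂ z x : ℂ) / (‖z‖ ^ 2 : ℝ)) • z) : ℂ) = 0 := by
  have hN : (‖z‖ : ℂ) ≠ 0 := by exact_mod_cast norm_ne_zero_iff.2 hz
  rw [inner_sub_right, inner_smul_right, inner_self_eq_norm_sq_to_K]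
  push_cast
  simp only [Complex.coe_algebraMap]
  field_simp
  ring

/-- The derivative of `|⟨p, z⟩|² / |z|²` is controlled by the Fubini–Study form. -/
lemma overlap_gradient_bound {p z : V} (hp : ‖p‖ = 1) (hz : z ≠ 0) (ζ : V) :
    (2 * (inner ℂ (inner ℂ p z : ℂ) (inner ℂ p ζ : ℂ) : ℂ).re / ‖z‖ ^ 2 -
      ‖(inner ℂ p z : ℂ)‖ ^ 2 * (2 * (inner ℂ z ζ : ℂ).re) / (‖z‖ ^ 2) ^ 2) ^ 2 ≤
    4 * (‖(inner ℂ p z : ℂ)‖ ^ 2 / ‖z‖ ^ 2) * (1 - ‖(inner ℂ p z : ℂ)‖ ^ 2 / ‖z‖ ^ 2) *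
      homForm z ζ ζ := by
  have hN : ‖z‖ ≠ 0 := norm_ne_zero_iff.2 hz
  -- Only the components `q`, `η` of `p`, `ζ` orthogonal to `z` matter: the derivative is `(2 /
  -- |z|²) Re (conj ⟨p, z⟩ ⟨q, η⟩)`. Cauchy–Schwarz concludes, because `|q|²` is one minus the
  -- overlap and `|η|² = |z|² homForm z ζ ζ`.
  set q := p - ((inner ℂ z p : ℂ) / (‖z‖ ^ 2 : ℝ)) • z with hq
  set η := ζ - ((inner ℂ z ζ : ℂ) / (‖z‖ ^ 2 : ℝ)) • z with hη
  have h1 : (inner ℂ p η : ℂ) = inner ℂ q η := by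
    rw [hq, inner_sub_left, inner_smul_left, hη, inner_sub_proj hz, mul_zero, sub_zero]
  have h2 : (inner ℂ p η : ℂ) = inner ℂ p ζ - inner ℂ z ζ / (‖z‖ ^ 2 : ℝ) * inner ℂ p z := by
    rw [hη, inner_sub_right, inner_smul_right]
  have h3 : 2 * (inner ℂ (inner ℂ p z : ℂ) (inner ℂ p ζ : ℂ) : ℂ).re / ‖z‖ ^ 2 -
      ‖(inner ℂ p z : ℂ)‖ ^ 2 * (2 * (inner ℂ z ζ : ℂ).re) / (‖z‖ ^ 2) ^ 2 =
      2 / ‖z‖ ^ 2 * ((starRingEnd ℂ) (inner ℂ p z) * inner ℂ p η : ℂ).re := by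
    rw [h2, ← Complex.normSq_eq_norm_sq, Complex.normSq_apply, mul_comm (inner ℂ z ζ / _ : ℂ),
      ← mul_div_assoc, mul_sub, ← mul_div_assoc, Complex.sub_re, Complex.div_ofReal_re]
    simp only [RCLike.inner_apply', Complex.mul_re, Complex.mul_im, Complex.conj_re, Complex.conj_im]
    field_simp
    ring
  have h4 : |((starRingEnd ℂ) (inner ℂ p z) * inner ℂ p η : ℂ).re| ≤
      ‖(inner ℂ p z : ℂ)‖ * (‖q‖ * ‖η‖) := by
    refine (Complex.abs_re_le_norm _).trans ?_
    rw [norm_mul, RCLike.norm_conj, h1]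
    exact mul_le_mul_of_nonneg_left (norm_inner_le_norm _ _) (norm_nonneg _)
  have h5 : ‖q‖ ^ 2 = 1 - ‖(inner ℂ p z : ℂ)‖ ^ 2 / ‖z‖ ^ 2 := by
    rw [hq, norm_sub_proj_sq hz, hp, one_pow, norm_inner_symm]
  have h6 : ‖η‖ ^ 2 = ‖z‖ ^ 2 * homForm z ζ ζ := by
    rw [hη, norm_sub_proj_sq hz, homForm_self]
    field_simp
  rw [h3, mul_pow, ← sq_abs (Complex.re _), ← h5]
  calc (2 / ‖z‖ ^ 2) ^ 2 * |((starRingEnd ℂ) (inner ℂ p z) * inner ℂ p η : ℂ).re| ^ 2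
      ≤ (2 / ‖z‖ ^ 2) ^ 2 * (‖(inner ℂ p z : ℂ)‖ * (‖q‖ * ‖η‖)) ^ 2 := by gcongr
    _ = (2 / ‖z‖ ^ 2) ^ 2 * (‖(inner ℂ p z : ℂ)‖ ^ 2 * (‖q‖ ^ 2 * ‖η‖ ^ 2)) := by ring
    _ = _ := by rw [h6]; field_simp; ring

end Gradient

/-! ### The lower bound for the Fubini–Study distance. -/

section OverlapGradient

lemma overlap_comp_affineChart_symm (p : HomSpace) (i : Fin 3) :
    overlap p ∘ (affineChart i).symm =
      fun w => ‖(inner ℂ p (homVec i w) : ℂ)‖ ^ 2 / ‖homVec i w‖ ^ 2 :=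
  funext fun w => overlap_mk p (homVec i w) (homVec_ne_zero i w)

lemma contMDiff_overlap (p : HomSpace) : ContMDiff 𝓘(ℝ, Model) 𝓘(ℝ, ℝ) ∞ (overlap p) := by
  intro Q
  obtain ⟨i, hi, -⟩ := exists_chartAt_eq Q
  rw [contMDiffAt_iff]
  refine ⟨(continuous_overlap p).continuousAt, ?_⟩
  simp only [extChartAt, hi, mfld_simps]
  rw [overlap_comp_affineChart_symm]
  have h1 : ContDiff ℝ ∞ fun w => (inner ℂ p (homVec i w) : ℂ) :=
    ((innerSL ℂ p).restrictScalars ℝ).contDiff.comp (contDiff_homVec i)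
  exact ((h1.norm_sq ℂ).div ((contDiff_homVec i).norm_sq ℂ) fun w =>
    pow_ne_zero 2 (norm_ne_zero_iff.2 (homVec_ne_zero i w))).contDiffWithinAt

lemma overlap_nonneg (p : HomSpace) (Q : CP2) : 0 ≤ overlap p Q := by
  unfold overlap; positivity

lemma overlap_le_one {p : HomSpace} (hp : ‖p‖ = 1) (Q : CP2) : overlap p Q ≤ 1 := by
  have h := norm_inner_le_norm (𝕜 := ℂ) p Q.rep
  rw [hp, one_mul] at h
  have hQ := norm_pos_iff.2 Q.rep_nonzero
  rw [overlap, div_le_one (by positivity)]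
  gcongr

lemma fderiv_overlap_comp_affineChart_symm {p : HomSpace} (i : Fin 3) (w u : Model) :
    fderiv ℝ (overlap p ∘ (affineChart i).symm) w u =
      2 * (inner ℂ (inner ℂ p (homVec i w) : ℂ) (inner ℂ p (homVecLinear i u) : ℂ) : ℂ).re /
        ‖homVec i w‖ ^ 2 -
      ‖(inner ℂ p (homVec i w) : ℂ)‖ ^ 2 * (2 * (inner ℂ (homVec i w) (homVecLinear i u) : ℂ).re) /
        (‖homVec i w‖ ^ 2) ^ 2 := by
  have h1 : HasFDerivAt (fun w => (inner ℂ p (homVec i w) : ℂ))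
      (((innerSL ℂ p).restrictScalars ℝ) ∘L homVecLinear i) w :=
    ((innerSL ℂ p).restrictScalars ℝ).hasFDerivAt.comp w (hasFDerivAt_homVec i w)
  have h2 : HasFDerivAt (fun w : Model => 1 + ‖w‖ ^ 2) _ w := (hasFDerivAt_id w).norm_sq.const_add 1
  have hN : 1 + ‖w‖ ^ 2 ≠ 0 := by positivity
  have h3 : HasFDerivAt (fun w => ‖(inner ℂ p (homVec i w) : ℂ)‖ ^ 2 * (1 + ‖w‖ ^ 2)⁻¹) _ w :=
    h1.norm_sq.mul ((hasDerivAt_inv hN).comp_hasFDerivAt w h2)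
  have h4 : overlap p ∘ (affineChart i).symm = _ := overlap_comp_affineChart_symm p i
  simp only [norm_homVec_sq, div_eq_mul_inv] at h4
  rw [h4, h3.fderiv, norm_homVec_sq, inner_homVec_homVecLinear]
  have h5 : (inner ℝ (inner ℂ p (homVec i w) : ℂ) (inner ℂ p (homVecLinear i u) : ℂ) : ℝ) =
    (inner ℂ (inner ℂ p (homVec i w) : ℂ) (inner ℂ p (homVecLinear i u) : ℂ) : ℂ).re := by
    simp [Complex.inner, mul_comm]
  simp [inner_model_eq_re, -RCLike.inner_apply, h5]
  field_simp
  ring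

lemma mfderiv_overlap_sq_le {p : HomSpace} (hp : ‖p‖ = 1) (Q : CP2)
    (u : TangentSpace 𝓘(ℝ, Model) Q) :
    @HPow.hPow ℝ ℕ ℝ _ (mfderiv 𝓘(ℝ, Model) 𝓘(ℝ, ℝ) (overlap p) Q u) 2 ≤
      4 * overlap p Q * (1 - overlap p Q) * fubiniStudy Q u u := by
  obtain ⟨i, hi, hQ⟩ := exists_chartAt_eq Q
  set w : Model := affineChart i Q with hw
  have hQw : (affineChart i).symm w = Q := (affineChart i).left_inv hQ
  have hF : overlap p Q = ‖(inner ℂ p (homVec i w) : ℂ)‖ ^ 2 / ‖homVec i w‖ ^ 2 := by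
    rw [← congrFun (overlap_comp_affineChart_symm p i) w, Function.comp_apply, hQw]
  have hmd : MDifferentiableAt 𝓘(ℝ, Model) 𝓘(ℝ, ℝ) (overlap p) Q :=
    (contMDiff_overlap p Q).mdifferentiableAt (by simp)
  have h3 : fderivWithin ℝ (writtenInExtChartAt 𝓘(ℝ, Model) 𝓘(ℝ, ℝ) Q (overlap p))
      (range 𝓘(ℝ, Model)) (extChartAt 𝓘(ℝ, Model) Q Q) =
      fderiv ℝ (overlap p ∘ (affineChart i).symm) w := by
    simp only [writtenInExtChartAt, extChartAt, hi, mfld_simps]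
    exact congrFun (fderivWithin_univ (𝕜 := ℝ) (f := overlap p ∘ (affineChart i).symm)) w
  have key : ∀ v : Model, (fderiv ℝ (overlap p ∘ (affineChart i).symm) w v) ^ 2 ≤
      4 * overlap p Q * (1 - overlap p Q) * fubiniStudyForm (chartAt Model Q Q) v v := fun v => by
    rw [hi, fderiv_overlap_comp_affineChart_symm, hF, fubiniStudyForm_eq_homForm i]
    exact overlap_gradient_bound hp (homVec_ne_zero i w) (homVecLinear i v)
  have h4 := key u
  rw [← h3, ← hmd.mfderiv] at h4
  exact h4

/-- A smooth approximation of the Fubini–Study distance from `[p]`. -/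
def approxDist (p : HomSpace) (a : ℝ) (Q : CP2) : ℝ :=
  1 / 2 * Real.arccos ((2 * overlap p Q - 1) / a)

variable {p : HomSpace} {a : ℝ}

/-- Taking `a > 1` keeps the argument off `±1`, where `arccos` is not differentiable. -/
lemma two_mul_overlap_sub_one_div_mem (hp : ‖p‖ = 1) (ha : 1 < a) (Q : CP2) :
    -1 < (2 * overlap p Q - 1) / a ∧ (2 * overlap p Q - 1) / a < 1 := by
  have h0 := overlap_nonneg p Q
  have h1 := overlap_le_one hp Q
  have ha0 : 0 < a := by linarith
  exact ⟨by rw [lt_div_iff₀ ha0]; linarith, by rw [div_lt_iff₀ ha0]; linarith⟩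

lemma contMDiff_approxDist (hp : ‖p‖ = 1) (ha : 1 < a) :
    ContMDiff 𝓘(ℝ, Model) 𝓘(ℝ, ℝ) 1 (approxDist p a) := by
  intro Q
  obtain ⟨h1, h2⟩ := two_mul_overlap_sub_one_div_mem hp ha Q
  have h3 : ContDiffAt ℝ 1 (fun x : ℝ => 1 / 2 * Real.arccos ((2 * x - 1) / a)) (overlap p Q) :=
    contDiffAt_const.mul (ContDiffAt.comp (g := Real.arccos) _ (Real.contDiffAt_arccos h1.ne' h2.ne)
      (((contDiffAt_const.mul contDiffAt_id).sub contDiffAt_const).div_const a))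
  exact h3.contMDiffAt.comp Q ((contMDiff_overlap p).of_le (by simp) Q)

lemma abs_mfderiv_approxDist_le (hp : ‖p‖ = 1) (ha : 1 < a) (Q : CP2)
    (u : TangentSpace 𝓘(ℝ, Model) Q) :
    @abs ℝ _ _ (mfderiv 𝓘(ℝ, Model) 𝓘(ℝ, ℝ) (approxDist p a) Q u) ≤ vectorNorm fubiniStudy Q u := by
  obtain ⟨h1, h2⟩ := two_mul_overlap_sub_one_div_mem hp ha Q
  have ha0 : 0 < a := by linarith
  set f := overlap p Q with hf
  have hf0 : 0 ≤ f := overlap_nonneg p Q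
  have hf1 : f ≤ 1 := overlap_le_one hp Q
  have h3 : HasDerivAt (fun x : ℝ => 1 / 2 * Real.arccos ((2 * x - 1) / a))
      (1 / 2 * (-(1 / √(1 - ((2 * f - 1) / a) ^ 2)) * (2 * 1 / a))) f :=
    (HasDerivAt.comp f (Real.hasDerivAt_arccos h1.ne' h2.ne)
      ((((hasDerivAt_id f).const_mul 2).sub_const 1).div_const a)).const_mul (1 / 2)
  have h4 := mfderiv_comp (I := 𝓘(ℝ, Model)) (I' := 𝓘(ℝ, ℝ)) (I'' := 𝓘(ℝ, ℝ)) Q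
    (g := fun x : ℝ => 1 / 2 * Real.arccos ((2 * x - 1) / a))
    h3.differentiableAt.mdifferentiableAt ((contMDiff_overlap p Q).mdifferentiableAt (by simp))
  have h5 : mfderiv 𝓘(ℝ, Model) 𝓘(ℝ, ℝ) (approxDist p a) Q u =
      fderiv ℝ (fun x : ℝ => 1 / 2 * Real.arccos ((2 * x - 1) / a)) f
        (mfderiv 𝓘(ℝ, Model) 𝓘(ℝ, ℝ) (overlap p) Q u) := by
    rw [← mfderiv_eq_fderiv]
    exact congrArg (fun T => T u) h4
  have h6 := mfderiv_overlap_sq_le hp Q u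
  rw [h5]
  generalize hd : (mfderiv 𝓘(ℝ, Model) 𝓘(ℝ, ℝ) (overlap p) Q u) = d at h6
  change ℝ at d
  have key : ∀ d : ℝ, d ^ 2 ≤ 4 * f * (1 - f) * fubiniStudy Q u u →
      |fderiv ℝ (fun x : ℝ => 1 / 2 * Real.arccos ((2 * x - 1) / a)) f d| ≤
        Real.sqrt (fubiniStudy Q u u) := fun d hd => by
    have hpos : 0 < 1 - ((2 * f - 1) / a) ^ 2 := by nlinarith
    apply Real.abs_le_sqrt
    rw [h3.hasFDerivAt.fderiv]
    simp only [ContinuousLinearMap.toSpanSingleton_apply, smul_eq_mul]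
    have hs := Real.sq_sqrt hpos.le
    have e1 : (d * (1 / 2 * (-(1 / √(1 - ((2 * f - 1) / a) ^ 2)) * (2 * 1 / a)))) ^ 2 =
        d ^ 2 / (a ^ 2 - (2 * f - 1) ^ 2) := by
      have : a ^ 2 - (2 * f - 1) ^ 2 = a ^ 2 * √(1 - ((2 * f - 1) / a) ^ 2) ^ 2 := by
        rw [hs]; field_simp
      rw [this]
      have := (Real.sqrt_pos.2 hpos).ne'
      field_simp
    have hD : 0 < a ^ 2 - (2 * f - 1) ^ 2 := by nlinarith
    rw [e1, div_le_iff₀ hD]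
    refine hd.trans ?_
    have hg : 0 ≤ fubiniStudy Q u u := by
      by_cases hu : (show Model from u) = 0
      · have : u = 0 := hu
        rw [this]; simp
      · exact (fubiniStudyForm_pos _ hu).le
    -- What remains is `4 f (1 - f) = 1 - (2 f - 1)² ≤ a² - (2 f - 1)²`.
    rw [mul_comm _ (a ^ 2 - (2 * f - 1) ^ 2)]
    exact mul_le_mul_of_nonneg_right (by nlinarith) hg
  exact key d h6

/-- The lower bound for the Fubini–Study distance. -/
lemma ofReal_arccos_overlap_le (hp : ‖p‖ = 1) (hp0 : p ≠ 0) (Q : CP2) :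
    ENNReal.ofReal (1 / 2 * Real.arccos (2 * overlap p Q - 1)) ≤
      geodesicEDist fubiniStudy (proj p hp0) Q := by
  have h1 : overlap p (proj p hp0) = 1 := by
    rw [overlap_mk, inner_self_eq_norm_sq_to_K, hp]; simp
  have h2 : ∀ a > 1, ENNReal.ofReal (approxDist p a Q - approxDist p a (proj p hp0)) ≤
      geodesicEDist fubiniStudy (proj p hp0) Q := fun a ha =>
    ofReal_sub_le_geodesicEDist _ (contMDiff_approxDist hp ha) (abs_mfderiv_approxDist_le hp ha) _ _
  have h3 : ∀ Q, Tendsto (fun a => approxDist p a Q) (𝓝[>] 1)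
      (𝓝 (1 / 2 * Real.arccos (2 * overlap p Q - 1))) := fun Q => by
    have : ContinuousAt (fun a => approxDist p a Q) 1 := by
      unfold approxDist
      exact continuousAt_const.mul (Real.continuous_arccos.continuousAt.comp
        (continuousAt_const.div continuousAt_id one_ne_zero))
    have h4 := this.tendsto
    rw [approxDist, div_one] at h4
    exact h4.mono_left nhdsWithin_le_nhds
  -- Let `a` decrease to `1`; the value at the centre tends to `0`.
  have h4 := ENNReal.tendsto_ofReal ((h3 Q).sub (h3 (proj p hp0)))
  have h5 : 1 / 2 * Real.arccos (2 * overlap p (proj p hp0) - 1) = 0 := by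
    rw [h1]; norm_num
  rw [h5, sub_zero] at h4
  exact le_of_tendsto h4 (eventually_mem_nhdsWithin.mono h2)

end OverlapGradient

/-! ### The Fubini–Study distance in centred charts. -/

section Distance

lemma exists_unitary_frame {p : HomSpace} (hp : ‖p‖ = 1) :
    ∃ R : HomSpace ≃ₗᵢ[ℂ] HomSpace, R p = homVec 0 0 := by
  have h1 : Orthonormal ℂ (({0} : Set (Fin 3)).domRestrict fun _ => p) := by
    refine ⟨fun _ => hp, fun i j hij => (hij (Subsingleton.elim i j)).elim⟩
  obtain ⟨b, hb⟩ := h1.exists_orthonormalBasis_extension_of_card_eq (ι := Fin 3) (by simp)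
  refine ⟨b.repr, ?_⟩
  have h0 : b 0 = p := hb 0 rfl
  rw [← h0, b.repr_self]
  ext k
  fin_cases k <;> simp [homVec]

variable {p : HomSpace} {R : HomSpace ≃ₗᵢ[ℂ] HomSpace}

lemma overlap_mk_eq (hR : R p = homVec 0 0) (z : HomSpace) (hz : z ≠ 0) :
    overlap p (proj z hz) = ‖R z 0‖ ^ 2 / ‖z‖ ^ 2 := by
  rw [overlap_mk, ← R.inner_map_map, hR, PiLp.inner_apply, Fin.sum_univ_succ]
  simp [homVec]

lemma overlap_unitaryChart_symm (hR : R p = homVec 0 0) (w : Model) :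
    overlap p ((unitaryChart R).symm w) = (1 + ‖w‖ ^ 2)⁻¹ := by
  rw [unitaryChart_symm_apply, overlap_mk_eq hR]
  simp [unitaryLift, homVec_same, norm_homVec_sq]

lemma overlap_eq_zero (hR : R p = homVec 0 0) {Q : CP2} (hQ : Q ∉ (unitaryChart R).source) :
    overlap p Q = 0 := by
  induction Q using Projectivization.ind with
  | h z hz =>
    have h := (mk_mem_unitaryChart_source R z hz).not.1 hQ
    rw [not_not] at h
    rw [overlap_mk_eq hR, h]
    simp

lemma half_arccos_eq_arctan {σ : ℝ} (hσ : 0 ≤ σ) :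
    1 / 2 * Real.arccos (2 * (1 + σ ^ 2)⁻¹ - 1) = Real.arctan σ := by
  have h1 : 2 * (1 + σ ^ 2)⁻¹ - 1 = Real.cos (2 * Real.arctan σ) := by
    rw [Real.cos_two_mul, Real.cos_sq_arctan, one_div]
  have h2 := Real.arctan_nonneg.2 hσ
  have h3 := Real.arctan_lt_pi_div_two σ
  rw [h1, Real.arccos_cos (by linarith) (by linarith)]
  ring

lemma fubiniStudyForm_ray (w : Model) (t : ℝ) :
    fubiniStudyForm (t • w) w w = (‖w‖ / (1 + (t * ‖w‖) ^ 2)) ^ 2 := by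
  have h : (inner ℂ (t • w) w : ℂ) = ((t * ‖w‖ ^ 2 : ℝ) : ℂ) := by
    rw [← Complex.coe_smul, inner_smul_left, inner_self_eq_norm_sq_to_K]
    simp
  rw [fubiniStudyForm_apply, inner_model_eq_re (t • w), h, Complex.ofReal_re, Complex.ofReal_im,
    real_inner_self_eq_norm_sq, norm_smul, mul_pow, Real.norm_eq_abs, sq_abs]
  have : 1 + t ^ 2 * ‖w‖ ^ 2 ≠ 0 := by positivity
  rw [mul_pow t]
  field_simp
  ring

lemma unitaryChart_symm_zero (hR : R p = homVec 0 0) (hp0 : p ≠ 0) :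
    (unitaryChart R).symm 0 = proj p hp0 := by
  rw [unitaryChart_symm_apply]
  congr 1
  rw [unitaryLift, ← hR, R.symm_apply_apply]

/-- The path `t ↦ t w` has speed `|w| / (1 + t² |w|²)`, with primitive `arctan (t |w|)`. -/
lemma geodesicEDist_le_arctan (hR : R p = homVec 0 0) (hp0 : p ≠ 0) (w : Model) :
    geodesicEDist fubiniStudy (proj p hp0) ((unitaryChart R).symm w) ≤
      ENNReal.ofReal (Real.arctan ‖w‖) := by
  have hs : ContMDiff 𝓘(ℝ, Model) 𝓘(ℝ, Model) ∞ (unitaryChart R).symm :=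
    contMDiffOn_univ.1 (contMDiffOn_symm_of_mem_maximalAtlas (unitaryChart_mem_maximalAtlas R))
  have hl : ContDiff ℝ ∞ fun t : ℝ => t • w := contDiff_id.smul contDiff_const
  have hγ : ContMDiff 𝓘(ℝ, ℝ) 𝓘(ℝ, Model) 1 fun t : ℝ => (unitaryChart R).symm (t • w) :=
    (hs.comp hl.contMDiff).of_le (by simp)
  have hb : ∀ t : ℝ, vectorNorm fubiniStudy ((unitaryChart R).symm (t • w))
      (mfderiv 𝓘(ℝ, ℝ) 𝓘(ℝ, Model) (fun t : ℝ => (unitaryChart R).symm (t • w)) t (1 : ℝ)) ≤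
      ‖w‖ / (1 + (t * ‖w‖) ^ 2) := fun t => by
    have h1 := mfderiv_comp (I := 𝓘(ℝ, ℝ)) (I' := 𝓘(ℝ, Model)) (I'' := 𝓘(ℝ, Model)) t
      ((hs (t • w)).mdifferentiableAt (by simp))
      (hl.contMDiff.mdifferentiableAt (x := t) (by simp))
    have h2 : mfderiv 𝓘(ℝ, ℝ) 𝓘(ℝ, Model) (fun t : ℝ => t • w) t (1 : ℝ) = w := by
      rw [mfderiv_eq_fderiv]
      change fderiv ℝ (fun t : ℝ => t • w) t 1 = w
      have : HasDerivAt (fun t : ℝ => t • w) ((1 : ℝ) • w) t := (hasDerivAt_id t).smul_const w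
      rw [fderiv_apply_one_eq_deriv, this.deriv, one_smul]
    have h3 : mfderiv 𝓘(ℝ, ℝ) 𝓘(ℝ, Model) (fun t : ℝ => (unitaryChart R).symm (t • w)) t (1 : ℝ) =
        mfderiv 𝓘(ℝ, Model) 𝓘(ℝ, Model) (unitaryChart R).symm (t • w) w :=
      (congrArg (fun T => T (1 : ℝ)) h1).trans
        (congrArg (mfderiv 𝓘(ℝ, Model) 𝓘(ℝ, Model) (unitaryChart R).symm (t • w)) h2)
    have h4 := (chartMetric_unitaryChart R (t • w) w w).trans (fubiniStudyForm_ray w t)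
    rw [h3, vectorNorm]
    refine (congrArg Real.sqrt h4).le.trans ?_
    rw [Real.sqrt_sq (by positivity)]
  have hℓ : ∀ t : ℝ, HasDerivAt (fun t : ℝ => Real.arctan (t * ‖w‖)) (‖w‖ / (1 + (t * ‖w‖) ^ 2)) t :=
    fun t => by
      have : HasDerivAt (fun t : ℝ => Real.arctan (t * ‖w‖))
          (1 / (1 + (t * ‖w‖) ^ 2) * (1 * ‖w‖)) t := ((hasDerivAt_id t).mul_const ‖w‖).arctan
      rwa [one_mul, one_div_mul_eq_div] at this
  have hc : Continuous fun t : ℝ => ‖w‖ / (1 + (t * ‖w‖) ^ 2) :=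
    Continuous.div (by fun_prop) (by fun_prop) fun t => by positivity
  have := geodesicEDist_le_of_hasDerivAt fubiniStudy hγ hℓ hc hb
  simp only [zero_smul, one_smul, unitaryChart_symm_zero hR hp0, zero_mul, one_mul,
    Real.arctan_zero, sub_zero] at this
  exact this

/-- The Fubini–Study distance in centered affine coordinates. -/
lemma geodesicEDist_symm_eq (hp : ‖p‖ = 1) (hR : R p = homVec 0 0) (hp0 : p ≠ 0) (w : Model) :
    geodesicEDist fubiniStudy (proj p hp0) ((unitaryChart R).symm w) =
      ENNReal.ofReal (Real.arctan ‖w‖) := by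
  refine le_antisymm (geodesicEDist_le_arctan hR hp0 w) ?_
  have := ofReal_arccos_overlap_le hp hp0 ((unitaryChart R).symm w)
  rwa [overlap_unitaryChart_symm hR, half_arccos_eq_arctan (norm_nonneg w)] at this

lemma geodesicEDist_of_notMem (hp : ‖p‖ = 1) (hR : R p = homVec 0 0) (hp0 : p ≠ 0) {Q : CP2}
    (hQ : Q ∉ (unitaryChart R).source) :
    ENNReal.ofReal (Real.pi / 2) ≤ geodesicEDist fubiniStudy (proj p hp0) Q := by
  have := ofReal_arccos_overlap_le hp hp0 Q
  rw [overlap_eq_zero hR hQ, mul_zero, zero_sub, Real.arccos_neg_one] at this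
  rwa [div_eq_inv_mul, ← one_div]

lemma exists_unit_proj (P : CP2) : ∃ (p : HomSpace) (hp0 : p ≠ 0), ‖p‖ = 1 ∧ proj p hp0 = P := by
  have h1 : ((‖P.rep‖ : ℂ)⁻¹) ≠ 0 := inv_ne_zero (by exact_mod_cast norm_ne_zero_iff.2 P.rep_nonzero)
  refine ⟨(‖P.rep‖ : ℂ)⁻¹ • P.rep, smul_ne_zero h1 P.rep_nonzero, ?_, ?_⟩
  · exact norm_smul_inv_norm (𝕜 := ℂ) P.rep_nonzero
  · conv_rhs => rw [← P.mk_rep]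
    rw [Projectivization.mk_eq_mk_iff']
    exact ⟨_, rfl⟩

/-- Every point is the center of unitary affine coordinates in which the distance is standard. -/
lemma exists_centered_unitaryChart (P : CP2) : ∃ R : HomSpace ≃ₗᵢ[ℂ] HomSpace,
    (unitaryChart R).symm 0 = P ∧
    (∀ w, geodesicEDist fubiniStudy P ((unitaryChart R).symm w) =
      ENNReal.ofReal (Real.arctan ‖w‖)) ∧
    ∀ Q ∉ (unitaryChart R).source, ENNReal.ofReal (Real.pi / 2) ≤ geodesicEDist fubiniStudy P Q := by
  obtain ⟨p, hp0, hp, rfl⟩ := exists_unit_proj P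
  obtain ⟨R, hR⟩ := exists_unitary_frame hp
  exact ⟨R, unitaryChart_symm_zero hR hp0, geodesicEDist_symm_eq hp hR hp0,
    fun Q hQ => geodesicEDist_of_notMem hp hR hp0 hQ⟩

end Distance

/-! ### Smoothness and positivity of a metric with a radial chart. -/

section RadialMetric

variable {M : Type*} [TopologicalSpace M] [ChartedSpace Model M] {g : MetricField Model M}
  {e : OpenPartialHomeomorph M Model} {P : M} {A ψ : ℝ → ℝ} {L : ℝ}

lemma IsRadialChart.isRiemannianMetricOn (hC : IsRadialChart g e P ψ)
    (hR : IsRadialProfile A ψ L) : IsRiemannianMetricOn g e.source where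
  isOpen := e.open_source
  symm Q hQ u v := by rw [hC.apply_eq hQ, hC.apply_eq hQ, IsRadialProfile.radialForm_symm]
  pos Q hQ u hu := by
    rw [hC.apply_eq hQ]
    refine hR.radialForm_pos _ fun h => hu ?_
    refine (chartDeriv_bijective hC.mem hQ).1 (h.trans ?_)
    exact (map_zero (mfderiv 𝓘(ℝ, Model) 𝓘(ℝ, Model) e Q)).symm
  smooth e' he' u v := by
    have h1 : ∀ x ∈ e'.target ∩ e'.symm ⁻¹' e.source, chartMetric g e' x u v =
        radialForm ψ ((e ∘ e'.symm) x) (fderiv ℝ (e ∘ e'.symm) x u)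
          (fderiv ℝ (e ∘ e'.symm) x v) := fun x hx => by
      rw [chartMetric_transition g hC.mem he' hx.1 hx.2, hC.metric]
    refine ContDiffOn.congr (fun x hx => ?_) h1
    have h2 : ContDiffAt ℝ ∞ (e ∘ e'.symm) x := contDiffAt_transition hC.mem he' hx.1 hx.2
    have h3 : ContDiffAt ℝ ∞ (fderiv ℝ (e ∘ e'.symm)) x := h2.fderiv_right (by simp)
    exact (((hR.contDiff_radialForm.contDiffAt.comp x h2).clm_apply
      (h3.clm_apply contDiffAt_const)).clm_apply (h3.clm_apply contDiffAt_const)).contDiffWithinAt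

lemma chartDeriv_smul (e : OpenPartialHomeomorph M Model) (P : M) (c : ℝ)
    (v : TangentSpace 𝓘(ℝ, Model) P) : chartDeriv e P (c • v) = c • chartDeriv e P v :=
  map_smul (mfderiv 𝓘(ℝ, Model) 𝓘(ℝ, Model) e P) c v

end RadialMetric

/-! ### The injectivity radius of the Fubini–Study metric. -/

section FubiniStudyRays

variable (R : HomSpace ≃ₗᵢ[ℂ] HomSpace)

/-- The homogeneous coordinates of the unit speed geodesic from the center of `unitaryChart R`
in the direction `ξ`. -/
def greatCircle (ξ : Model) (θ : ℝ) : HomSpace :=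
  R.symm (Real.cos θ • homVec 0 0 + Real.sin θ • homVecLinear 0 ξ)

lemma continuous_greatCircle (ξ : Model) : Continuous (greatCircle R ξ) :=
  R.symm.continuous.comp (by fun_prop)

lemma homVecLinear_ne_zero {ξ : Model} (hξ : ξ ≠ 0) : homVecLinear 0 ξ ≠ 0 := fun h => hξ <| by
  have h1 := inner_homVecLinear 0 ξ ξ
  rwa [h, inner_zero_left, eq_comm, inner_self_eq_zero] at h1

lemma greatCircle_ne_zero {ξ : Model} (hξ : ξ ≠ 0) (θ : ℝ) : greatCircle R ξ θ ≠ 0 := by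
  refine map_ne_zero_of_isometry R.symm fun h => ?_
  have hcos : Real.cos θ = 0 := by
    have := congrArg (fun z : HomSpace => z 0) h
    simpa [homVec_same, homVecLinear_same, -Complex.ofReal_cos] using this
  have hsin : Real.sin θ ≠ 0 := fun hs => by
    have := Real.sin_sq_add_cos_sq θ
    simp [hcos, hs] at this
  rw [hcos, zero_smul, zero_add, smul_eq_zero] at h
  exact h.elim hsin (homVecLinear_ne_zero hξ)

/-- The homogeneous form of the ray stays continuous through `θ = π / 2`, where the affine point
escapes to infinity. -/
lemma unitaryChart_symm_tan {ξ : Model} (hξ : ξ ≠ 0) {θ : ℝ} (hθ : Real.cos θ ≠ 0) :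
    (unitaryChart R).symm (Real.tan θ • ξ) =
      proj (greatCircle R ξ θ) (greatCircle_ne_zero R hξ θ) := by
  rw [unitaryChart_symm_apply, Projectivization.mk_eq_mk_iff']
  refine ⟨((Real.cos θ)⁻¹ : ℝ), ?_⟩
  rw [greatCircle, unitaryLift, ← map_smul, Complex.coe_smul, smul_add, smul_smul, smul_smul,
    inv_mul_cancel₀ hθ, one_smul, homVec_eq_add 0 (Real.tan θ • ξ), map_smul, Real.tan_eq_sin_div_cos,
    div_eq_inv_mul]

variable {R} {P : CP2}

/-- The geodesics of length `π / 2` from the center of `unitaryChart R` end on the line at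
infinity. -/
lemma geodesic_apply_one (hC : IsRadialChart fubiniStudy (unitaryChart R) P fun _ => 1)
    {v : TangentSpace 𝓘(ℝ, Model) P} {γ : ℝ → CP2} {ξ : Model} (hξ : ‖ξ‖ = 1)
    (hv : chartDeriv (unitaryChart R) P v = (Real.pi / 2) • ξ)
    (hγ : IsGeodesicFrom fubiniStudy univ P v γ) :
    γ 1 = proj (greatCircle R ξ (Real.pi / 2))
      (greatCircle_ne_zero R (norm_ne_zero_iff.1 (hξ ▸ one_ne_zero)) _) := by
  have := t2Space_CP2
  have hξ0 : ξ ≠ 0 := norm_ne_zero_iff.1 (hξ ▸ one_ne_zero)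
  have hpi := Real.pi_pos
  have h1 : ∀ t ∈ Ico (0 : ℝ) 1, γ t =
      proj (greatCircle R ξ (t * (Real.pi / 2))) (greatCircle_ne_zero R hξ0 _) := by
    rintro t ⟨ht0, ht1⟩
    have hθ0 : 0 ≤ t * (Real.pi / 2) := by positivity
    have hθ1 : t * (Real.pi / 2) < Real.pi / 2 := by nlinarith
    have hlen : t * ‖chartDeriv (unitaryChart R) P v‖ < Real.pi / 2 := by
      rw [hv, norm_smul, hξ, mul_one, Real.norm_of_nonneg (by positivity)]
      exact hθ1
    have htan : 0 ≤ Real.tan (t * (Real.pi / 2)) := Real.tan_nonneg_of_nonneg_of_le_pi_div_two hθ0 hθ1.le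
    have hray := isRadialProfile_fubiniStudy.radialInv_smul hξ (Real.tan (t * (Real.pi / 2)))
    rw [mul_arctanQuot_sq htan, Real.arctan_tan (by linarith) hθ1] at hray
    rw [hC.geodesic_eq isRadialProfile_fubiniStudy hγ ht0 ht1.le hlen, hv, smul_smul, hray,
      unitaryChart_symm_tan R hξ0 (Real.cos_pos_of_mem_Ioo ⟨by linarith, hθ1⟩).ne']
  obtain ⟨⟨ε, hε, hgeo⟩, -⟩ := hγ
  have h2 : Tendsto γ (𝓝[<] 1) (𝓝 (γ 1)) :=
    ((hgeo.smooth.continuousOn.continuousAt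
      (Ioo_mem_nhds (by linarith) (by linarith))).tendsto).mono_left nhdsWithin_le_nhds
  have hcont : Continuous fun t : ℝ =>
      proj (greatCircle R ξ (t * (Real.pi / 2))) (greatCircle_ne_zero R hξ0 _) :=
    continuous_proj_comp ((continuous_greatCircle R ξ).comp (by fun_prop)) _
  have h3 := (hcont.tendsto 1).mono_left (nhdsWithin_le_nhds (s := Iio 1))
  have h4 := tendsto_nhds_unique_of_eventuallyEq h2 h3 (by
    filter_upwards [Ico_mem_nhdsLT (zero_lt_one (α := ℝ))] with t ht using h1 t ht)
  simpa only [one_mul] using h4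

/-- Opposite vectors of length `π / 2` have the same endpoint, the class of `ξ` on the line at
infinity, so the exponential map is not injective on that sphere. -/
lemma injRadius_fubiniStudy (hC : IsRadialChart fubiniStudy (unitaryChart R) P fun _ => 1) :
    injRadius fubiniStudy univ P = ENNReal.ofReal (Real.pi / 2) := by
  have := t2Space_CP2
  have hpi := Real.pi_pos
  refine hC.injRadius_eq isRadialProfile_fubiniStudy (subset_univ _) fun hdom hinj => ?_
  obtain ⟨ξ, hξ⟩ := exists_norm_eq Model (zero_le_one (α := ℝ))
  have hξ0 : ξ ≠ 0 := norm_ne_zero_iff.1 (hξ ▸ one_ne_zero)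
  obtain ⟨v, hv⟩ := (chartDeriv_bijective hC.mem hC.mem_source).2 ((Real.pi / 2) • ξ)
  have hv' : chartDeriv (unitaryChart R) P ((-1 : ℝ) • v) = (Real.pi / 2) • (-ξ) := by
    rw [chartDeriv_smul, hv, neg_one_smul, smul_neg]
  have hn : ‖chartDeriv (unitaryChart R) P v‖ = Real.pi / 2 := by
    rw [hv, norm_smul, hξ, mul_one, Real.norm_of_nonneg (by positivity)]
  have hn' : ‖chartDeriv (unitaryChart R) P ((-1 : ℝ) • v)‖ = Real.pi / 2 := by
    rw [hv', norm_smul, norm_neg, hξ, mul_one, Real.norm_of_nonneg (by positivity)]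
  have hexp : ∀ {v : TangentSpace 𝓘(ℝ, Model) P} {η : Model} (hη : ‖η‖ = 1),
      chartDeriv (unitaryChart R) P v = (Real.pi / 2) • η → v ∈ expDomain fubiniStudy univ P →
      expMap fubiniStudy univ P v = proj (greatCircle R η (Real.pi / 2))
        (greatCircle_ne_zero R (norm_ne_zero_iff.1 (hη ▸ one_ne_zero)) _) := fun hη hv hd => by
    have hd' : ∃ γ, IsGeodesicFrom fubiniStudy univ P _ γ := hd
    rw [expMap, dif_pos hd']
    exact geodesic_apply_one hC hη hv hd'.choose_spec
  have heq : expMap fubiniStudy univ P v = expMap fubiniStudy univ P ((-1 : ℝ) • v) := by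
    rw [hexp hξ hv (hdom _ hn), hexp (by rwa [norm_neg]) hv' (hdom _ hn'),
      Projectivization.mk_eq_mk_iff']
    refine ⟨-1, ?_⟩
    simp [greatCircle]
  have hvv := congrArg (chartDeriv (unitaryChart R) P) (hinj hn hn' heq)
  rw [hv, hv', smul_neg, eq_neg_iff_add_eq_zero, ← add_smul, smul_eq_zero] at hvv
  exact hvv.elim (by positivity) hξ0

end FubiniStudyRays

/-! ### The deformed metric in a centred chart. -/

section Deformation

/-- As `arctan |w| < π / 2` on the chart and the distance is at least `π / 2` off it, `B_P` is the
chart domain; there `tan² r_P = |w|²`. -/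
lemma exists_radialChart (P : CP2) : ∃ R : HomSpace ≃ₗᵢ[ℂ] HomSpace,
    IsRadialChart fubiniStudy (unitaryChart R) P (fun _ => 1) ∧
    injBall fubiniStudy P = (unitaryChart R).source ∧
    ∀ Q ∈ (unitaryChart R).source,
      phi (fsDist P Q) = deformFactor (‖unitaryChart R Q‖ ^ 2) := by
  obtain ⟨R, h0, hd, hfar⟩ := exists_centered_unitaryChart P
  have hC : IsRadialChart fubiniStudy (unitaryChart R) P fun _ => 1 := {
    mem := unitaryChart_mem_maximalAtlas R
    target := rfl
    mem_source := h0 ▸ (unitaryChart R).map_target (mem_univ 0)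
    center := h0 ▸ (unitaryChart R).right_inv (mem_univ 0)
    metric := fun x u v => by
      rw [chartMetric_unitaryChart, radialForm, one_pow, one_smul] }
  have hdist : ∀ Q ∈ (unitaryChart R).source, geodesicEDist fubiniStudy P Q =
      ENNReal.ofReal (Real.arctan ‖unitaryChart R Q‖) := fun Q hQ => by
    rw [← hd, (unitaryChart R).left_inv hQ]
  refine ⟨R, hC, ?_, fun Q hQ => ?_⟩
  · ext Q
    rw [injBall, mem_ofPred_eq, injRadius_fubiniStudy hC]
    by_cases hQ : Q ∈ (unitaryChart R).source
    · rw [hdist Q hQ, ENNReal.ofReal_lt_ofReal_iff (by positivity)]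
      exact iff_of_true (Real.arctan_lt_pi_div_two _) hQ
    · exact iff_of_false (hfar Q hQ).not_gt hQ
  · rw [fsDist, hdist Q hQ, ENNReal.toReal_ofReal (Real.arctan_nonneg.2 (norm_nonneg _)),
      phi_arctan (norm_nonneg _)]

variable {R : HomSpace ≃ₗᵢ[ℂ] HomSpace} {P : CP2}

lemma isRadialChart_deformedMetric
    (hC : IsRadialChart fubiniStudy (unitaryChart R) P fun _ => 1)
    (hphi : ∀ Q ∈ (unitaryChart R).source,
      phi (fsDist P Q) = deformFactor (‖unitaryChart R Q‖ ^ 2)) :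
    IsRadialChart (deformedMetric P) (unitaryChart R) P deformFactor where
  mem := hC.mem
  target := hC.target
  mem_source := hC.mem_source
  center := hC.center
  metric x u v := by
    have h1 : chartMetric (deformedMetric P) (unitaryChart R) x u v =
        phi (fsDist P ((unitaryChart R).symm x)) ^ 2 *
          chartMetric fubiniStudy (unitaryChart R) x u v := rfl
    have h2 : radialForm deformFactor x u v =
        deformFactor (‖x‖ ^ 2) ^ 2 * fubiniStudyForm x u v := rfl
    rw [h1, h2, hphi _ ((unitaryChart R).map_target (mem_univ x)),
      (unitaryChart R).right_inv (mem_univ x), chartMetric_unitaryChart]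

lemma contMDiffOn_phi_fsDist
    (hphi : ∀ Q ∈ (unitaryChart R).source,
      phi (fsDist P Q) = deformFactor (‖unitaryChart R Q‖ ^ 2)) :
    ContMDiffOn 𝓘(ℝ, Model) 𝓘(ℝ, ℝ) ∞ (fun Q => phi (fsDist P Q)) (unitaryChart R).source := by
  refine ContMDiffOn.congr ?_ hphi
  have h : ContDiff ℝ ∞ fun w : Model => deformFactor (‖w‖ ^ 2) :=
    contDiff_iff_contDiffAt.2 fun w =>
      (isRadialProfile_deformed.smooth_factor _ (by positivity)).comp w
        (contDiff_norm_sq ℝ).contDiffAt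
  exact h.contMDiff.comp_contMDiffOn
    (contMDiffOn_of_mem_maximalAtlas (unitaryChart_mem_maximalAtlas R))

lemma eball_zero_ofReal {F : Type*} [SeminormedAddCommGroup F] {L : ℝ} (hL : 0 < L) :
    Metric.eball (0 : F) (ENNReal.ofReal L) = {x | ‖x‖ < L} := by
  ext x
  rw [Metric.mem_eball, edist_zero_right, ← ofReal_norm, ENNReal.ofReal_lt_ofReal_iff hL,
    mem_ofPred_eq]

end Deformation

end RadialDeformation

end

theorem lemma2p4 :
    Tendsto phiFormula (𝓝[>] 0) (𝓝 1) ∧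
    phi 0 = 1 ∧
    (∀ r ∈ Ioo 0 (Real.pi / 2), phi r = phiFormula r) ∧
    ∀ P : CP2,
      injRadius fubiniStudy univ P = ENNReal.ofReal (Real.pi / 2) ∧
      (∀ Q ∈ injBall fubiniStudy P, 0 < phi (fsDist P Q)) ∧
      ContMDiffOn 𝓘(ℝ, Model) 𝓘(ℝ, ℝ) ∞ (fun Q => phi (fsDist P Q)) (injBall fubiniStudy P) ∧
      IsRiemannianMetricOn (deformedMetric P) (injBall fubiniStudy P) ∧
      ∀ e : Fin 4 → TangentSpace 𝓘(ℝ, Model) P, IsOrthonormalFrame (deformedMetric P) P e →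
        BijOn (geodesicCoord (deformedMetric P) (injBall fubiniStudy P) P e)
          (Metric.eball 0 (injRadius (deformedMetric P) (injBall fubiniStudy P) P))
          (injBall fubiniStudy P) ∧
        IsLocalDiffeomorphOn (𝓡 4) 𝓘(ℝ, Model) ∞
          (geodesicCoord (deformedMetric P) (injBall fubiniStudy P) P e)
          (Metric.eball 0 (injRadius (deformedMetric P) (injBall fubiniStudy P) P)) ∧
        ∀ x ∈ Metric.eball (0 : EuclideanSpace ℝ (Fin 4))
            (injRadius (deformedMetric P) (injBall fubiniStudy P) P),
          volumeDensity (deformedMetric P) (injBall fubiniStudy P) P e x = 1 := by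
  refine ⟨tendsto_phiFormula, phi_zero, fun r hr => phi_eq_phiFormula hr, fun P => ?_⟩
  have := t2Space_CP2
  obtain ⟨R, hC, hball, hphi⟩ := exists_radialChart P
  have hD := isRadialChart_deformedMetric hC hphi
  have hR := isRadialProfile_deformed
  rw [hball]
  refine ⟨injRadius_fubiniStudy hC, fun Q hQ => ?_, contMDiffOn_phi_fsDist hphi,
    hD.isRiemannianMetricOn hR, fun f hf => ?_⟩
  · rw [hphi Q hQ]
    exact hR.pos_factor _ (by positivity)
  obtain ⟨S, hS⟩ := hD.exists_frame_isometry hR hf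
  rw [hD.injRadius_source hR, eball_zero_ofReal hR.L_pos]
  -- `S` is an isometry, so the coordinate ball is the source of `radialDiffeo`.
  have hset : {x : EuclideanSpace ℝ (Fin 4) | ‖x‖ < phiAux₀ 0} =
      {x | ‖S.toContinuousLinearEquiv x‖ < phiAux₀ 0} := by
    ext x
    exact (congrArg (· < phiAux₀ 0) (S.norm_map x)).symm.to_iff
  have hcoord : ∀ x, ‖S.toContinuousLinearEquiv x‖ < phiAux₀ 0 →
      geodesicCoord (deformedMetric P) (unitaryChart R).source P f x =
        (unitaryChart R).symm (radialInv deformQuot (S.toContinuousLinearEquiv x)) := fun x hx => by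
    have hx' : ‖S x‖ < phiAux₀ 0 := hx
    rw [hS] at hx'
    rw [geodesicCoord, hD.expMap_eq hR subset_rfl hx', ← hS]
    rfl
  refine ⟨hset ▸ hD.bijOn hR _ hcoord, hset ▸ hD.isLocalDiffeomorphOn hR _ hcoord, fun x hx => ?_⟩
  exact hD.volumeDensity_eq_one hR subset_rfl (fun s hs => deformQuot_cube hs) hS hx
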